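/- **Problem.** Let $d\ge1$, $\Omega=\prod_{r=1}^d(a^{(r)},b^{(r)})$ with side lengths $L^{(r)}=b^{(r)}-a^{(r)}>0$, $T\ge 1$, and let $\alpha:[0,T]\to[\underline\alpha,\overline\alpha]\subset(0,1)$ be continuous. Let $f$ be continuous on $\overline\Omega\times[0,T]$ and let $u$ solve $${}^C_0\mathcal D_t^{\alpha(t)}u=\Delta u+f\ \text{ in }\Omega\times(0,T],\qquad u(\cdot,0)=\varphi\ \text{ on }\overline\Omega,\qquad u=0\ \text{ on }\partial\Omega\times[0,T],$$ where ${}^C_0\mathcal D_t^{\alpha(t)}v(t)=\frac1{\Gamma(1-\alpha(t))}\int_0^t v'(\tau)(t-\tau)^{-\alpha(t)}\,d\tau$. Assume $u\in C^{(6,3)}(\overline\Omega\times[0,T])$, i.e. all derivatives $\partial_x^\beta\partial_t^p u$ with $|\beta|\le6$, $p\le3$ exist and are continuous up to the boundary. Put $c_1=\max_{0\le t\le T}t^{\alpha(t)}\Gamma(1-\alpha(t))$. **Discretization.** Let $n\ge1$, $m^{(r)}\ge1$ be integers, $\Delta t=T/n$, $t_k=k\Delta t$, $\Delta x^{(r)}=L^{(r)}/m^{(r)}$,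 $\Delta x=\max_r\Delta x^{(r)}$, $0<\epsilon\le 1/e$. For $0\le k\le n-1$ let $\sigma_k\in(\frac12,1)$ satisfy $\sigma_k=1-\frac12\alpha(t_k+\sigma_k\Delta t)$; write $t_{k+\sigma_k}=t_k+\sigma_k\Delta t$ and $\alpha_k=\alpha(t_{k+\sigma_k})$. Grid points are $\mathbf x_j=(a^{(r)}+j^{(r)}\Delta x^{(r)})_r$ with $0\le j^{(r)}\le m^{(r)}$; $\mathcal J$ is the set of indices with $1\le j^{(r)}\le m^{(r)}-1$ for all $r$, and $\partial\mathcal J$ is the set of the other indices. Let $e_r$ denote the $r$-th unit index vector. **Exponential sum.** Let $h=2\pi/\big(\log3+\overline\alpha\log\frac1{\cos1}+\log\frac1\epsilon\big)$, $\lambda_i=e^{ih}$, $\theta_i^{(k)}=he^{\alpha_k ih}/\Gamma(\alpha_k)$. Integers $\underline N,\overline N$ are called $\epsilon$-accurate if, for $1\le k\le n-1$ and $0\le\tau\le t_k$, $$\Big|\Big(\tfrac{t_{k+\sigma_k}-\tau}T\Big)^{-\alpha_k}-\sum_{i=\underline N+1}^{\overline N}\theta_i^{(k)}e^{-\lambda_i(t_{k+\sigma_k}-\tau)/T}\Big|\le\epsilon\Big(\tfrac{t_{k+\sigma_k}-\tau}T\Big)^{-\alpha_k}.$$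 **FL2-1$_\sigma$ formula.** For a sequence $v^0,\dots,v^n$ put $${}^{FH}\mathcal D v^{k+\sigma_k}=\frac{T^{-\alpha_k}}{\Gamma(1-\alpha_k)}\sum_{i=\underline N+1}^{\overline N}\theta_i^{(k)}H_i^{(k)}+\frac{\Delta t^{-\alpha_k}\sigma_k^{1-\alpha_k}}{\Gamma(2-\alpha_k)}(v^{k+1}-v^k),\qquad 0\le k\le n-1,$$ where $H_i^{(0)}=0$ and, for $k\ge1$, $H_i^{(k)}=e^{-\lambda_i(1+\sigma_k-\sigma_{k-1})\Delta t/T}H_i^{(k-1)}+A_i^{(k)}(v^k-v^{k-1})+B_i^{(k)}(v^{k+1}-v^k)$ with $$A_i^{(k)}=\int_0^1(\tfrac32-\tau)e^{-\lambda_i(\sigma_k+1-\tau)\Delta t/T}d\tau,\qquad B_i^{(k)}=\int_0^1(\tau-\tfrac12)e^{-\lambda_i(\sigma_k+1-\tau)\Delta t/T}d\tau .$$ **Scheme and norms.** For grid functions $w$ let $\delta_rw_{j+\frac12e_r}=(w_{j+e_r}-w_j)/\Delta x^{(r)}$ and $\delta_r^2w_j=(w_{j+e_r}-2w_j+w_{j-e_r})/(\Delta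 x^{(r)})^2$. Let $\mathcal A_rw_j=\frac1{12}(w_{j-e_r}+10w_j+w_{j+e_r})$ if $1\le j^{(r)}\le m^{(r)}-1$, and $\mathcal A_rw_j=w_j$ if $j^{(r)}\in\{0,m^{(r)}\}$. Let $\mathcal A_h=\prod_r\mathcal A_r$, $\Delta_h=\sum_r\delta_r^2$, $\Lambda_h=\sum_r\prod_{l\ne r}\mathcal A_l\,\delta_r^2$. The scheme is $$\mathcal A_h\,{}^{FH}\mathcal D u_j^{k+\sigma_k}=\Lambda_h\big(\sigma_ku_j^{k+1}+(1-\sigma_k)u_j^k\big)+\mathcal A_hf(\mathbf x_j,t_{k+\sigma_k}),\quad j\in\mathcal J,\ 0\le k\le n-1,$$ with $u_j^0=\varphi(\mathbf x_j)$ for $j\in\mathcal J$ and $u_j^k=0$ for $j\in\partial\mathcal J$, $0\le k\le n$. The local truncation error $S_j^k$ is the left side minus the right side of the scheme when $u_j^k$ is replaced by $u(\mathbf x_j,t_k)$. Let $(v,w)=\big(\prod_r\Delta x^{(r)}\big)\sum_{j\in\mathcal J}v_jw_j$, $|w|_{1,\mathcal A_h}=\sqrt{(\mathcal A_hw,-\Delta_hw)}$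 and $$|w|_1^2=\Big(\prod_r\Delta x^{(r)}\Big)\sum_{k=1}^d\ \sum_{0\le j^{(k)}\le m^{(k)}-1}\ \sum_{\substack{1\le j^{(l)}\le m^{(l)}-1\\ l\ne k}}\big(\delta_kw_{j+\frac12e_k}\big)^2 .$$ **Theorem.** 1. For every discretization, $\epsilon$-accurate integers $\underline N,\overline N$ exist. 2. There is a constant $c_0>0$, independent of $n$, $m^{(r)}$, $\epsilon$, $\sigma_k$, $\underline N$, $\overline N$, such that for every discretization and all $\epsilon$-accurate $\underline N,\overline N$, $$|S_j^k|\le c_0(\Delta t^2+\Delta x^4+\epsilon),\qquad j\in\mathcal J,\ 0\le k\le n-1.$$ 3. For every discretization, all $\epsilon$-accurate $\underline N,\overline N$, every solution $(u_j^k)$ of the scheme, and every $c_0\ge0$ for which the bound in 2 holds for this discretization, the error $e_j^k=u(\mathbf x_j,t_k)-u_j^k$ satisfies, for $0\le k\le n$, $$|e^k|_{1,\mathcal A_h}\le\sqrt{\Big(\frac32\Big)^{d-1}\frac{c_1}{1-\epsilon}\prod_{r=1}^dL^{(r)}}\;c_0(\Delta t^2+\Delta x^4+\epsilon),$$ $$|e^k|_1\le\sqrt{\Big(\frac32\Big)^{2d-1}\frac{c_1}{1-\epsilon}\prod_{r=1}^dL^{(r)}}\;c_0(\Delta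 t^2+\Delta x^4+\epsilon).$$ -/

import Mathlib

namespace FL21

noncomputable section

/-! ### The continuous problem -/

/-- Variable-order Caputo derivative
`(1 / Γ(1 - α(t))) ∫₀ᵗ v'(τ) (t - τ)^(-α(t)) dτ`. -/
def caputo (α : ℝ → ℝ) (v : ℝ → ℝ) (t : ℝ) : ℝ :=
  1 / Real.Gamma (1 - α t) * ∫ τ in (0 : ℝ)..t, deriv v τ / (t - τ) ^ α t

/-- Data of the time-fractional sub-diffusion problem on the box `∏ (a k, b k)` and the
time interval `[0, T]`: variable order `α`, source term `f`, initial value `φ`. -/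
structure Problem (d : ℕ) where
  a : Fin d → ℝ
  b : Fin d → ℝ
  a_lt_b : ∀ k, a k < b k
  T : ℝ
  one_le_T : 1 ≤ T
  α : ℝ → ℝ
  αlo : ℝ
  αhi : ℝ
  αlo_pos : 0 < αlo
  αhi_lt_one : αhi < 1
  α_mem : ∀ t ∈ Set.Icc 0 T, α t ∈ Set.Icc αlo αhi
  α_cont : ContinuousOn α (Set.Icc 0 T)
  f : (Fin d → ℝ) → ℝ → ℝ
  f_cont : ContinuousOn (fun z : (Fin d → ℝ) × ℝ => f z.1 z.2) (Set.Icc a b ×ˢ Set.Icc 0 T)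
  φ : (Fin d → ℝ) → ℝ

namespace Problem

variable {d : ℕ} (P : Problem d)

/-- The open box. -/
def Ω : Set (Fin d → ℝ) := Set.univ.pi fun k => Set.Ioo (P.a k) (P.b k)

/-- The spatial Laplacian `∑ₖ ∂²u/∂(x⁽ᵏ⁾)²` at `(x, t)`. -/
def laplacian (u : (Fin d → ℝ) → ℝ → ℝ) (x : Fin d → ℝ) (t : ℝ) : ℝ :=
  ∑ k, iteratedDeriv 2 (fun s => u (Function.update x k s) t) (x k)

/-- `u` solves the initial-boundary value problem. -/
structure IsSolution (u : (Fin d → ℝ) → ℝ → ℝ) : Prop where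
  equation : ∀ x ∈ P.Ω, ∀ t ∈ Set.Ioc 0 P.T,
    caputo P.α (u x) t = laplacian u x t + P.f x t
  initial : ∀ x ∈ closure P.Ω, u x 0 = P.φ x
  boundary : ∀ x ∈ frontier P.Ω, ∀ t ∈ Set.Icc 0 P.T, u x t = 0

/-- The class `C^(6,3)` on the closed box times `[0, T]`: all mixed derivatives
`∂ₓ^β ∂ₜ^p u` with `|β| ≤ 6`, `p ≤ 3` exist (one-sided at the boundary) and are continuous up to
the boundary. `D β p` is the derivative `∂ₓ^β ∂ₜ^p u`. -/
def IsC63 (u : (Fin d → ℝ) → ℝ → ℝ) : Prop :=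
  ∃ D : (Fin d → ℕ) → ℕ → (Fin d → ℝ) → ℝ → ℝ,
    (∀ x ∈ Set.Icc P.a P.b, ∀ t ∈ Set.Icc 0 P.T, D 0 0 x t = u x t) ∧
    (∀ β p, ∑ k, β k ≤ 6 → p ≤ 3 →
      ContinuousOn (fun z : (Fin d → ℝ) × ℝ => D β p z.1 z.2)
        (Set.Icc P.a P.b ×ˢ Set.Icc 0 P.T)) ∧
    (∀ β p, ∑ k, β k < 6 → p ≤ 3 → ∀ k, ∀ x ∈ Set.Icc P.a P.b, ∀ t ∈ Set.Icc 0 P.T,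
      HasDerivWithinAt (fun s => D β p (Function.update x k s) t)
        (D (β + Pi.single k 1) p x t) (Set.Icc (P.a k) (P.b k)) (x k)) ∧
    (∀ β p, ∑ k, β k ≤ 6 → p < 3 → ∀ x ∈ Set.Icc P.a P.b, ∀ t ∈ Set.Icc 0 P.T,
      HasDerivWithinAt (fun s => D β p x s) (D β (p + 1) x t) (Set.Icc 0 P.T) t)

/-- `c₁ = max_{0 ≤ t ≤ T} t^α(t) Γ(1 - α(t))`. -/
def c₁ : ℝ := sSup ((fun t => t ^ P.α t * Real.Gamma (1 - P.α t)) '' Set.Icc 0 P.T)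

end Problem

/-! ### Discretization parameters and the exponential-sum approximation -/

/-- Discretization parameters: `n` time steps, `m k` mesh intervals in the `k`-th direction,
expected accuracy `ε`, and the shifts `σ k`. -/
structure Discretization {d : ℕ} (P : Problem d) where
  n : ℕ
  n_pos : 0 < n
  m : Fin d → ℕ
  m_pos : ∀ k, 0 < m k
  ε : ℝ
  ε_pos : 0 < ε
  ε_le : ε ≤ 1 / Real.exp 1
  σ : ℕ → ℝ
  σ_mem : ∀ k < n, σ k ∈ Set.Ioo (1 / 2 : ℝ) 1
  σ_root : ∀ k < n, σ k = 1 - P.α (k * (P.T / n) + σ k * (P.T / n)) / 2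

namespace Discretization

variable {d : ℕ} {P : Problem d} (M : Discretization P)

/-- The time step. -/
def Δt : ℝ := P.T / M.n

/-- The time level `t_k`. -/
def t (k : ℕ) : ℝ := k * M.Δt

/-- The shifted time `t_{k+σ_k}`. -/
def tσ (k : ℕ) : ℝ := M.t k + M.σ k * M.Δt

/-- The order `α_{k+σ_k} = α(t_{k+σ_k})`. -/
def ασ (k : ℕ) : ℝ := P.α (M.tσ k)

/-- The step of the quadrature. -/
def h : ℝ :=
  2 * Real.pi / (Real.log 3 + P.αhi * Real.log (Real.cos 1)⁻¹ + Real.log M.ε⁻¹)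

/-- The quadrature exponents. -/
def lam (i : ℤ) : ℝ := Real.exp (i * M.h)

/-- The quadrature weights `θ_i^(k)`. -/
def θ (k : ℕ) (i : ℤ) : ℝ := M.h * Real.exp (M.ασ k * i * M.h) / Real.Gamma (M.ασ k)

/-- The exponential sum over `Nlo < i ≤ Nhi` approximates the kernel
`((t_{k+σ_k} - τ)/T)^(-α_{k+σ_k})` with relative accuracy `ε` on `[0, t_k]`. -/
def ESAAccurate (Nlo Nhi : ℤ) : Prop :=
  ∀ k, 1 ≤ k → k < M.n → ∀ τ ∈ Set.Icc 0 (M.t k),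
    |((M.tσ k - τ) / P.T) ^ (-M.ασ k)
        - ∑ i ∈ Finset.Ioc Nlo Nhi, M.θ k i * Real.exp (-M.lam i * (M.tσ k - τ) / P.T)|
      ≤ ((M.tσ k - τ) / P.T) ^ (-M.ασ k) * M.ε

/-! ### The fast formula -/

/-- `A_i^(k)`. -/
def coefA (i : ℤ) (k : ℕ) : ℝ :=
  ∫ τ in (0 : ℝ)..1, (3 / 2 - τ) * Real.exp (-M.lam i * (M.σ k + 1 - τ) * M.Δt / P.T)

/-- `B_i^(k)`. -/
def coefB (i : ℤ) (k : ℕ) : ℝ :=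
  ∫ τ in (0 : ℝ)..1, (τ - 1 / 2) * Real.exp (-M.lam i * (M.σ k + 1 - τ) * M.Δt / P.T)

/-- The history part `H_i^(k)` for the time sequence `v`, computed recursively. -/
def hist (v : ℕ → ℝ) (i : ℤ) : ℕ → ℝ
  | 0 => 0
  | k + 1 =>
      Real.exp (-M.lam i * (1 + M.σ (k + 1) - M.σ k) * M.Δt / P.T) * hist v i k
        + M.coefA i (k + 1) * (v (k + 1) - v k)
        + M.coefB i (k + 1) * (v (k + 2) - v (k + 1))

/-- `s^(k) = Δt^(-α_{k+σ_k}) / Γ(2 - α_{k+σ_k})`. -/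
def s (k : ℕ) : ℝ := M.Δt ^ (-M.ασ k) / Real.Gamma (2 - M.ασ k)

/-- The fast formula for the variable-order Caputo derivative at `t_{k+σ_k}`, applied
to the time sequence `v`. -/
def FH (Nlo Nhi : ℤ) (v : ℕ → ℝ) (k : ℕ) : ℝ :=
  P.T ^ (-M.ασ k) / Real.Gamma (1 - M.ασ k)
      * ∑ i ∈ Finset.Ioc Nlo Nhi, M.θ k i * M.hist v i k
    + M.s k * M.σ k ^ (1 - M.ασ k) * (v (k + 1) - v k)

/-! ### Grid functions, difference operators and norms

Grid functions are functions of the index vector `j : Fin d → ℤ`; only the values at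
`0 ≤ j k ≤ m k` matter. -/

/-- The mesh size in the `k`-th direction. -/
def Δx (k : Fin d) : ℝ := (P.b k - P.a k) / M.m k

/-- The maximal mesh size. -/
def Δxmax : ℝ := ⨆ k, M.Δx k

/-- The grid point with index `j`. -/
def pt (j : Fin d → ℤ) : Fin d → ℝ := fun k => P.a k + j k * M.Δx k

/-- Indices of all grid points. -/
def Jbar : Finset (Fin d → ℤ) := Fintype.piFinset fun k => Finset.Icc 0 (M.m k : ℤ)

/-- Indices of the interior grid points. -/
def J : Finset (Fin d → ℤ) := Fintype.piFinset fun k => Finset.Icc 1 ((M.m k : ℤ) - 1)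

/-- Indices of the boundary grid points. -/
def bdJ : Finset (Fin d → ℤ) := M.Jbar \ M.J

/-- The forward difference quotient `δ_k w` at `j + δ_k / 2`. -/
def δ (k : Fin d) (w : (Fin d → ℤ) → ℝ) (j : Fin d → ℤ) : ℝ :=
  1 / M.Δx k * (w (j + Pi.single k 1) - w j)

/-- The second difference quotient `δ_k² w`. -/
def δ2 (k : Fin d) (w : (Fin d → ℤ) → ℝ) (j : Fin d → ℤ) : ℝ :=
  1 / M.Δx k ^ 2 * (w (j + Pi.single k 1) - 2 * w j + w (j - Pi.single k 1))

/-- The averaging operator in the `k`-th direction; it is the identity at the two ends of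
a grid line in this direction. -/
def avg (k : Fin d) (w : (Fin d → ℤ) → ℝ) (j : Fin d → ℤ) : ℝ :=
  if j k ∈ Finset.Icc 1 ((M.m k : ℤ) - 1) then
    1 / 12 * (w (j - Pi.single k 1) + 10 * w j + w (j + Pi.single k 1))
  else w j

/-- The composition of the averaging operators over all directions. -/
def Ah (w : (Fin d → ℤ) → ℝ) : (Fin d → ℤ) → ℝ :=
  (List.finRange d).foldr (fun k v => M.avg k v) w

/-- The composition of the averaging operators over all directions except `k`. -/
def AhExcept (k : Fin d) (w : (Fin d → ℤ) → ℝ) : (Fin d → ℤ) → ℝ :=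
  ((List.finRange d).filter (fun l => l ≠ k)).foldr (fun l v => M.avg l v) w

/-- The discrete Laplacian. -/
def Δh (w : (Fin d → ℤ) → ℝ) (j : Fin d → ℤ) : ℝ := ∑ k, M.δ2 k w j

/-- The compact operator `Λ_h = ∑ₖ (∏_{l ≠ k} A_l) δ_k²`. -/
def Λh (w : (Fin d → ℤ) → ℝ) (j : Fin d → ℤ) : ℝ := ∑ k, M.AhExcept k (M.δ2 k w) j

/-- The discrete inner product over the interior grid points. -/
def ip (v w : (Fin d → ℤ) → ℝ) : ℝ := (∏ r, M.Δx r) * ∑ j ∈ M.J, v j * w j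

/-- The norm `|w|_{1,A_h} = √(A_h w, -Δ_h w)`. -/
def norm1A (w : (Fin d → ℤ) → ℝ) : ℝ := √(M.ip (M.Ah w) (fun j => -M.Δh w j))

/-- The square of `|w|_{1,k}`. -/
def sq1 (k : Fin d) (w : (Fin d → ℤ) → ℝ) : ℝ :=
  (∏ r, M.Δx r) *
    ∑ j ∈ Fintype.piFinset
      (fun l => Finset.Icc (if l = k then (0 : ℤ) else 1) ((M.m l : ℤ) - 1)),
      M.δ k w j ^ 2

/-- The norm `|w|_1`. -/
def norm1 (w : (Fin d → ℤ) → ℝ) : ℝ := √(∑ k, M.sq1 k w)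

/-! ### The difference scheme -/

/-- The residual of a grid function in the scheme (it vanishes for a solution of the scheme):
`A_h FH U - Λ_h (σ_k U^{k+1} + (1 - σ_k) U^k) - A_h f^{k+σ_k}` at the index `j`. -/
def residual (Nlo Nhi : ℤ) (U : ℕ → (Fin d → ℤ) → ℝ) (k : ℕ) (j : Fin d → ℤ) : ℝ :=
  M.Ah (fun i => M.FH Nlo Nhi (fun l => U l i) k) j
    - M.Λh (fun i => M.σ k * U (k + 1) i + (1 - M.σ k) * U k i) j
    - M.Ah (fun i => P.f (M.pt i) (M.tσ k)) j

/-- `U k j` is a solution of the difference scheme. -/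
structure IsSchemeSolution (Nlo Nhi : ℤ) (U : ℕ → (Fin d → ℤ) → ℝ) : Prop where
  scheme : ∀ k < M.n, ∀ j ∈ M.J,
    M.Ah (fun i => M.FH Nlo Nhi (fun l => U l i) k) j
      = M.Λh (fun i => M.σ k * U (k + 1) i + (1 - M.σ k) * U k i) j
        + M.Ah (fun i => P.f (M.pt i) (M.tσ k)) j
  initial : ∀ j ∈ M.J, U 0 j = P.φ (M.pt j)
  boundary : ∀ k ≤ M.n, ∀ j ∈ M.bdJ, U k j = 0

/-- The grid values of a function `u(x, t)`. -/
def restrict (u : (Fin d → ℝ) → ℝ → ℝ) (k : ℕ) (j : Fin d → ℤ) : ℝ := u (M.pt j) (M.t k)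

/-- `Δt² + Δx⁴ + ε`. -/
def order : ℝ := M.Δt ^ 2 + M.Δxmax ^ 4 + M.ε

/-- The local truncation errors of `u` are bounded by `c₀ (Δt² + Δx⁴ + ε)`. -/
def TruncationBound (Nlo Nhi : ℤ) (u : (Fin d → ℝ) → ℝ → ℝ) (c₀ : ℝ) : Prop :=
  ∀ k < M.n, ∀ j ∈ M.J, |M.residual Nlo Nhi (M.restrict u) k j| ≤ c₀ * M.order

end Discretization

end

end FL21

/-! The proof is stability plus consistency. The delicate point is that stability must hold for
every `ε`-accurate exponential sum with only `ε ≤ 1/e`.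

Exponential sum. The trapezoidal rule of step `h` is applied to `Γ(α) x^(-α) = ∫ exp(α s) exp(-x exp
s) ds`. By Poisson summation its error is the sum over `n ≠ 0` of `x^(-a) Γ(a)` with `a = α +
2πin/h`. Rotating the ray in Euler's integral by the angle 1 shows that `Γ` decays like `exp(-|Im
a|)` on vertical lines (`norm_Gamma_le`), and `h` is tuned so that the relative error is at most
`(4/5) α ε` (`full_sum`). Since all terms are positive, every partial sum satisfies the
corresponding upper bound.

Stability in time. The fast formula is a weighted sum of increments of the sequence (`FH_eq_sum`). A
positive combination of increasing exponentials is increasing and has increasing increments, so the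
weights increase away from the last one. At the last one, the margin is of size `(1 - log 2) α`, and
it beats the kernel excess `(4/5) α ε` because the latter carries the factor `α` too
(`wA_add_wB_le`). With `σ = 1 - α/2` this yields the condition on the last two weights under which
`energy_inequality` holds. Accuracy of the sum bounds the first weight below by `(1 - ε)/c₁`, and
`discrete_max_principle` then bounds the energy uniformly in time.

Stability in space. On interior grid functions, `-δ_r²` and the averages are commuting symmetric
matrices with `A_r ≥ 2/3` in the Loewner order. Testing the error equation with `-Δ_h` of the
weighted time average gives coercivity `(2/3)^(d-1)`, and Young's inequality absorbs the residual
(`energy_step`, `energy_estimate`).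

Consistency. The equation extends by continuity to the closed box, so the averages may be applied to
it at all grid points. In time, quadratic interpolation handles the history; on the last piece the
choice of `σ` cancels the linear error term (`FH_error`). In space, `A_r` turns `∂_r²` into `δ_r²`
up to fourth order (`spatial_error`). By linearity the scheme error satisfies the scheme with the
truncation error as right-hand side (`error_residual`). -/

namespace FL21

open Set Filter Topology MeasureTheory

/-! ### Decay of the Gamma function on vertical lines. -/

/-- The Laplace transform of `t ^ (a - 1)` on the right half plane. -/
theorem integral_cpow_mul_cexp_neg_mul_Ioi {a r : ℂ} (ha : 0 < a.re) (hr : 0 < r.re) :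
    ∫ t : ℝ in Ioi 0, (t : ℂ) ^ (a - 1) * Complex.exp (-(r * t)) = r ^ (-a) * Complex.Gamma a := by
  set U : Set ℂ := {z | 0 < z.re} with hU
  have hUo : IsOpen U := isOpen_lt continuous_const Complex.continuous_re
  have hmeas : ∀ (b z : ℂ), AEStronglyMeasurable
      (fun t : ℝ => (t : ℂ) ^ b * Complex.exp (-(z * t))) (volume.restrict (Ioi 0)) := by
    intro b z
    refine ContinuousOn.aestronglyMeasurable ?_ measurableSet_Ioi
    intro t ht
    refine ContinuousAt.continuousWithinAt (ContinuousAt.mul ?_ (by fun_prop))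
    exact (Complex.continuousAt_ofReal_cpow_const _ _ (Or.inr (ne_of_gt ht)))
  have hnorm : ∀ (b z : ℂ) (t : ℝ), t ∈ Ioi (0 : ℝ) →
      ‖(t : ℂ) ^ b * Complex.exp (-(z * t))‖ = t ^ b.re * Real.exp (-z.re * t ^ (1 : ℝ)) := by
    intro b z t ht
    rw [norm_mul, Complex.norm_cpow_eq_rpow_re_of_pos ht, Complex.norm_exp]
    simp
  have hbd : ∀ (c s : ℝ), -1 < s → 0 < c →
      IntegrableOn (fun t : ℝ => t ^ s * Real.exp (-c * t ^ (1 : ℝ))) (Ioi 0) :=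
    fun c s hs hc => integrableOn_rpow_mul_exp_neg_mul_rpow hs one_pos hc
  have hdiff : DifferentiableOn ℂ
      (fun z : ℂ => ∫ t : ℝ in Ioi 0, (t : ℂ) ^ (a - 1) * Complex.exp (-(z * t))) U := by
    intro z hz
    have hz' : 0 < z.re := hz
    refine DifferentiableAt.differentiableWithinAt ?_
    have := hasDerivAt_integral_of_dominated_loc_of_deriv_le (𝕜 := ℂ)
      (μ := volume.restrict (Ioi (0 : ℝ))) (x₀ := z) (s := {w | z.re / 2 < w.re})
      (F := fun z (t : ℝ) => (t : ℂ) ^ (a - 1) * Complex.exp (-(z * t)))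
      (F' := fun z (t : ℝ) => (t : ℂ) ^ (a - 1) * (Complex.exp (-(z * t)) * (-t)))
      (bound := fun t => t ^ a.re * Real.exp (-(z.re / 2) * t ^ (1 : ℝ))) ?_ ?_ ?_ ?_ ?_ ?_ ?_
    · exact this.2.differentiableAt
    · exact (isOpen_lt continuous_const Complex.continuous_re).mem_nhds (by simp; linarith)
    · exact Eventually.of_forall fun w => hmeas _ w
    · refine (hbd z.re (a - 1).re (by simp; linarith) hz').mono' (hmeas _ _) ?_
      exact (ae_restrict_iff' measurableSet_Ioi).2 (Eventually.of_forall fun t ht =>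
        (hnorm _ _ t ht).le)
    · have := (hmeas (a - 1) z).mul
        (g := fun t : ℝ => (-t : ℂ)) (Continuous.aestronglyMeasurable (by fun_prop))
      refine this.congr (Eventually.of_forall fun t => ?_)
      simp only [Pi.mul_apply]; ring
    · refine (ae_restrict_iff' measurableSet_Ioi).2 (Eventually.of_forall fun t ht w hw => ?_)
      have ht' : (0 : ℝ) < t := ht
      rw [← mul_assoc, norm_mul, hnorm _ _ t ht]
      have : t ^ a.re = t ^ (a - 1).re * t := by
        rw [Complex.sub_re, Complex.one_re, Real.rpow_sub_one ht'.ne']; field_simp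
      rw [this]
      simp only [norm_neg, Complex.norm_real, Real.norm_eq_abs, abs_of_pos ht', Real.rpow_one]
      have hw' : z.re / 2 < w.re := hw
      have : Real.exp (-w.re * t) ≤ Real.exp (-(z.re / 2) * t) := by
        apply Real.exp_le_exp.2; nlinarith
      calc _ = t ^ (a - 1).re * t * Real.exp (-w.re * t) := by ring
        _ ≤ _ := by gcongr
    · exact hbd _ _ (by linarith) (by linarith)
    · refine (ae_restrict_iff' measurableSet_Ioi).2 (Eventually.of_forall fun t ht w hw => ?_)
      have := (((hasDerivAt_id w).mul_const (t : ℂ)).neg.cexp).const_mul ((t : ℂ) ^ (a - 1))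
      simpa using this
  have hdiff2 : DifferentiableOn ℂ (fun z : ℂ => z ^ (-a) * Complex.Gamma a) U := by
    intro z hz
    refine DifferentiableAt.differentiableWithinAt (DifferentiableAt.mul_const ?_ _)
    exact differentiableAt_id.cpow_const (Or.inl hz)
  have hpre : IsPreconnected U := (convex_halfSpace_re_gt 0).isPreconnected
  have h1 : (1 : ℂ) ∈ U := by simp [hU]
  -- Both sides are holomorphic in `r` on the half plane, so it suffices that they agree on real `r`
  -- accumulating at 1.
  refine (hdiff.analyticOnNhd hUo).eqOn_of_preconnected_of_frequently_eq
    (hdiff2.analyticOnNhd hUo) hpre h1 ?_ hr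
  have key : ∀ x : ℝ, 0 < x →
      ∫ t : ℝ in Ioi 0, (t : ℂ) ^ (a - 1) * Complex.exp (-((x : ℂ) * t))
        = (x : ℂ) ^ (-a) * Complex.Gamma a := by
    intro x hx
    rw [Complex.integral_cpow_mul_exp_neg_mul_Ioi ha hx, one_div, Complex.inv_cpow,
      Complex.cpow_neg]
    rw [Complex.arg_ofReal_of_nonneg hx.le]; exact Real.pi_pos.ne
  have htend : Tendsto (fun n : ℕ => ((1 + 1 / ((n : ℝ) + 1) : ℝ) : ℂ)) atTop (𝓝[≠] 1) := by
    refine tendsto_nhdsWithin_iff.2 ⟨?_, Eventually.of_forall fun n => ?_⟩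
    · have : Tendsto (fun n : ℕ => (1 + 1 / ((n : ℝ) + 1))) atTop (𝓝 (1 + 0)) :=
        tendsto_const_nhds.add tendsto_one_div_add_atTop_nhds_zero_nat
      simpa [Function.comp_def] using (Complex.continuous_ofReal.tendsto _).comp this
    · have : (0 : ℝ) < 1 / ((n : ℝ) + 1) := by positivity
      simp only [mem_compl_iff, mem_singleton_iff]
      rw [Complex.ofReal_eq_one]
      linarith
  refine htend.frequently (Frequently.of_forall fun n => key _ (by positivity))

/-- Euler's integral is taken along the ray of angle `±1`: with `r = exp(±i)` the factor `r^(-a)`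
has modulus `exp |Im a|` for the right sign, while the integral only loses `(cos 1)^(-Re a)`. The
angle 1 is the source of `cos 1` in the quadrature step. -/
theorem norm_Gamma_le {a : ℂ} (ha : 0 < a.re) :
    ‖Complex.Gamma a‖ ≤ Real.Gamma a.re * Real.cos 1 ^ (-a.re) * Real.exp (-|a.im|) := by
  have hc := Real.cos_one_pos
  obtain ⟨s, hs, hsa⟩ : ∃ s : ℝ, (s = 1 ∨ s = -1) ∧ s * a.im = |a.im| := by
    rcases abs_choice a.im with h | h
    · exact ⟨1, Or.inl rfl, by rw [h]; ring⟩
    · exact ⟨-1, Or.inr rfl, by rw [h]; ring⟩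
  have hcs : Real.cos s = Real.cos 1 := by rcases hs with rfl | rfl <;> simp
  set r : ℂ := Complex.exp (s * Complex.I) with hr
  have hrre : r.re = Real.cos 1 := by
    rw [hr, Complex.exp_ofReal_mul_I_re, hcs]
  have hrpow : r ^ (-a) = Complex.exp (s * Complex.I * (-a)) := by
    rw [Complex.cpow_def_of_ne_zero (Complex.exp_ne_zero _), Complex.log_exp] <;>
    · have := Real.pi_gt_three
      rcases hs with rfl | rfl <;> simp <;> linarith
  have hnr : ‖r ^ (-a)‖ = Real.exp (|a.im|) := by
    rw [hrpow, Complex.norm_exp, ← hsa]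
    congr 1
    simp
  have h := integral_cpow_mul_cexp_neg_mul_Ioi ha (r := r) (by rw [hrre]; exact hc)
  have h2 : ‖r ^ (-a) * Complex.Gamma a‖ ≤ Real.Gamma a.re * Real.cos 1 ^ (-a.re) := by
    rw [← h]
    refine (norm_integral_le_integral_norm _).trans (le_of_eq ?_)
    have h3 : ∀ t ∈ Ioi (0 : ℝ), ‖(t : ℂ) ^ (a - 1) * Complex.exp (-(r * t))‖
        = t ^ (a.re - 1) * Real.exp (-(Real.cos 1 * t)) := by
      intro t ht
      rw [norm_mul, Complex.norm_cpow_eq_rpow_re_of_pos ht, Complex.norm_exp]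
      simp [hrre]
    rw [setIntegral_congr_fun measurableSet_Ioi h3, Real.integral_rpow_mul_exp_neg_mul_Ioi ha hc,
      one_div, Real.inv_rpow hc.le, Real.rpow_neg hc.le]
    ring
  rw [norm_mul, hnr] at h2
  rw [Real.exp_neg, ← div_eq_mul_inv, le_div_iff₀ (Real.exp_pos _)]
  linarith

/-- The bound on a vertical line with a gain of the factor `x` near the imaginary axis. -/
theorem norm_Gamma_div_le {x y : ℝ} (hx : 0 < x) (hy : 0 < |y|) :
    ‖Complex.Gamma (x + y * Complex.I)‖ / Real.Gamma x
      ≤ x * Real.cos 1 ^ (-(1 + x)) * Real.exp (-|y|) / |y| := by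
  have hG := Real.Gamma_pos_of_pos hx
  set a : ℂ := x + y * Complex.I with ha
  have hare : a.re = x := by simp [ha]
  have haim : a.im = y := by simp [ha]
  have ha0 : a ≠ 0 := by
    intro h; rw [h] at hare; simp at hare; linarith
  -- The functional equation at `a + 1` replaces `Γ(x)` by `x Γ(x)` at the price of `1/|y|`; this is
  -- where the factor `x` (later the order `α`) is gained.
  have h1 := norm_Gamma_le (a := a + 1) (by simp [hare]; linarith)
  rw [Complex.Gamma_add_one _ ha0, norm_mul] at h1
  simp only [Complex.add_re, Complex.add_im, hare, haim, Complex.one_re, Complex.one_im,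
    add_zero, Real.Gamma_add_one hx.ne'] at h1
  have h2 : |y| ≤ ‖a‖ := by rw [← haim]; exact Complex.abs_im_le_norm a
  rw [div_le_div_iff₀ hG hy]
  calc ‖Complex.Gamma a‖ * |y| ≤ ‖a‖ * ‖Complex.Gamma a‖ := by
        rw [mul_comm]; gcongr
    _ ≤ _ := h1
    _ = _ := by rw [add_comm x 1]; ring

end FL21

/-! ### Poisson summation for the trapezoidal rule. -/

namespace FL21

open Set Filter Topology MeasureTheory
open scoped FourierTransform

theorem isBigO_cocompact_of_exp_decay {f : ℝ → ℂ} {C c : ℝ} (hc : 0 < c) (hC : 0 ≤ C)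
    (hf : ∀ u, u ≠ 0 → ‖f u‖ ≤ C * Real.exp (-(c * |u|))) :
    f =O[cocompact ℝ] fun u : ℝ => |u| ^ (-2 : ℝ) := by
  refine Asymptotics.IsBigO.of_bound (C * (2 / c ^ 2)) ?_
  filter_upwards [(isCompact_singleton (x := (0 : ℝ))).compl_mem_cocompact] with u hu
  have hu' : 0 < |u| := abs_pos.2 hu
  refine (hf u hu).trans ?_
  rw [mul_assoc]
  refine mul_le_mul_of_nonneg_left ?_ hC
  rw [Real.norm_of_nonneg (Real.rpow_nonneg hu'.le _), Real.rpow_neg hu'.le, Real.exp_neg,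
    Real.rpow_two, ← div_eq_mul_inv, div_div, inv_eq_one_div,
    div_le_div_iff₀ (Real.exp_pos _) (by positivity)]
  have := Real.quadratic_le_exp_of_nonneg (x := c * |u|) (by positivity)
  have h2 : 0 < c * |u| := by positivity
  nlinarith

/-- To the right the first factor decays at rate `α h`. To the left it grows, but `exp(-y) ≤ 1/y`
supplies `exp(h u)/x`, which leaves the rate `(1 - α) h`. -/
theorem exp_mul_exp_neg_le {α h x : ℝ} (hα : 0 < α) (hα1 : α < 1) (hh : 0 < h) (hx : 0 < x)
    (u : ℝ) : Real.exp (-(α * h) * u) * Real.exp (-(x * Real.exp (-(h * u))))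
      ≤ (1 + 1 / x) * Real.exp (-(min α (1 - α) * h * |u|)) := by
  have hx' : 0 < 1 / x := by positivity
  rcases le_total 0 u with hu | hu
  · rw [abs_of_nonneg hu]
    have h1 : Real.exp (-(x * Real.exp (-(h * u)))) ≤ 1 := by
      rw [Real.exp_le_one_iff]; have := Real.exp_pos (-(h * u)); nlinarith
    have h2 : Real.exp (-(α * h) * u) ≤ Real.exp (-(min α (1 - α) * h * u)) := by
      apply Real.exp_le_exp.2
      have : min α (1 - α) * (h * u) ≤ α * (h * u) :=
        mul_le_mul_of_nonneg_right (min_le_left _ _) (by positivity)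
      linarith
    have := Real.exp_pos (-(min α (1 - α) * h * u))
    have := Real.exp_pos (-(α * h) * u)
    nlinarith
  · rw [abs_of_nonpos hu]
    have h1 : Real.exp (-(x * Real.exp (-(h * u)))) ≤ 1 / x * Real.exp (h * u) := by
      have h3 : x * Real.exp (-(h * u)) ≤ Real.exp (x * Real.exp (-(h * u))) := by
        linarith [Real.add_one_le_exp (x * Real.exp (-(h * u)))]
      have h4 : 0 < x * Real.exp (-(h * u)) := by positivity
      rw [Real.exp_neg]
      refine (inv_anti₀ h4 h3).trans (le_of_eq ?_)
      rw [Real.exp_neg]; field_simp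
    have h2 : Real.exp (-(α * h) * u) * Real.exp (h * u)
        ≤ Real.exp (-(min α (1 - α) * h * -u)) := by
      rw [← Real.exp_add]
      apply Real.exp_le_exp.2
      have : min α (1 - α) * (h * -u) ≤ (1 - α) * (h * -u) :=
        mul_le_mul_of_nonneg_right (min_le_right _ _)
          (mul_nonneg hh.le (by linarith))
      linarith
    have := Real.exp_pos (-(min α (1 - α) * h * -u))
    calc _ ≤ Real.exp (-(α * h) * u) * (1 / x * Real.exp (h * u)) := by gcongr
      _ = 1 / x * (Real.exp (-(α * h) * u) * Real.exp (h * u)) := by ring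
      _ ≤ 1 / x * Real.exp (-(min α (1 - α) * h * -u)) := by gcongr
      _ ≤ _ := by nlinarith

/-- The substitution `t = exp(-u)` turns the Fourier transform into the Mellin transform of `exp(-x
t^h)` at `α h + 2πiξ`, which is the Laplace integral above. -/
theorem fourier_exp_mul_exp_neg {α h x : ℝ} (hα : 0 < α) (hh : 0 < h) (hx : 0 < x) (ξ : ℝ) :
    𝓕 (fun u : ℝ => ((Real.exp (-(α * h) * u) * Real.exp (-(x * Real.exp (-(h * u)))) : ℝ) : ℂ)) ξ
      = (h⁻¹ : ℝ) • ((x : ℂ) ^ (-(α + (2 * Real.pi * ξ / h : ℝ) * Complex.I))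
          * Complex.Gamma (α + (2 * Real.pi * ξ / h : ℝ) * Complex.I)) := by
  set s : ℂ := (α * h : ℝ) + (2 * Real.pi * ξ : ℝ) * Complex.I with hs
  have hsre : s.re = α * h := by simp [hs]
  have hsim : s.im / (2 * Real.pi) = ξ := by
    have : s.im = 2 * Real.pi * ξ := by simp [hs]
    rw [this]; field_simp
  set F : ℝ → ℂ := fun t => Complex.exp (-(x * t)) with hF
  have h1 := mellin_eq_fourier (fun t : ℝ => F (t ^ h)) (s := s)
  rw [mellin_comp_rpow, abs_of_pos hh, hsim, hsre] at h1
  have h2 : s / h = α + (2 * Real.pi * ξ / h : ℝ) * Complex.I := by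
    have : (h : ℂ) ≠ 0 := by exact_mod_cast hh.ne'
    rw [hs]; push_cast; field_simp
  have h3 : mellin F (s / h) = (x : ℂ) ^ (-(s / h)) * Complex.Gamma (s / h) := by
    rw [mellin, ← integral_cpow_mul_cexp_neg_mul_Ioi (by rw [h2]; simpa using hα) (by simpa using hx)]
    rfl
  rw [h3, h2] at h1
  rw [h1]
  refine congrArg (fun g : ℝ → ℂ => 𝓕 g ξ) (funext fun u => ?_)
  rw [hF]
  simp only [Complex.real_smul]
  push_cast
  congr 2
  rw [← Real.exp_mul]
  push_cast
  ring_nf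

/-- Poisson summation for the trapezoidal rule applied to the integral representation
of `Γ(α) x ^ (-α)`. -/
theorem exp_sum_aliasing {α h x : ℝ} (hα : 0 < α) (hα1 : α < 1) (hh : 0 < h) (hx : 0 < x)
    {K : ℝ} (hK : HasSum (fun n : ℕ => 2 * ‖Complex.Gamma
      (α + (2 * Real.pi * ((n : ℝ) + 1) / h : ℝ) * Complex.I)‖) K) :
    ∃ S : ℝ, HasSum (fun i : ℤ => h * Real.exp (α * i * h) * Real.exp (-Real.exp (i * h) * x)) S ∧
      |S - x ^ (-α) * Real.Gamma α| ≤ x ^ (-α) * K := by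
  set f : ℝ → ℂ := fun u : ℝ =>
    ((Real.exp (-(α * h) * u) * Real.exp (-(x * Real.exp (-(h * u)))) : ℝ) : ℂ) with hf
  set c := min α (1 - α) * h with hcdef
  have hc : 0 < c := mul_pos (lt_min hα (by linarith)) hh
  have hfb : ∀ u, ‖f u‖ ≤ (1 + 1 / x) * Real.exp (-(c * |u|)) := by
    intro u
    rw [hf]
    simp only [Complex.norm_real]
    rw [Real.norm_of_nonneg (by positivity)]
    exact exp_mul_exp_neg_le hα hα1 hh hx u
  have hfO := isBigO_cocompact_of_exp_decay hc (by positivity) (fun u _ => hfb u)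
  have hFn : ∀ ξ : ℝ, ‖𝓕 f ξ‖
      = h⁻¹ * x ^ (-α) * ‖Complex.Gamma (α + (2 * Real.pi * ξ / h : ℝ) * Complex.I)‖ := by
    intro ξ
    rw [hf, fourier_exp_mul_exp_neg hα hh hx, norm_smul, norm_mul,
      Complex.norm_cpow_eq_rpow_re_of_pos hx, Real.norm_of_nonneg (by positivity)]
    simp [mul_assoc]
  have hFO : (𝓕 f) =O[cocompact ℝ] fun u : ℝ => |u| ^ (-2 : ℝ) := by
    refine isBigO_cocompact_of_exp_decay (c := 2 * Real.pi / h)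
      (C := h⁻¹ * x ^ (-α) * (Real.Gamma α * Real.cos 1 ^ (-α)))
      (by positivity) (by have := Real.Gamma_pos_of_pos hα; have := Real.cos_one_pos; positivity)
      fun ξ _ => ?_
    rw [hFn, mul_assoc (h⁻¹ * x ^ (-α))]
    refine mul_le_mul_of_nonneg_left ?_ (by positivity)
    have := norm_Gamma_le (a := α + (2 * Real.pi * ξ / h : ℝ) * Complex.I) (by simpa using hα)
    simp only [Complex.add_re, Complex.ofReal_re, Complex.mul_re, Complex.I_re, mul_zero,
      Complex.ofReal_im, Complex.I_im, mul_one, sub_self, add_zero, Complex.add_im, Complex.mul_im,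
      zero_add] at this
    refine this.trans (le_of_eq ?_)
    congr 2
    rw [abs_div, abs_mul, abs_of_pos hh, abs_of_pos (by positivity : 0 < 2 * Real.pi)]
    ring
  have hpoisson := Real.tsum_eq_tsum_fourier_of_rpow_decay
    (f := f) (by fun_prop) one_lt_two hfO hFO 0
  simp only [zero_add, QuotientAddGroup.mk_zero, fourier_eval_zero, mul_one] at hpoisson
  have hsumf : Summable fun n : ℤ => f n :=
    summable_of_isBigO (Real.summable_abs_int_rpow one_lt_two)
      (hfO.comp_tendsto Int.tendsto_coe_cofinite)
  have hsumF : Summable fun n : ℤ => 𝓕 f n :=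
    summable_of_isBigO (Real.summable_abs_int_rpow one_lt_two)
      (hFO.comp_tendsto Int.tendsto_coe_cofinite)
  have hS := hsumf.hasSum
  set S' := ∑' n : ℤ, f n with hS'
  have hS1 : HasSum (fun n : ℤ => h * Real.exp (α * n * h) * Real.exp (-Real.exp (n * h) * x))
      (h * S'.re) := by
    have h1 := Complex.hasSum_re hS
    have h2 := ((Equiv.neg ℤ).hasSum_iff.2 h1).mul_left h
    refine h2.congr_fun ?_
    intro n
    simp only [Function.comp, Equiv.neg_apply, hf, Complex.ofReal_re]
    push_cast
    rw [mul_assoc]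
    congr 2
    · congr 1; ring
    · congr 1; rw [show -(h * -(n : ℝ)) = n * h by ring]; ring
  refine ⟨h * S'.re, hS1, ?_⟩
  have hconjn : ∀ y : ℝ, ‖Complex.Gamma (α + (-y : ℝ) * Complex.I)‖
      = ‖Complex.Gamma (α + y * Complex.I)‖ := by
    intro y
    rw [← Complex.norm_conj (Complex.Gamma (α + y * Complex.I)), ← Complex.Gamma_conj]
    congr 2
    simp
  have hzero : 𝓕 f (0 : ℤ) = ((h⁻¹ * (x ^ (-α) * Real.Gamma α) : ℝ) : ℂ) := by
    rw [hf, fourier_exp_mul_exp_neg hα hh hx]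
    simp only [Int.cast_zero, mul_zero, zero_div, Complex.ofReal_zero, zero_mul, add_zero,
      Complex.Gamma_ofReal, Complex.real_smul]
    rw [← Complex.ofReal_neg, ← Complex.ofReal_cpow hx.le]
    push_cast; ring
  have hrest : ‖S' - 𝓕 f (0 : ℤ)‖ ≤ h⁻¹ * x ^ (-α) * K := by
    -- The zero mode is the integral itself, so the quadrature error consists of the remaining
    -- modes, paired as `±(n + 1)`; conjugate arguments of `Γ` make both halves of a pair equal in
    -- modulus.
    have hnat : HasSum (fun n : ℕ => 𝓕 f ((n + 1 : ℤ) : ℝ) + 𝓕 f ((-(n + 1 : ℤ) : ℤ) : ℝ))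
        (S' - 𝓕 f (0 : ℤ)) := by
      have h0 : S' = ∑' n : ℤ, 𝓕 f n := hpoisson
      have h1 := (hasSum_nat_add_iff' 1).2 (h0 ▸ hsumF.hasSum).nat_add_neg
      convert! h1 using 1
      simp
    refine (hnat.tsum_eq ▸ tsum_of_norm_bounded (hK.mul_left (h⁻¹ * x ^ (-α))) fun n => ?_)
    refine (norm_add_le _ _).trans (le_of_eq ?_)
    rw [hFn, hFn]
    have := hconjn (2 * Real.pi * ((n : ℝ) + 1) / h)
    have e : 2 * Real.pi * (((-(n + 1 : ℤ) : ℤ)) : ℝ) / h = -(2 * Real.pi * ((n : ℝ) + 1) / h) := by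
      push_cast; ring
    rw [e, this]
    push_cast; ring
  have hre : |S'.re - h⁻¹ * (x ^ (-α) * Real.Gamma α)| ≤ h⁻¹ * x ^ (-α) * K := by
    refine le_trans ?_ hrest
    rw [hzero]
    have := Complex.abs_re_le_norm (S' - ((h⁻¹ * (x ^ (-α) * Real.Gamma α) : ℝ) : ℂ))
    simpa only [Complex.sub_re, Complex.ofReal_re] using this
  have : h * S'.re - x ^ (-α) * Real.Gamma α
      = h * (S'.re - h⁻¹ * (x ^ (-α) * Real.Gamma α)) := by field_simp
  rw [this, abs_mul, abs_of_pos hh]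
  calc _ ≤ h * (h⁻¹ * x ^ (-α) * K) := by gcongr
    _ = _ := by field_simp

end FL21

/-! ### Accuracy of the exponential sums. -/

namespace FL21

open Set Filter Topology MeasureTheory

theorem cos_one_gt : 0.519 < Real.cos 1 := by
  have h := (abs_le.1 (Real.cos_bound (x := 1 / 2) (by norm_num [abs_of_pos]))).1
  have h2 := Real.cos_two_mul (1 / 2)
  norm_num [abs_of_pos] at h h2
  rw [h2]
  nlinarith

namespace Discretization

variable {d : ℕ} {P : Problem d} (M : Discretization P)

theorem T_pos : 0 < P.T := lt_of_lt_of_le one_pos P.one_le_T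

theorem Δt_pos : 0 < M.Δt := div_pos T_pos (by exact_mod_cast M.n_pos)

theorem n_mul_Δt : M.n * M.Δt = P.T := by
  have : (M.n : ℝ) ≠ 0 := by exact_mod_cast M.n_pos.ne'
  unfold Δt; field_simp

theorem t_nonneg (k : ℕ) : 0 ≤ M.t k := mul_nonneg k.cast_nonneg M.Δt_pos.le

theorem t_succ (k : ℕ) : M.t (k + 1) = M.t k + M.Δt := by
  unfold t; push_cast; ring

theorem t_mono {k l : ℕ} (h : k ≤ l) : M.t k ≤ M.t l :=
  mul_le_mul_of_nonneg_right (by exact_mod_cast h) M.Δt_pos.le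

theorem t_le_T {k : ℕ} (h : k ≤ M.n) : M.t k ≤ P.T := by
  rw [← M.n_mul_Δt]; exact M.t_mono h

theorem t_mem {k : ℕ} (h : k ≤ M.n) : M.t k ∈ Icc 0 P.T := ⟨M.t_nonneg k, M.t_le_T h⟩

theorem σ_gt {k : ℕ} (hk : k < M.n) : 1 / 2 < M.σ k := (M.σ_mem k hk).1

theorem σ_lt {k : ℕ} (hk : k < M.n) : M.σ k < 1 := (M.σ_mem k hk).2

theorem σ_pos {k : ℕ} (hk : k < M.n) : 0 < M.σ k := by linarith [M.σ_gt hk]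

theorem t_lt_tσ {k : ℕ} (hk : k < M.n) : M.t k < M.tσ k := by
  unfold tσ; linarith [mul_pos (M.σ_pos hk) M.Δt_pos]

theorem tσ_lt {k : ℕ} (hk : k < M.n) : M.tσ k < M.t (k + 1) := by
  rw [t_succ]; unfold tσ
  nlinarith [M.σ_lt hk, M.Δt_pos]

theorem tσ_pos {k : ℕ} (hk : k < M.n) : 0 < M.tσ k := (M.t_nonneg k).trans_lt (M.t_lt_tσ hk)

theorem tσ_lt_T {k : ℕ} (hk : k < M.n) : M.tσ k < P.T := (M.tσ_lt hk).trans_le (M.t_le_T hk)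

theorem tσ_mem {k : ℕ} (hk : k < M.n) : M.tσ k ∈ Icc 0 P.T :=
  ⟨(M.tσ_pos hk).le, (M.tσ_lt_T hk).le⟩

theorem ασ_mem {k : ℕ} (hk : k < M.n) : M.ασ k ∈ Icc P.αlo P.αhi := P.α_mem _ (M.tσ_mem hk)

theorem ασ_pos {k : ℕ} (hk : k < M.n) : 0 < M.ασ k := P.αlo_pos.trans_le (M.ασ_mem hk).1

theorem ασ_lt_one {k : ℕ} (hk : k < M.n) : M.ασ k < 1 := (M.ασ_mem hk).2.trans_lt P.αhi_lt_one

theorem αhi_pos : 0 < P.αhi := by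
  have := P.α_mem 0 ⟨le_rfl, T_pos.le⟩
  exact P.αlo_pos.trans_le (this.1.trans this.2)

theorem σ_eq {k : ℕ} (hk : k < M.n) : M.σ k = 1 - M.ασ k / 2 := M.σ_root k hk

theorem ε_lt : M.ε < 0.368 := by
  refine M.ε_le.trans_lt ?_
  rw [div_lt_iff₀ (Real.exp_pos _)]
  have := Real.exp_one_gt_d9
  linarith

/-- The width of the strip entering the quadrature step. -/
noncomputable def width : ℝ := Real.log 3 + P.αhi * Real.log (Real.cos 1)⁻¹ + Real.log M.ε⁻¹

theorem two_lt_width : 2 < M.width := by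
  have h1 : 1 < Real.log 3 := by
    rw [Real.lt_log_iff_exp_lt (by norm_num)]
    linarith [Real.exp_one_lt_d9]
  have h2 : 0 ≤ Real.log (Real.cos 1)⁻¹ :=
    Real.log_nonneg ((one_le_inv₀ Real.cos_one_pos).2 (Real.cos_le_one _))
  have h3 : 1 ≤ Real.log M.ε⁻¹ := by
    rw [Real.le_log_iff_exp_le (inv_pos.2 M.ε_pos)]
    have := M.ε_le
    rw [one_div] at this
    exact (le_inv_comm₀ M.ε_pos (Real.exp_pos _)).1 this
  have := mul_nonneg (αhi_pos (P := P)).le h2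
  unfold width; linarith

theorem h_pos : 0 < M.h :=
  div_pos (by positivity) (zero_lt_two.trans M.two_lt_width)

theorem two_pi_div_h : 2 * Real.pi / M.h = M.width := by
  have := M.two_lt_width
  change 2 * Real.pi / (2 * Real.pi / M.width) = M.width
  field_simp

/-- This is what the step `h` is designed for: the first aliasing mode decays by `exp(-2π/h)`, which
is `ε/3` times a power that compensates the `(cos 1)^(-α)` lost in the bound on `Γ`. -/
theorem exp_neg_width : Real.exp (-M.width) = M.ε / 3 * Real.cos 1 ^ P.αhi := by
  have hc := Real.cos_one_pos
  unfold width
  rw [Real.log_inv, Real.log_inv, Real.rpow_def_of_pos hc, show -(Real.log 3 + P.αhi * -Real.log (Real.cos 1)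
    + -Real.log M.ε) = -Real.log 3 + Real.log M.ε + Real.log (Real.cos 1) * P.αhi by ring,
    Real.exp_add, Real.exp_add, Real.exp_log M.ε_pos, Real.exp_neg, Real.exp_log (by norm_num)]
  ring

theorem lam_pos (i : ℤ) : 0 < M.lam i := Real.exp_pos _

theorem θ_pos {k : ℕ} (hk : k < M.n) (i : ℤ) : 0 < M.θ k i :=
  div_pos (mul_pos M.h_pos (Real.exp_pos _)) (Real.Gamma_pos_of_pos (M.ασ_pos hk))

/-- The untruncated exponential sum approximates the power function with a relative error that
is small for small orders. -/
theorem full_sum {k : ℕ} (hk : k < M.n) {x : ℝ} (hx : 0 < x) :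
    ∃ S : ℝ, HasSum (fun i : ℤ => M.θ k i * Real.exp (-M.lam i * x)) S ∧
      |S - x ^ (-M.ασ k)| ≤ x ^ (-M.ασ k) * (4 / 5 * M.ασ k * M.ε) := by
  have hα := M.ασ_pos hk
  have hα1 := M.ασ_lt_one hk
  have hG := Real.Gamma_pos_of_pos hα
  have hD := M.two_lt_width
  have hc := Real.cos_one_pos
  have hε := M.ε_pos
  set α := M.ασ k with hαdef
  set D := M.width with hDdef
  set q := Real.exp (-D) with hq
  have hqε : q ≤ M.ε / 3 := by
    rw [hq, exp_neg_width]
    have := Real.rpow_le_one hc.le (Real.cos_le_one 1) (αhi_pos (P := P)).le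
    nlinarith
  have hq0 : 0 < q := Real.exp_pos _
  have hq1 : q < 0.123 := by linarith [M.ε_lt]
  set B := 2 * (Real.Gamma α * (α * Real.cos 1 ^ (-(1 + α)) / D)) with hB
  have hB0 : 0 < B := by positivity
  have hterm : ∀ n : ℕ, 2 * ‖Complex.Gamma
      (α + (2 * Real.pi * ((n : ℝ) + 1) / M.h : ℝ) * Complex.I)‖ ≤ B * q * q ^ n := by
    intro n
    have e : 2 * Real.pi * ((n : ℝ) + 1) / M.h = D * (n + 1) := by
      rw [mul_div_right_comm, two_pi_div_h]
    have hy : 0 < D * ((n : ℝ) + 1) := by positivity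
    have := norm_Gamma_div_le hα (y := D * (n + 1)) (by rw [abs_of_pos hy]; exact hy)
    rw [abs_of_pos hy, div_le_iff₀ hG] at this
    rw [e]
    have h1 : Real.exp (-(D * ((n : ℝ) + 1))) = q * q ^ n := by
      rw [hq, ← Real.exp_nat_mul, ← Real.exp_add]; congr 1; ring
    have h2 : α * Real.cos 1 ^ (-(1 + α)) * Real.exp (-(D * ((n : ℝ) + 1))) / (D * ((n : ℝ) + 1))
        ≤ α * Real.cos 1 ^ (-(1 + α)) * Real.exp (-(D * ((n : ℝ) + 1))) / D := by
      gcongr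
      have : (0 : ℝ) ≤ n := n.cast_nonneg
      nlinarith
    calc _ ≤ 2 * (α * Real.cos 1 ^ (-(1 + α)) * Real.exp (-(D * ((n : ℝ) + 1))) / D
          * Real.Gamma α) := by
            refine mul_le_mul_of_nonneg_left (this.trans ?_) (by norm_num)
            exact mul_le_mul_of_nonneg_right h2 hG.le
      _ = _ := by rw [h1, hB]; ring
  have hgeo := (hasSum_geometric_of_lt_one hq0.le (by linarith)).mul_left (B * q)
  have hsum : Summable fun n : ℕ => 2 * ‖Complex.Gamma
      (α + (2 * Real.pi * ((n : ℝ) + 1) / M.h : ℝ) * Complex.I)‖ :=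
    Summable.of_nonneg_of_le (fun n => by positivity) hterm hgeo.summable
  obtain ⟨S, hS, hSx⟩ := exp_sum_aliasing hα hα1 M.h_pos hx hsum.hasSum
  set K := ∑' n : ℕ, 2 * ‖Complex.Gamma
      (α + (2 * Real.pi * ((n : ℝ) + 1) / M.h : ℝ) * Complex.I)‖ with hK
  have hKle : K ≤ B * q * (1 - q)⁻¹ := hasSum_le hterm hsum.hasSum hgeo
  -- Numerically `2 · (1/3) · 1.93 · (1/2) · 1.141 < 4/5`: the factors come from the pairs of modes,
  -- `q`, `1/cos 1`, `1/D` and the geometric series.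
  have hKε : K ≤ Real.Gamma α * (4 / 5 * α * M.ε) := by
    refine hKle.trans ?_
    have h1 : Real.cos 1 ^ (-(1 + α)) * q ≤ M.ε / 3 * (Real.cos 1)⁻¹ := by
      rw [hq, exp_neg_width, mul_left_comm, ← Real.rpow_add hc]
      gcongr
      rw [show -(1 + α) + P.αhi = -1 + (P.αhi - α) by ring, Real.rpow_add hc, Real.rpow_neg_one]
      have := Real.rpow_le_one hc.le (Real.cos_le_one 1)
        (sub_nonneg.2 (M.ασ_mem hk).2 : 0 ≤ P.αhi - α)
      have h2 := inv_pos.2 hc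
      nlinarith
    have h2 : (Real.cos 1)⁻¹ ≤ 1.93 := by
      rw [inv_le_comm₀ hc (by norm_num)]
      have := cos_one_gt
      norm_num at this ⊢; linarith
    have h3 : (1 - q)⁻¹ ≤ 1.141 := by
      rw [inv_le_comm₀ (by linarith) (by norm_num)]
      norm_num at hq1 ⊢; linarith
    have h4 : D⁻¹ ≤ 1 / 2 := by
      rw [inv_le_comm₀ (by linarith) (by norm_num)]; norm_num; linarith
    have h3' : 0 < (1 - q)⁻¹ := inv_pos.2 (by linarith)
    calc B * q * (1 - q)⁻¹
        = 2 * Real.Gamma α * α * (Real.cos 1 ^ (-(1 + α)) * q) * D⁻¹ * (1 - q)⁻¹ := by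
          rw [hB]; ring
      _ ≤ 2 * Real.Gamma α * α * (M.ε / 3 * 1.93) * (1 / 2) * 1.141 := by
          have h5 : Real.cos 1 ^ (-(1 + α)) * q ≤ M.ε / 3 * 1.93 := h1.trans (by gcongr)
          have h6 : 0 ≤ 2 * Real.Gamma α * α := by positivity
          exact mul_le_mul (mul_le_mul (mul_le_mul_of_nonneg_left h5 h6) h4
            (by positivity) (by positivity)) h3 h3'.le (by positivity)
      _ ≤ _ := by
          have : 0 ≤ Real.Gamma α * α * M.ε := by positivity
          nlinarith
  refine ⟨S / Real.Gamma α, ?_, ?_⟩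
  · refine (hS.div_const (Real.Gamma α)).congr_fun ?_
    intro i
    simp only [θ, lam, ← hαdef]
    ring_nf
  · have : S / Real.Gamma α - x ^ (-α) = (S - x ^ (-α) * Real.Gamma α) / Real.Gamma α := by
      field_simp
    rw [this, abs_div, abs_of_pos hG, div_le_iff₀ hG]
    refine hSx.trans ?_
    have : 0 < x ^ (-α) := Real.rpow_pos_of_pos hx _
    calc _ ≤ x ^ (-α) * (Real.Gamma α * (4 / 5 * α * M.ε)) := by gcongr
      _ = _ := by ring

/-- Positivity of the terms makes this bound independent of the truncation. It replaces `ε` by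
`(4/5) α ε`, and the factor `α` is indispensable in `wA_add_wB_le`. -/
theorem sum_le_full {k : ℕ} (hk : k < M.n) {x : ℝ} (hx : 0 < x) (s : Finset ℤ) :
    ∑ i ∈ s, M.θ k i * Real.exp (-M.lam i * x)
      ≤ x ^ (-M.ασ k) * (1 + 4 / 5 * M.ασ k * M.ε) := by
  obtain ⟨S, hS, hSx⟩ := M.full_sum hk hx
  have h1 : ∑ i ∈ s, M.θ k i * Real.exp (-M.lam i * x) ≤ S :=
    sum_le_hasSum s (fun i _ => mul_nonneg (M.θ_pos hk i).le (Real.exp_pos _).le) hS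
  have := (abs_le.1 hSx).2
  linarith

/-- The aliasing error uses up `4ε/5`, and a tail of at most `ε/5` remains. The tail terms decrease
in `x`, so the tail need only be controlled at the smallest argument; as `x ≤ 1` gives `x^(-α) ≥ 1`,
an absolute tail bound is also a relative one. Finitely many time levels share one index interval.
-/
theorem exists_ESAAccurate : ∃ Nlo Nhi : ℤ, M.ESAAccurate Nlo Nhi := by
  have hε := M.ε_pos
  -- The smallest argument: `t_{k+σ_k} - τ ≥ σ_k Δt` on `[0, t_k]`, and `σ_k > 1/2`.
  set δ := M.Δt / (2 * P.T) with hδ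
  have hT := T_pos (P := P)
  have hδ0 : 0 < δ := div_pos M.Δt_pos (by positivity)
  have hk : ∀ k, ∃ s : Finset ℤ, k < M.n → ∀ s', s ⊆ s' → ∀ x, δ ≤ x → x ≤ 1 →
      |x ^ (-M.ασ k) - ∑ i ∈ s', M.θ k i * Real.exp (-M.lam i * x)| ≤ x ^ (-M.ασ k) * M.ε := by
    intro k
    by_cases hk : k < M.n
    swap
    · exact ⟨∅, fun h => absurd h hk⟩
    obtain ⟨S, hS, -⟩ := M.full_sum hk hδ0
    obtain ⟨s, hs⟩ := (summable_iff_vanishing_norm.1 hS.summable) (M.ε / 5) (by positivity)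
    refine ⟨s, fun _ s' hss x hx hx1 => ?_⟩
    have hx0 := hδ0.trans_le hx
    obtain ⟨Sx, hSx, hSxb⟩ := M.full_sum hk hx0
    have hnn : ∀ y i, 0 ≤ M.θ k i * Real.exp (-M.lam i * y) :=
      fun y i => mul_nonneg (M.θ_pos hk i).le (Real.exp_pos _).le
    have hpow : 1 ≤ x ^ (-M.ασ k) :=
      Real.one_le_rpow_of_pos_of_le_one_of_nonpos hx0 hx1 (by linarith [M.ασ_pos hk])
    have htail : Sx - ∑ i ∈ s', M.θ k i * Real.exp (-M.lam i * x) ≤ M.ε / 5 := by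
      rw [sub_le_iff_le_add]
      refine hasSum_le_of_sum_le hSx fun u => ?_
      have h1 : ∑ i ∈ u, M.θ k i * Real.exp (-M.lam i * x)
          ≤ ∑ i ∈ u \ s', M.θ k i * Real.exp (-M.lam i * x)
            + ∑ i ∈ s', M.θ k i * Real.exp (-M.lam i * x) := by
        rw [← Finset.sum_union Finset.sdiff_disjoint]
        exact Finset.sum_le_sum_of_subset_of_nonneg (by simp) fun i _ _ => hnn _ _
      have h2 : ∑ i ∈ u \ s', M.θ k i * Real.exp (-M.lam i * x)
          ≤ ∑ i ∈ u \ s', M.θ k i * Real.exp (-M.lam i * δ) := by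
        refine Finset.sum_le_sum fun i _ => mul_le_mul_of_nonneg_left ?_ (M.θ_pos hk i).le
        apply Real.exp_le_exp.2
        nlinarith [M.lam_pos i]
      have h3 := hs (u \ s') (Finset.sdiff_disjoint.mono_right hss)
      have h4 := (le_abs_self _).trans h3.le
      linarith
    have hle := sum_le_hasSum s' (fun i _ => hnn x i) hSx
    have h5 := abs_le.1 hSxb
    have h6 : 4 / 5 * M.ασ k * M.ε ≤ 4 / 5 * M.ε := by
      have := M.ασ_lt_one hk
      nlinarith
    have h7 : x ^ (-M.ασ k) * (4 / 5 * M.ασ k * M.ε) ≤ x ^ (-M.ασ k) * (4 / 5 * M.ε) :=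
      mul_le_mul_of_nonneg_left h6 (by linarith)
    rw [abs_le]
    constructor <;> nlinarith
  choose s hs using hk
  set U := (Finset.range M.n).biUnion s with hU
  obtain ⟨a, ha⟩ := U.bddBelow
  obtain ⟨b, hb⟩ := U.bddAbove
  refine ⟨a - 1, b, fun k hk1 hkn τ hτ => ?_⟩
  have hsub : s k ⊆ Finset.Ioc (a - 1) b := by
    intro i hi
    have : i ∈ U := Finset.mem_biUnion.2 ⟨k, Finset.mem_range.2 hkn, hi⟩
    have h1 := ha (Finset.mem_coe.2 this)
    have h2 := hb (Finset.mem_coe.2 this)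
    rw [Finset.mem_Ioc]; constructor <;> omega
  have h := hs k hkn _ hsub ((M.tσ k - τ) / P.T) ?_ ?_
  · simpa only [mul_div_assoc] using h
  · rw [hδ, div_le_div_iff₀ (by positivity) hT]
    have : M.Δt / 2 ≤ M.tσ k - τ := by
      have := hτ.2
      unfold tσ
      nlinarith [M.σ_gt hkn, M.Δt_pos]
    nlinarith
  · rw [div_le_one hT]
    linarith [hτ.1, M.tσ_lt_T hkn]

end Discretization
end FL21

/-! ### Energy inequality, maximum principle, and the weights of the fast formula. -/

namespace FL21

open Set Filter Topology MeasureTheory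

/-! ### Summation by parts -/

/-- Abel summation produces `(g l - g (l - 1)) * N l` for `0 < l ≤ K`, and these terms are dropped.
The two end values of `N` may have any sign, which the maximum principle exploits at `K + 1`. -/
theorem abel_lower_bound {g N : ℕ → ℝ} (K : ℕ) (hg : ∀ l, l < K → g l ≤ g (l + 1))
    (hN : ∀ l, 0 < l → l ≤ K → 0 ≤ N l) :
    g 0 * N 0 - g K * N (K + 1) ≤ ∑ l ∈ Finset.range (K + 1), g l * (N l - N (l + 1)) := by
  induction K with
  | zero => simp; linarith
  | succ K ih =>
    rw [Finset.sum_range_succ]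
    have h1 := ih (fun l hl => hg l (hl.trans K.lt_succ_self)) fun l h0 hl => hN l h0 (by omega)
    have h2 := mul_nonneg (sub_nonneg.2 (hg K K.lt_succ_self)) (hN (K + 1) (by omega) le_rfl)
    linarith

/-- With `w` the weighted average and `N l = |v l - w|²`, the defect in the `l`-th increment is
exactly `g l * (N l - N (l + 1))`. After Abel summation only the last two weights matter: there `N k
= σ² Q` and `N (k + 1) = (1 - σ)² Q`, and `σ² - (1 - σ)² = 2σ - 1` matches the hypothesis on `g` at
`k - 1` and `k`. -/
theorem energy_inequality {V : Type*} [AddCommGroup V] [Module ℝ V] (B : V →ₗ[ℝ] V →ₗ[ℝ] ℝ)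
    (hsymm : ∀ x y, B x y = B y x) (hpos : ∀ x, 0 ≤ B x x) {g : ℕ → ℝ} {σ : ℝ} (k : ℕ)
    (hσ : 1 / 2 ≤ σ) (hσ1 : σ ≤ 1) (hg0 : 0 ≤ g 0)
    (hg : ∀ l, l < k → g l ≤ g (l + 1))
    (hlast : ∀ l, l + 1 = k → σ * g l ≤ (2 * σ - 1) * g k) (v : ℕ → V) :
    ∑ l ∈ Finset.range (k + 1), g l * (B (v (l + 1)) (v (l + 1)) - B (v l) (v l))
      ≤ 2 * B (∑ l ∈ Finset.range (k + 1), g l • (v (l + 1) - v l))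
          (σ • v (k + 1) + (1 - σ) • v k) := by
  set w := σ • v (k + 1) + (1 - σ) • v k with hw
  set N : ℕ → ℝ := fun l => B (v l - w) (v l - w) with hN
  have hNpos : ∀ l, 0 ≤ N l := fun l => hpos _
  have hid : 2 * B (∑ l ∈ Finset.range (k + 1), g l • (v (l + 1) - v l)) w
      - ∑ l ∈ Finset.range (k + 1), g l * (B (v (l + 1)) (v (l + 1)) - B (v l) (v l))
      = ∑ l ∈ Finset.range (k + 1), g l * (N l - N (l + 1)) := by
    rw [map_sum, LinearMap.sum_apply, Finset.mul_sum, ← Finset.sum_sub_distrib]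
    refine Finset.sum_congr rfl fun l _ => ?_
    simp only [hN, map_sub, map_smul, LinearMap.sub_apply, LinearMap.smul_apply, smul_eq_mul,
      hsymm w]
    ring
  set Q := B (v (k + 1) - v k) (v (k + 1) - v k) with hQ
  have hQ0 : 0 ≤ Q := hpos _
  have hNk : N k = σ ^ 2 * Q := by
    have : v k - w = (-σ) • (v (k + 1) - v k) := by rw [hw]; module
    simp only [hN, this, map_smul, LinearMap.smul_apply, smul_eq_mul, hQ]; ring
  have hNk1 : N (k + 1) = (1 - σ) ^ 2 * Q := by
    have : v (k + 1) - w = (1 - σ) • (v (k + 1) - v k) := by rw [hw]; module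
    simp only [hN, this, map_smul, LinearMap.smul_apply, smul_eq_mul, hQ]; ring
  have hmain : 0 ≤ ∑ l ∈ Finset.range (k + 1), g l * (N l - N (l + 1)) := by
    rcases k with _ | K
    · simp only [zero_add, Finset.range_one, Finset.sum_singleton] at hNk hNk1 ⊢
      rw [hNk, hNk1]
      have : g 0 * (σ ^ 2 * Q - (1 - σ) ^ 2 * Q) = (2 * σ - 1) * (g 0 * Q) := by ring
      rw [this]
      exact mul_nonneg (by linarith) (mul_nonneg hg0 hQ0)
    · rw [Finset.sum_range_succ, hNk, hNk1]
      have h1 := abel_lower_bound (g := g) (N := N) K (fun l hl => hg l (by omega))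
        fun l _ _ => hNpos l
      rw [hNk] at h1
      have h2 := mul_nonneg hg0 (hNpos 0)
      have h3 := mul_le_mul_of_nonneg_right (hlast K rfl) hQ0
      have hgK : 0 ≤ g K := by
        have : ∀ l, l ≤ K → 0 ≤ g l := by
          intro l
          induction l with
          | zero => exact fun _ => hg0
          | succ l ih => exact fun hl => (ih (by omega)).trans (hg l (by omega))
        exact this K le_rfl
      have h4 : σ ^ 2 * (g K * Q) ≤ σ * (g K * Q) :=
        mul_le_mul_of_nonneg_right (by nlinarith) (mul_nonneg hgK hQ0)
      nlinarith
  linarith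

/-- Strong induction with `N l = V 0 + F/γ - V l`, nonnegative for earlier `l`. Abel summation gives
`g 0 * N 0 - g k * N (k + 1) ≤ F`, while `g 0 * N 0 ≥ γ (F/γ) = F`; hence `N (k + 1) ≥ 0`. -/
theorem discrete_max_principle {n : ℕ} {g : ℕ → ℕ → ℝ} {V : ℕ → ℝ} {F γ : ℝ} (hγ : 0 < γ)
    (hF : 0 ≤ F) (hg0 : ∀ k < n, γ ≤ g k 0)
    (hg : ∀ k < n, ∀ l, l < k → g k l ≤ g k (l + 1))
    (hV : ∀ k < n, ∑ l ∈ Finset.range (k + 1), g k l * (V (l + 1) - V l) ≤ F) :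
    ∀ k ≤ n, V k ≤ V 0 + F / γ := by
  intro k
  induction k using Nat.strong_induction_on with
  | _ k ih =>
    intro hk
    rcases k with _ | k
    · have := div_nonneg hF hγ.le
      linarith
    have hk' : k < n := hk
    have h1 := abel_lower_bound (g := g k) (N := fun l => V 0 + F / γ - V l) k (hg k hk')
      fun l _ hl => sub_nonneg.2 (ih l (by omega) (by omega))
    have h2 : ∑ l ∈ Finset.range (k + 1),
        g k l * ((V 0 + F / γ - V l) - (V 0 + F / γ - V (l + 1)))
        = ∑ l ∈ Finset.range (k + 1), g k l * (V (l + 1) - V l) :=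
      Finset.sum_congr rfl fun l _ => by ring
    simp only [h2] at h1
    have h3 := hV k hk'
    have h4 : F ≤ g k 0 * (V 0 + F / γ - V 0) := by
      have : γ * (F / γ) = F := by field_simp
      rw [add_sub_cancel_left]
      calc F = γ * (F / γ) := this.symm
        _ ≤ _ := mul_le_mul_of_nonneg_right (hg0 k hk') (div_nonneg hF hγ.le)
    have hgk : 0 < g k k := by
      have : ∀ l, l ≤ k → 0 < g k l := by
        intro l
        induction l with
        | zero => exact fun _ => hγ.trans_le (hg0 k hk')
        | succ l ihl => exact fun hl => (ihl (by omega)).trans_le (hg k hk' l (by omega))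
      exact this k le_rfl
    have h5 : 0 ≤ g k k * (V 0 + F / γ - V (k + 1)) := by linarith
    linarith [nonneg_of_mul_nonneg_right h5 hgk]

/-- Chebyshev's argument: `F (1/2)` may be subtracted because `s - 1/2` has mean zero, and then the
integrand is pointwise nonnegative. -/
theorem integral_sub_half_mul_nonneg {F : ℝ → ℝ} (hF : Continuous F) (hm : Monotone F) :
    0 ≤ ∫ s in (0 : ℝ)..1, (s - 1 / 2) * F s := by
  have h0 : ∫ s in (0 : ℝ)..1, (s - 1 / 2) * F (1 / 2) = 0 := by
    rw [intervalIntegral.integral_mul_const]; norm_num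
  refine h0.symm.le.trans (intervalIntegral.integral_mono_on zero_le_one
    (Continuous.intervalIntegrable (by fun_prop) _ _)
    (Continuous.intervalIntegrable (by fun_prop) _ _) fun s _ => ?_)
  rcases le_total s (1 / 2) with h | h
  · have := hm h; nlinarith
  · have := hm h; nlinarith

namespace Discretization

variable {d : ℕ} {P : Problem d} (M : Discretization P)

/-- The kernel of the fast formula. -/
noncomputable def ker (Nlo Nhi : ℤ) (k : ℕ) (τ : ℝ) : ℝ :=
  P.T ^ (-M.ασ k) / Real.Gamma (1 - M.ασ k)
    * ∑ i ∈ Finset.Ioc Nlo Nhi, M.θ k i * Real.exp (-M.lam i * (M.tσ k - τ) / P.T)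

theorem continuous_ker (Nlo Nhi : ℤ) (k : ℕ) : Continuous (M.ker Nlo Nhi k) := by
  unfold ker; fun_prop

theorem Gamma_one_sub_pos {k : ℕ} (hk : k < M.n) : 0 < Real.Gamma (1 - M.ασ k) :=
  Real.Gamma_pos_of_pos (by linarith [M.ασ_lt_one hk])

theorem ker_const_pos {k : ℕ} (hk : k < M.n) :
    0 < P.T ^ (-M.ασ k) / Real.Gamma (1 - M.ασ k) :=
  div_pos (Real.rpow_pos_of_pos T_pos _) (M.Gamma_one_sub_pos hk)

theorem ker_nonneg (Nlo Nhi : ℤ) {k : ℕ} (hk : k < M.n) (τ : ℝ) : 0 ≤ M.ker Nlo Nhi k τ :=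
  mul_nonneg (M.ker_const_pos hk).le (Finset.sum_nonneg fun i _ =>
    mul_nonneg (M.θ_pos hk i).le (Real.exp_pos _).le)

theorem monotone_exp_kernel (i : ℤ) (k : ℕ) :
    Monotone fun τ => Real.exp (-M.lam i * (M.tσ k - τ) / P.T) := by
  intro τ τ' h
  apply Real.exp_le_exp.2
  apply div_le_div_of_nonneg_right _ T_pos.le
  nlinarith [M.lam_pos i]

theorem monotone_ker (Nlo Nhi : ℤ) {k : ℕ} (hk : k < M.n) : Monotone (M.ker Nlo Nhi k) := by
  intro τ τ' h
  refine mul_le_mul_of_nonneg_left (Finset.sum_le_sum fun i _ => ?_) (M.ker_const_pos hk).le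
  exact mul_le_mul_of_nonneg_left (M.monotone_exp_kernel i k h) (M.θ_pos hk i).le

/-- Shifting by `η` multiplies each exponential by a constant at least 1, so the increment is again
a positive combination of increasing exponentials. It plays the role of convexity of the kernel in
`wB_mono`. -/
theorem monotone_ker_increment (Nlo Nhi : ℤ) {k : ℕ} (hk : k < M.n) {η : ℝ} (hη : 0 ≤ η) :
    Monotone fun τ => M.ker Nlo Nhi k (τ + η) - M.ker Nlo Nhi k τ := by
  have e : (fun τ => M.ker Nlo Nhi k (τ + η) - M.ker Nlo Nhi k τ)
      = fun τ => P.T ^ (-M.ασ k) / Real.Gamma (1 - M.ασ k) * ∑ i ∈ Finset.Ioc Nlo Nhi,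
        M.θ k i * ((Real.exp (M.lam i * η / P.T) - 1)
          * Real.exp (-M.lam i * (M.tσ k - τ) / P.T)) := by
    funext τ
    unfold ker
    rw [← mul_sub, ← Finset.sum_sub_distrib]
    refine congrArg _ (Finset.sum_congr rfl fun i _ => ?_)
    have : -M.lam i * (M.tσ k - (τ + η)) / P.T
        = M.lam i * η / P.T + -M.lam i * (M.tσ k - τ) / P.T := by ring
    rw [this, Real.exp_add]; ring
  rw [e]
  intro τ τ' h
  refine mul_le_mul_of_nonneg_left (Finset.sum_le_sum fun i _ => ?_) (M.ker_const_pos hk).le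
  refine mul_le_mul_of_nonneg_left (mul_le_mul_of_nonneg_left (M.monotone_exp_kernel i k h) ?_)
    (M.θ_pos hk i).le
  have := Real.one_le_exp (x := M.lam i * η / P.T)
    (div_nonneg (mul_nonneg (M.lam_pos i).le hη) T_pos.le)
  linarith

/-- The exponents do not depend on `k`, so moving the evaluation point from `t_{k+σ_k}` to the next
one multiplies the whole history by one exponential. Unrolled, the history is the exact integral of
the exponential against the derivative of the piecewise quadratic interpolant. -/
theorem hist_eq (v : ℕ → ℝ) (i : ℤ) (k : ℕ) :
    M.hist v i k = ∑ l ∈ Finset.range k, ∫ s in (0 : ℝ)..1,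
      Real.exp (-M.lam i * (M.tσ k - (M.t l + s * M.Δt)) / P.T)
        * ((3 / 2 - s) * (v (l + 1) - v l) + (s - 1 / 2) * (v (l + 2) - v (l + 1))) := by
  induction k with
  | zero => simp [hist]
  | succ k ih =>
    rw [hist, ih, Finset.sum_range_succ, Finset.mul_sum, add_assoc]
    congr 1
    · refine Finset.sum_congr rfl fun l _ => ?_
      rw [← intervalIntegral.integral_const_mul]
      refine intervalIntegral.integral_congr fun s _ => ?_
      rw [← mul_assoc, ← Real.exp_add]
      congr 2
      simp only [tσ, t_succ]
      ring
    · rw [coefA, coefB, ← intervalIntegral.integral_mul_const,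
        ← intervalIntegral.integral_mul_const, ← intervalIntegral.integral_add
        (Continuous.intervalIntegrable (by fun_prop) _ _)
        (Continuous.intervalIntegrable (by fun_prop) _ _)]
      refine intervalIntegral.integral_congr fun s _ => ?_
      simp only [tσ, t_succ]
      have : -M.lam i * (M.t k + M.Δt + M.σ (k + 1) * M.Δt - (M.t k + s * M.Δt)) / P.T
        = -M.lam i * (M.σ (k + 1) + 1 - s) * M.Δt / P.T := by ring
      rw [this]; ring

/-- The weight of the last, exactly integrated, increment. -/
noncomputable def lastWeight (k : ℕ) : ℝ := M.s k * M.σ k ^ (1 - M.ασ k)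

theorem FH_eq_integral (Nlo Nhi : ℤ) (v : ℕ → ℝ) (k : ℕ) :
    M.FH Nlo Nhi v k = (∑ l ∈ Finset.range k, ∫ s in (0 : ℝ)..1,
        M.ker Nlo Nhi k (M.t l + s * M.Δt)
          * ((3 / 2 - s) * (v (l + 1) - v l) + (s - 1 / 2) * (v (l + 2) - v (l + 1))))
      + M.lastWeight k * (v (k + 1) - v k) := by
  unfold FH lastWeight
  congr 1
  simp_rw [hist_eq, Finset.mul_sum]
  rw [Finset.sum_comm]
  refine Finset.sum_congr rfl fun l _ => ?_
  simp_rw [← intervalIntegral.integral_const_mul]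
  rw [← intervalIntegral.integral_finsetSum
    (fun i _ => Continuous.intervalIntegrable (by fun_prop) _ _)]
  refine intervalIntegral.integral_congr fun s _ => ?_
  simp only [ker]
  rw [mul_assoc, Finset.sum_mul, Finset.mul_sum]
  exact Finset.sum_congr rfl fun i _ => by ring

/-- The weight of the increment over the `l`-th interval coming from this interval. -/
noncomputable def wA (Nlo Nhi : ℤ) (k l : ℕ) : ℝ :=
  ∫ s in (0 : ℝ)..1, (3 / 2 - s) * M.ker Nlo Nhi k (M.t l + s * M.Δt)

/-- The weight of the increment over the `(l+1)`-st interval coming from the `l`-th interval. -/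
noncomputable def wB (Nlo Nhi : ℤ) (k l : ℕ) : ℝ :=
  ∫ s in (0 : ℝ)..1, (s - 1 / 2) * M.ker Nlo Nhi k (M.t l + s * M.Δt)

theorem continuous_ker_comp (Nlo Nhi : ℤ) (k l : ℕ) :
    Continuous fun s => M.ker Nlo Nhi k (M.t l + s * M.Δt) :=
  (M.continuous_ker Nlo Nhi k).comp (by fun_prop)

/-- The weights of the fast formula as a combination of increments. -/
noncomputable def weight (Nlo Nhi : ℤ) (k : ℕ) : ℕ → ℝ
  | 0 => if 0 < k then M.wA Nlo Nhi k 0 else M.lastWeight k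
  | l + 1 => (if l + 1 < k then M.wA Nlo Nhi k (l + 1) else M.lastWeight k) + M.wB Nlo Nhi k l

/-- On the `l`-th interval the quadratic interpolant uses the increments `l` and `l + 1`; collecting
both contributions to each increment gives `weight`. -/
theorem FH_eq_sum (Nlo Nhi : ℤ) (v : ℕ → ℝ) (k : ℕ) :
    M.FH Nlo Nhi v k
      = ∑ l ∈ Finset.range (k + 1), M.weight Nlo Nhi k l * (v (l + 1) - v l) := by
  have h1 : ∀ l, ∫ s in (0 : ℝ)..1, M.ker Nlo Nhi k (M.t l + s * M.Δt)
      * ((3 / 2 - s) * (v (l + 1) - v l) + (s - 1 / 2) * (v (l + 2) - v (l + 1)))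
      = M.wA Nlo Nhi k l * (v (l + 1) - v l) + M.wB Nlo Nhi k l * (v (l + 2) - v (l + 1)) := by
    intro l
    have hc := M.continuous_ker_comp Nlo Nhi k l
    rw [wA, wB, ← intervalIntegral.integral_mul_const, ← intervalIntegral.integral_mul_const,
      ← intervalIntegral.integral_add
      (Continuous.intervalIntegrable (by fun_prop) _ _)
      (Continuous.intervalIntegrable (by fun_prop) _ _)]
    exact intervalIntegral.integral_congr fun s _ => by ring
  rw [FH_eq_integral, Finset.sum_congr rfl fun l _ => h1 l, Finset.sum_add_distrib]
  rcases k with _ | k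
  · simp [weight]
  · rw [Finset.sum_range_succ' (fun l => M.weight Nlo Nhi (k + 1) l * (v (l + 1) - v l)),
      Finset.sum_range_succ' (fun l => M.wA Nlo Nhi (k + 1) l * (v (l + 1) - v l)),
      Finset.sum_range_succ (fun l => M.weight Nlo Nhi (k + 1) (l + 1) * _),
      Finset.sum_range_succ (fun l => M.wB Nlo Nhi (k + 1) l * _)]
    have h2 : ∑ l ∈ Finset.range k, M.weight Nlo Nhi (k + 1) (l + 1) * (v (l + 1 + 1) - v (l + 1))
        = ∑ l ∈ Finset.range k, M.wA Nlo Nhi (k + 1) (l + 1) * (v (l + 1 + 1) - v (l + 1))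
          + ∑ l ∈ Finset.range k, M.wB Nlo Nhi (k + 1) l * (v (l + 2) - v (l + 1)) := by
      rw [← Finset.sum_add_distrib]
      refine Finset.sum_congr rfl fun l hl => ?_
      have : l + 1 < k + 1 := by simpa using hl
      simp only [weight, this, if_true]; ring
    rw [h2]
    simp only [weight, lt_irrefl, if_false, Nat.succ_pos, if_true, zero_add]
    ring

theorem wA_mono (Nlo Nhi : ℤ) {k : ℕ} (hk : k < M.n) (l : ℕ) :
    M.wA Nlo Nhi k l ≤ M.wA Nlo Nhi k (l + 1) := by
  have hc := M.continuous_ker_comp Nlo Nhi k l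
  have hc' := M.continuous_ker_comp Nlo Nhi k (l + 1)
  refine intervalIntegral.integral_mono_on zero_le_one
    (Continuous.intervalIntegrable (by fun_prop) _ _)
    (Continuous.intervalIntegrable (by fun_prop) _ _) fun s hs => ?_
  refine mul_le_mul_of_nonneg_left (M.monotone_ker Nlo Nhi hk ?_) (by linarith [hs.2])
  rw [t_succ]; linarith [M.Δt_pos]

theorem wB_nonneg (Nlo Nhi : ℤ) {k : ℕ} (hk : k < M.n) (l : ℕ) : 0 ≤ M.wB Nlo Nhi k l := by
  refine integral_sub_half_mul_nonneg (M.continuous_ker_comp Nlo Nhi k l) fun s s' h => ?_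
  refine M.monotone_ker Nlo Nhi hk ?_
  nlinarith [M.Δt_pos]

/-- The difference of the two integrals is again of the form in `integral_sub_half_mul_nonneg`, with
the increment of the kernel over one time step as the monotone function. -/
theorem wB_mono (Nlo Nhi : ℤ) {k : ℕ} (hk : k < M.n) (l : ℕ) :
    M.wB Nlo Nhi k l ≤ M.wB Nlo Nhi k (l + 1) := by
  have hc := M.continuous_ker_comp Nlo Nhi k l
  have hc' := M.continuous_ker_comp Nlo Nhi k (l + 1)
  rw [← sub_nonneg, wB, wB, ← intervalIntegral.integral_sub
    (Continuous.intervalIntegrable (by fun_prop) _ _)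
    (Continuous.intervalIntegrable (by fun_prop) _ _)]
  simp_rw [← mul_sub]
  refine integral_sub_half_mul_nonneg (by fun_prop) fun s s' h => ?_
  have := M.monotone_ker_increment Nlo Nhi hk M.Δt_pos.le
    (show M.t l + s * M.Δt ≤ M.t l + s' * M.Δt by nlinarith [M.Δt_pos])
  simp only [t_succ] at this ⊢
  simp only [add_right_comm (M.t l) M.Δt]
  exact this

end Discretization
end FL21

/-! ### Quantitative bounds for the weights. -/

namespace FL21

open Set Filter Topology MeasureTheory

theorem integral_inv_two_sub : ∫ s in (0 : ℝ)..1, 1 / (2 - s) = Real.log 2 := by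
  have h := intervalIntegral.integral_comp_sub_left (fun x : ℝ => 1 / x) (a := 0) (b := 1) 2
  rw [h, integral_one_div_of_pos (by norm_num) (by norm_num)]
  norm_num

namespace Discretization

variable {d : ℕ} {P : Problem d} (M : Discretization P)

theorem T_rpow_mul_div_rpow {k : ℕ} {y : ℝ} (hy : 0 < y) :
    P.T ^ (-M.ασ k) / Real.Gamma (1 - M.ασ k) * (y / P.T) ^ (-M.ασ k)
      = y ^ (-M.ασ k) / Real.Gamma (1 - M.ασ k) := by
  have hT := T_pos (P := P)
  rw [Real.div_rpow hy.le hT.le]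
  have := (Real.rpow_pos_of_pos hT (-M.ασ k)).ne'
  field_simp

theorem ker_le {Nlo Nhi : ℤ} {k : ℕ} (hk : k < M.n) {τ : ℝ} (hτ : τ < M.tσ k) :
    M.ker Nlo Nhi k τ ≤ (M.tσ k - τ) ^ (-M.ασ k) / Real.Gamma (1 - M.ασ k)
      * (1 + 4 / 5 * M.ασ k * M.ε) := by
  have hy : 0 < M.tσ k - τ := by linarith
  have h := M.sum_le_full hk (x := (M.tσ k - τ) / P.T) (div_pos hy T_pos) (Finset.Ioc Nlo Nhi)
  rw [← M.T_rpow_mul_div_rpow hy, mul_assoc]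
  refine mul_le_mul_of_nonneg_left ?_ (M.ker_const_pos hk).le
  simpa only [mul_div_assoc] using h

theorem abs_ker_sub_le {Nlo Nhi : ℤ} (hN : M.ESAAccurate Nlo Nhi) {k : ℕ} (hk1 : 1 ≤ k)
    (hk : k < M.n) {τ : ℝ} (hτ : τ ∈ Icc 0 (M.t k)) :
    |M.ker Nlo Nhi k τ - (M.tσ k - τ) ^ (-M.ασ k) / Real.Gamma (1 - M.ασ k)|
      ≤ (M.tσ k - τ) ^ (-M.ασ k) / Real.Gamma (1 - M.ασ k) * M.ε := by
  have hy : 0 < M.tσ k - τ := by linarith [hτ.2, M.t_lt_tσ hk]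
  have h := hN k hk1 hk τ hτ
  rw [← M.T_rpow_mul_div_rpow hy, ker, ← mul_sub, abs_mul, abs_of_pos (M.ker_const_pos hk),
    abs_sub_comm, mul_assoc]
  exact mul_le_mul_of_nonneg_left h (M.ker_const_pos hk).le

theorem lastWeight_eq {k : ℕ} (hk : k < M.n) :
    (1 - M.ασ k) * M.lastWeight k
      = M.σ k * ((M.σ k * M.Δt) ^ (-M.ασ k) / Real.Gamma (1 - M.ασ k)) := by
  have hα1 : 0 < 1 - M.ασ k := by linarith [M.ασ_lt_one hk]
  have hσ := M.σ_pos hk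
  rw [lastWeight, s, show (2 : ℝ) - M.ασ k = (1 - M.ασ k) + 1 by ring,
    Real.Gamma_add_one hα1.ne', Real.mul_rpow hσ.le M.Δt_pos.le,
    show (1 : ℝ) - M.ασ k = 1 + -M.ασ k by ring, Real.rpow_add hσ, Real.rpow_one]
  have : 1 + -M.ασ k ≠ 0 := by linarith
  have := (M.Gamma_one_sub_pos hk).ne'
  rw [show (1 : ℝ) - M.ασ k = 1 + -M.ασ k by ring] at this
  field_simp

theorem lastWeight_pos {k : ℕ} (hk : k < M.n) : 0 < M.lastWeight k := by
  have hα1 : 0 < 1 - M.ασ k := by linarith [M.ασ_lt_one hk]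
  have h := M.lastWeight_eq hk
  have : 0 < (1 - M.ασ k) * M.lastWeight k := by
    rw [h]
    have := M.σ_pos hk
    have := M.Δt_pos
    have := M.Gamma_one_sub_pos hk
    positivity
  exact pos_of_mul_pos_right this hα1.le

/-- Since `(1 - σ)(1 - s) ≥ 0`, the base is at least `σ (2 - s)`. Weighted AM-GM then makes the
bound affine in `α`, so that its integral over `s` is elementary. -/
theorem rpow_neg_le_of_mul_le {σ α s : ℝ} (hσ : 0 < σ) (hσ1 : σ ≤ 1) (hα : 0 ≤ α) (hα1 : α ≤ 1)
    (hs : s ∈ Icc (0 : ℝ) 1) :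
    (σ + 1 - s) ^ (-α) ≤ σ ^ (-α) * (1 - α + α * (1 / (2 - s))) := by
  have h2 : 0 < 2 - s := by linarith [hs.2]
  have h1 : σ * (2 - s) ≤ σ + 1 - s := by nlinarith [hs.1, hs.2]
  calc (σ + 1 - s) ^ (-α) ≤ (σ * (2 - s)) ^ (-α) :=
        Real.rpow_le_rpow_of_nonpos (by positivity) h1 (by linarith)
    _ = σ ^ (-α) * ((1 : ℝ) ^ (1 - α) * (1 / (2 - s)) ^ α) := by
        rw [Real.mul_rpow hσ.le h2.le, Real.one_rpow, one_mul, one_div, Real.inv_rpow h2.le,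
          Real.rpow_neg h2.le]
    _ ≤ _ := by
        refine mul_le_mul_of_nonneg_left ?_ (Real.rpow_nonneg hσ.le _)
        have := Real.geom_mean_le_arith_mean2_weighted (w₁ := 1 - α) (w₂ := α) (p₁ := 1)
          (p₂ := 1 / (2 - s)) (by linarith) hα zero_le_one (by positivity) (by ring)
        linarith

/-- The two weights add up to the mean of the kernel over the interval before the last node, and
this mean must not exceed the kernel value at distance `σ Δt`. Accuracy of the sum is not needed,
only the bound valid for all partial sums. -/
theorem wA_add_wB_le {Nlo Nhi : ℤ} {k l : ℕ} (hk : k < M.n) (hl : l + 1 = k) :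
    M.σ k * (M.wA Nlo Nhi k l + M.wB Nlo Nhi k l) ≤ (1 - M.ασ k) * M.lastWeight k := by
  have hσ := M.σ_pos hk
  have hα := M.ασ_pos hk
  have hα1 := M.ασ_lt_one hk
  have hΔ := M.Δt_pos
  have hG := M.Gamma_one_sub_pos hk
  have hc := M.continuous_ker_comp Nlo Nhi k l
  rw [M.lastWeight_eq hk]
  refine mul_le_mul_of_nonneg_left ?_ hσ.le
  set R := (M.σ k * M.Δt) ^ (-M.ασ k) / Real.Gamma (1 - M.ασ k) with hR
  have hR0 : 0 < R := by positivity
  have h1 : M.wA Nlo Nhi k l + M.wB Nlo Nhi k l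
      = ∫ s in (0 : ℝ)..1, M.ker Nlo Nhi k (M.t l + s * M.Δt) := by
    rw [wA, wB, ← intervalIntegral.integral_add
      (Continuous.intervalIntegrable (by fun_prop) _ _)
      (Continuous.intervalIntegrable (by fun_prop) _ _)]
    exact intervalIntegral.integral_congr fun s _ => by ring
  have hint : IntervalIntegrable (fun s : ℝ => 1 / (2 - s)) volume 0 1 := by
    refine ContinuousOn.intervalIntegrable ?_
    refine continuousOn_const.div (by fun_prop) fun s hs => ?_
    rw [uIcc_of_le zero_le_one] at hs
    linarith [hs.2]
  have h2 : ∫ s in (0 : ℝ)..1, M.ker Nlo Nhi k (M.t l + s * M.Δt)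
      ≤ ∫ s in (0 : ℝ)..1, R * (1 + 4 / 5 * M.ασ k * M.ε)
        * (1 - M.ασ k + M.ασ k * (1 / (2 - s))) := by
    refine intervalIntegral.integral_mono_on zero_le_one (hc.intervalIntegrable _ _) ?_
      fun s hs => ?_
    · exact ((intervalIntegrable_const).add (hint.const_mul _)).const_mul _
    · have ey : M.tσ k - (M.t l + s * M.Δt) = (M.σ k + 1 - s) * M.Δt := by
        rw [tσ, ← hl, t_succ]; ring
      have hpos : 0 < (M.σ k + 1 - s) := by linarith [hs.2]
      have h3 := M.ker_le (Nlo := Nlo) (Nhi := Nhi) hk (τ := M.t l + s * M.Δt)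
        (by have : 0 < (M.σ k + 1 - s) * M.Δt := by positivity
            linarith)
      refine h3.trans ?_
      have h4 := rpow_neg_le_of_mul_le hσ (M.σ_lt hk).le hα.le hα1.le hs
      rw [ey, Real.mul_rpow hpos.le hΔ.le, hR, Real.mul_rpow hσ.le hΔ.le]
      have hε := M.ε_pos
      have h5 : 0 ≤ M.Δt ^ (-M.ασ k) / Real.Gamma (1 - M.ασ k) * (1 + 4 / 5 * M.ασ k * M.ε) := by
        positivity
      have := mul_le_mul_of_nonneg_right h4 h5
      calc _ = (M.σ k + 1 - s) ^ (-M.ασ k)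
            * (M.Δt ^ (-M.ασ k) / Real.Gamma (1 - M.ασ k) * (1 + 4 / 5 * M.ασ k * M.ε)) := by ring
        _ ≤ _ := this
        _ = _ := by ring
  rw [h1]
  refine h2.trans ?_
  rw [intervalIntegral.integral_const_mul, intervalIntegral.integral_add intervalIntegrable_const
    (hint.const_mul _), intervalIntegral.integral_const_mul, integral_inv_two_sub]
  simp only [intervalIntegral.integral_const, sub_zero, one_smul]
  have hlog := Real.log_two_lt_d9
  have hε := M.ε_lt
  have hε0 := M.ε_pos
  -- The margin is tight: `(4/5) ε < 0.2944` since `ε ≤ 1/e`, whereas `1 - log 2 > 0.3068`. Both are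
  -- multiplied by `α`, so the comparison survives small orders.
  have h6 : (1 + 4 / 5 * M.ασ k * M.ε) * (1 - M.ασ k + M.ασ k * Real.log 2) ≤ 1 := by
    have h7 : 1 + 4 / 5 * M.ασ k * M.ε ≤ 1 + 0.2944 * M.ασ k := by nlinarith
    have h8 : 1 - M.ασ k + M.ασ k * Real.log 2 ≤ 1 - 0.3068 * M.ασ k := by nlinarith
    calc _ ≤ (1 + 0.2944 * M.ασ k) * (1 - 0.3068 * M.ασ k) := by
          refine mul_le_mul h7 h8 ?_ (by positivity)
          have := Real.log_two_gt_d9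
          nlinarith
      _ ≤ 1 := by nlinarith
  calc _ = R * ((1 + 4 / 5 * M.ασ k * M.ε) * (1 - M.ασ k + M.ασ k * Real.log 2)) := by ring
    _ ≤ R * 1 := by gcongr
    _ = R := mul_one R

/-- The choice of shift gives `2σ - 1 = 1 - α`, which is exactly the factor by which `lastWeight`
exceeds `σ` times the kernel value at distance `σ Δt`. -/
theorem weight_last {Nlo Nhi : ℤ} {k l : ℕ} (hk : k < M.n) (hl : l + 1 = k) :
    M.σ k * M.weight Nlo Nhi k l ≤ (2 * M.σ k - 1) * M.weight Nlo Nhi k k := by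
  have h1 := M.wA_add_wB_le (Nlo := Nlo) (Nhi := Nhi) hk hl
  have h2 : 2 * M.σ k - 1 = 1 - M.ασ k := by rw [M.σ_eq hk]; ring
  have hσ := M.σ_pos hk
  have h3 : M.weight Nlo Nhi k l ≤ M.wA Nlo Nhi k l + M.wB Nlo Nhi k l := by
    have hlk : l < k := by omega
    rcases l with _ | l
    · simp only [weight, hlk, if_true]
      linarith [M.wB_nonneg Nlo Nhi hk 0]
    · simp only [weight, hlk, if_true]
      linarith [M.wB_mono Nlo Nhi hk l]
  have h4 : M.lastWeight k ≤ M.weight Nlo Nhi k k := by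
    subst hl
    simp only [weight, lt_irrefl, if_false]
    linarith [M.wB_nonneg Nlo Nhi hk l]
  rw [h2]
  have := M.ασ_lt_one hk
  nlinarith

theorem weight_nonneg_zero {Nlo Nhi : ℤ} {k : ℕ} (hk : k < M.n) : 0 ≤ M.weight Nlo Nhi k 0 := by
  simp only [weight]
  split_ifs
  · refine intervalIntegral.integral_nonneg zero_le_one fun s hs => ?_
    exact mul_nonneg (by linarith [hs.2]) (M.ker_nonneg Nlo Nhi hk _)
  · exact (M.lastWeight_pos hk).le

/-- Away from the end this is monotonicity of `wA` and `wB`. At the end it follows from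
`weight_last`, because `2σ - 1 ≤ σ`. -/
theorem weight_mono {Nlo Nhi : ℤ} {k : ℕ} (hk : k < M.n) :
    ∀ l, l < k → M.weight Nlo Nhi k l ≤ M.weight Nlo Nhi k (l + 1) := by
  have hinner : ∀ l, l + 1 < k → M.weight Nlo Nhi k l ≤ M.weight Nlo Nhi k (l + 1) := by
    intro l hl
    have hl' : l < k := by omega
    have hA := M.wA_mono Nlo Nhi hk l
    rcases l with _ | l
    · simp only [weight, hl, hl', if_true]
      linarith [M.wB_nonneg Nlo Nhi hk 0]
    · simp only [weight, hl, hl', if_true]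
      linarith [M.wB_mono Nlo Nhi hk l]
  intro l hl
  rcases Nat.lt_or_ge (l + 1) k with h | h
  · exact hinner l h
  · have hlk : l + 1 = k := by omega
    have h1 := M.weight_last (Nlo := Nlo) (Nhi := Nhi) hk hlk
    have hpos : ∀ j, j < k → 0 ≤ M.weight Nlo Nhi k j := by
      intro j
      induction j with
      | zero => exact fun _ => M.weight_nonneg_zero hk
      | succ j ih => exact fun hj => (ih (by omega)).trans (hinner j hj)
    have h2 := hpos l hl
    rw [hlk]
    have := M.σ_gt hk
    have := M.σ_lt hk
    by_contra! hlt
    nlinarith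

/-- Without boundedness the supremum defining `c₁` would carry no information. Here `T ≥ 1` enters,
through `t^α ≤ T`. -/
theorem c₁_bddAbove :
    BddAbove ((fun t => t ^ P.α t * Real.Gamma (1 - P.α t)) '' Icc 0 P.T) := by
  have hcont : ContinuousOn Real.Gamma (Icc (1 - P.αhi) (1 - P.αlo)) := by
    intro x hx
    have : 0 < x := by linarith [hx.1, P.αhi_lt_one]
    exact (Real.differentiableAt_Gamma fun m => by
      have : (0 : ℝ) ≤ m := m.cast_nonneg
      linarith).continuousAt.continuousWithinAt
  obtain ⟨C, hC⟩ := (isCompact_Icc.bddAbove_image hcont)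
  refine ⟨P.T * C, ?_⟩
  rintro _ ⟨t, ht, rfl⟩
  have hα := P.α_mem t ht
  have h1 : t ^ P.α t ≤ P.T := by
    calc t ^ P.α t ≤ P.T ^ P.α t := Real.rpow_le_rpow ht.1 ht.2 (P.αlo_pos.le.trans hα.1)
      _ ≤ P.T ^ (1 : ℝ) := Real.rpow_le_rpow_of_exponent_le P.one_le_T
          (hα.2.trans P.αhi_lt_one.le)
      _ = P.T := Real.rpow_one _
  have h2 : Real.Gamma (1 - P.α t) ≤ C :=
    hC ⟨1 - P.α t, ⟨by linarith [hα.2], by linarith [hα.1]⟩, rfl⟩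
  have h3 : 0 < Real.Gamma (1 - P.α t) :=
    Real.Gamma_pos_of_pos (by linarith [hα.2, P.αhi_lt_one])
  exact mul_le_mul h1 h2 h3.le T_pos.le

theorem le_c₁ {k : ℕ} (hk : k < M.n) :
    M.tσ k ^ M.ασ k * Real.Gamma (1 - M.ασ k) ≤ P.c₁ :=
  le_csSup c₁_bddAbove ⟨M.tσ k, M.tσ_mem hk, rfl⟩

theorem c₁_pos (M : Discretization P) : 0 < P.c₁ :=
  (mul_pos (Real.rpow_pos_of_pos (M.tσ_pos M.n_pos) _) (M.Gamma_one_sub_pos M.n_pos)).trans_le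
    (M.le_c₁ M.n_pos)

/-- For `k ≥ 1` accuracy gives the kernel at least `1 - ε` times the exact one, which is smallest at
`τ = 0`; there it is at least `1/c₁`. For `k = 0` only the exactly integrated piece is present, and
`σ ≥ 1 - α` suffices. -/
theorem weight_zero_lower {Nlo Nhi : ℤ} (hN : M.ESAAccurate Nlo Nhi) {k : ℕ} (hk : k < M.n) :
    (1 - M.ε) / P.c₁ ≤ M.weight Nlo Nhi k 0 := by
  have hε : 0 < 1 - M.ε := by linarith [M.ε_lt]
  have hε0 := M.ε_pos
  have hG := M.Gamma_one_sub_pos hk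
  have htσ := M.tσ_pos hk
  have hα := M.ασ_pos hk
  have hα1 := M.ασ_lt_one hk
  have hc : (1 - M.ε) / P.c₁
      ≤ (1 - M.ε) * (M.tσ k ^ (-M.ασ k) / Real.Gamma (1 - M.ασ k)) := by
    rw [div_eq_mul_inv]
    refine mul_le_mul_of_nonneg_left ?_ hε.le
    have h1 := inv_anti₀ (mul_pos (Real.rpow_pos_of_pos htσ _) hG) (M.le_c₁ hk)
    rwa [mul_inv, ← Real.rpow_neg htσ.le, ← div_eq_mul_inv] at h1
  refine hc.trans ?_
  rcases Nat.eq_zero_or_pos k with rfl | hkpos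
  · simp only [weight, lt_irrefl, if_false]
    have h1 := M.lastWeight_eq hk
    have h2 : M.tσ 0 = M.σ 0 * M.Δt := by simp [tσ, t]
    rw [← h2] at h1
    have h3 : 0 < M.tσ 0 ^ (-M.ασ 0) / Real.Gamma (1 - M.ασ 0) := by positivity
    have h4 := M.σ_eq hk
    have h5 : (1 - M.ασ 0) * (M.tσ 0 ^ (-M.ασ 0) / Real.Gamma (1 - M.ασ 0))
        ≤ (1 - M.ασ 0) * M.lastWeight 0 := by
      rw [h1]; exact mul_le_mul_of_nonneg_right (by linarith) h3.le
    have h6 := le_of_mul_le_mul_left h5 (by linarith)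
    nlinarith
  · simp only [weight, hkpos, if_true]
    have hck := M.continuous_ker_comp Nlo Nhi k 0
    -- The factor `3/2 - s` is positive with mean 1, so a pointwise lower bound for the kernel
    -- passes to `wA`.
    have h0 : (1 - M.ε) * (M.tσ k ^ (-M.ασ k) / Real.Gamma (1 - M.ασ k))
        = ∫ s in (0 : ℝ)..1, (3 / 2 - s)
          * ((1 - M.ε) * (M.tσ k ^ (-M.ασ k) / Real.Gamma (1 - M.ασ k))) := by
      have : ∫ s in (0 : ℝ)..1, (3 / 2 - s) = 1 := by
        rw [intervalIntegral.integral_sub intervalIntegrable_const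
          intervalIntegral.intervalIntegrable_id]
        norm_num
      rw [intervalIntegral.integral_mul_const, this, one_mul]
    rw [h0, wA]
    refine intervalIntegral.integral_mono_on zero_le_one
      (Continuous.intervalIntegrable (by fun_prop) _ _)
      (Continuous.intervalIntegrable (by fun_prop) _ _) fun s hs => ?_
    refine mul_le_mul_of_nonneg_left ?_ (by linarith [hs.2])
    have hτ : M.t 0 + s * M.Δt ∈ Icc 0 (M.t k) := by
      have h0 : M.t 0 = 0 := by simp [t]
      have h1 : M.t 1 = M.Δt := by simp [t]
      have h2 := M.t_mono (Nat.succ_le_of_lt hkpos)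
      rw [h0, zero_add]
      simp only [Nat.succ_eq_add_one, zero_add, h1] at h2
      exact ⟨mul_nonneg hs.1 M.Δt_pos.le, by nlinarith [hs.2, M.Δt_pos]⟩
    have h1 := (abs_le.1 (M.abs_ker_sub_le hN hkpos hk hτ)).1
    have h2 : M.tσ k ^ (-M.ασ k) ≤ (M.tσ k - (M.t 0 + s * M.Δt)) ^ (-M.ασ k) :=
      Real.rpow_le_rpow_of_nonpos (by linarith [hτ.2, M.t_lt_tσ hk]) (by linarith [hτ.1])
        (by linarith)
    have h3 := div_le_div_of_nonneg_right h2 hG.le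
    nlinarith

end Discretization
end FL21

/-! ### Commuting matrices and summation by parts on the grid. -/

namespace FL21

open Set Filter Topology MeasureTheory
open scoped MatrixOrder

section OrderedMatrices

variable {ι κ : Type*}

theorem matrix_mul_nonneg [Fintype ι] [DecidableEq ι] {A B : Matrix ι ι ℝ} (hA : 0 ≤ A) (hB : 0 ≤ B) (h : Commute A B) :
    0 ≤ A * B := h.mul_nonneg hA hB

theorem matrix_smul_nonneg {A : Matrix ι ι ℝ} {c : ℝ} (hc : 0 ≤ c) (hA : 0 ≤ A) : 0 ≤ c • A :=
  Matrix.nonneg_iff_posSemidef.2 ((Matrix.nonneg_iff_posSemidef.1 hA).smul hc)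

theorem matrix_smul_one_nonneg [DecidableEq ι] {c : ℝ} (hc : 0 ≤ c) : (0 : Matrix ι ι ℝ) ≤ c • 1 :=
  matrix_smul_nonneg hc (Matrix.nonneg_iff_posSemidef.2 Matrix.PosSemidef.one)

theorem matrix_dotProduct_nonneg [Fintype ι] {A : Matrix ι ι ℝ} (hA : 0 ≤ A) (x : ι → ℝ) :
    0 ≤ x ⬝ᵥ A.mulVec x := by
  simpa using (Matrix.nonneg_iff_posSemidef.1 hA).dotProduct_mulVec_nonneg x

theorem matrix_transpose_of_nonneg {A : Matrix ι ι ℝ} (hA : 0 ≤ A) : A.transpose = A := by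
  have := (Matrix.nonneg_iff_posSemidef.1 hA).1
  rwa [Matrix.IsHermitian, Matrix.conjTranspose_eq_transpose_of_trivial] at this

variable [Fintype ι] [DecidableEq ι]

theorem commute_list_map_prod {A : κ → Matrix ι ι ℝ} {B : Matrix ι ι ℝ}
    (hcomm : ∀ l, Commute B (A l)) (L : List κ) : Commute B (L.map A).prod :=
  Commute.list_prod_right _ _ fun x hx => by
    obtain ⟨l, -, rfl⟩ := List.mem_map.1 hx
    exact hcomm l

/-- Induction on `A P - c^(n+1) = (A - c) P + c (P - c^n)`, where the product is nonnegative because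
its factors commute. -/
theorem list_map_prod_lower {A : κ → Matrix ι ι ℝ} (hcomm : ∀ r s, Commute (A r) (A s))
    {c : ℝ} (hc : 0 ≤ c) (hA : ∀ r, c • (1 : Matrix ι ι ℝ) ≤ A r) (L : List κ) :
    c ^ L.length • (1 : Matrix ι ι ℝ) ≤ (L.map A).prod := by
  induction L with
  | nil => simp
  | cons r L ih =>
    have hP : 0 ≤ (L.map A).prod := (matrix_smul_one_nonneg (pow_nonneg hc _)).trans ih
    have h1 : 0 ≤ (A r - c • 1) * (L.map A).prod :=
      matrix_mul_nonneg (sub_nonneg.2 (hA r)) hP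
        ((commute_list_map_prod (hcomm r) L).sub_left ((Commute.one_left _).smul_left c))
    have h2 := matrix_smul_nonneg hc (sub_nonneg.2 ih)
    have h3 := add_nonneg h1 h2
    rw [← sub_nonneg, List.map_cons, List.prod_cons, List.length_cons]
    convert! h3 using 1
    rw [sub_mul, smul_sub, smul_mul_assoc, one_mul, smul_smul, pow_succ']
    abel

end OrderedMatrices

namespace Discretization

variable {d : ℕ} {P : Problem d} (M : Discretization P)

/-- Extension by zero of a function on the interior grid points. -/
noncomputable def ext (w : M.J → ℝ) (j : Fin d → ℤ) : ℝ := if h : j ∈ M.J then w ⟨j, h⟩ else 0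

theorem ext_of_mem (w : M.J → ℝ) (j : M.J) : M.ext w j = w j := by simp [ext]

theorem ext_of_notMem (w : M.J → ℝ) {j : Fin d → ℤ} (h : j ∉ M.J) : M.ext w j = 0 := by
  simp [ext, h]

theorem ext_add (v w : M.J → ℝ) : M.ext (v + w) = M.ext v + M.ext w := by
  funext j; by_cases h : j ∈ M.J <;> simp [ext, h]

theorem ext_smul (c : ℝ) (w : M.J → ℝ) : M.ext (c • w) = c • M.ext w := by
  funext j; by_cases h : j ∈ M.J <;> simp [ext, h]

theorem mem_J {j : Fin d → ℤ} : j ∈ M.J ↔ ∀ k, j k ∈ Finset.Icc 1 ((M.m k : ℤ) - 1) := by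
  simp [J]

theorem Δx_pos (k : Fin d) : 0 < M.Δx k :=
  div_pos (sub_pos.2 (P.a_lt_b k)) (by exact_mod_cast M.m_pos k)

/-- Grid points whose `k`-th index is interior. -/
def slab (k : Fin d) : Set (Fin d → ℤ) := {j | j k ∈ Finset.Icc 1 ((M.m k : ℤ) - 1)}

theorem add_single_apply_ne {k l : Fin d} (h : l ≠ k) (j : Fin d → ℤ) (c : ℤ) :
    (j + Pi.single k c : Fin d → ℤ) l = j l := by simp [h]

theorem sub_single_apply_ne {k l : Fin d} (h : l ≠ k) (j : Fin d → ℤ) (c : ℤ) :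
    (j - Pi.single k c : Fin d → ℤ) l = j l := by simp [h]

theorem avg_eq_of_mem {k : Fin d} {j : Fin d → ℤ} (hj : j ∈ M.slab k) (w : (Fin d → ℤ) → ℝ) :
    M.avg k w j = w j + M.Δx k ^ 2 / 12 * M.δ2 k w j := by
  have := (M.Δx_pos k).ne'
  rw [avg, if_pos (show j k ∈ _ from hj), δ2]
  field_simp
  ring

/-- The restriction of `-δ_r²` to the interior grid functions, extended by zero. -/
noncomputable def negδ2 (r : Fin d) : (M.J → ℝ) →ₗ[ℝ] (M.J → ℝ) where
  toFun w j := -M.δ2 r (M.ext w) j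
  map_add' v w := by
    funext j; simp only [ext_add, δ2, Pi.add_apply]; ring
  map_smul' c w := by
    funext j; simp only [ext_smul, δ2, Pi.smul_apply, smul_eq_mul, RingHom.id_apply]; ring

/-- The identity holds beyond the interior. If the index in direction `r` is interior but the point
is not in `J`, another coordinate is at fault, and the whole stencil in direction `r` lies where the
extension vanishes. Compositions of one-dimensional operators rely on this. -/
theorem ext_negδ2 (r : Fin d) (w : M.J → ℝ) {j : Fin d → ℤ} (hj : j ∈ M.slab r) :
    M.ext (M.negδ2 r w) j = -M.δ2 r (M.ext w) j := by
  by_cases h : j ∈ M.J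
  · exact M.ext_of_mem _ ⟨j, h⟩
  · rw [ext_of_notMem _ _ h]
    have hout : ∀ j' : Fin d → ℤ, (∀ l, l ≠ r → j' l = j l) → M.ext w j' = 0 := by
      intro j' hj'
      refine M.ext_of_notMem _ fun hmem => h ?_
      rw [mem_J] at hmem ⊢
      intro l
      by_cases hl : l = r
      · exact hl ▸ hj
      · rw [← hj' l hl]; exact hmem l
    rw [δ2, hout _ fun l hl => add_single_apply_ne hl j 1, hout _ fun l _ => rfl,
      hout _ fun l hl => sub_single_apply_ne hl j 1]
    ring

theorem negδ2_comm (r s : Fin d) (w : M.J → ℝ) :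
    M.negδ2 r (M.negδ2 s w) = M.negδ2 s (M.negδ2 r w) := by
  by_cases hrs : r = s
  · rw [hrs]
  have key : ∀ r s, r ≠ s → ∀ j : M.J, M.negδ2 r (M.negδ2 s w) j
      = M.δ2 r (M.δ2 s (M.ext w)) j := by
    intro r s hrs j
    have hj : ∀ k, j.1 ∈ M.slab k := M.mem_J.1 j.2
    have h1 : M.negδ2 r (M.negδ2 s w) j = -M.δ2 r (M.ext (M.negδ2 s w)) j := rfl
    rw [h1, δ2, ext_negδ2 _ _ _ (hj s), ext_negδ2, ext_negδ2, δ2, δ2, δ2, δ2]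
    · simp only [δ2]; ring
    · change (j.1 - Pi.single r 1 : Fin d → ℤ) s ∈ Finset.Icc 1 ((M.m s : ℤ) - 1)
      rw [sub_single_apply_ne (Ne.symm hrs)]; exact hj s
    · change (j.1 + Pi.single r 1 : Fin d → ℤ) s ∈ Finset.Icc 1 ((M.m s : ℤ) - 1)
      rw [add_single_apply_ne (Ne.symm hrs)]; exact hj s
  funext j
  rw [key r s hrs, key s r (Ne.symm hrs)]
  simp only [δ2]
  have e1 : j.1 + Pi.single r 1 + Pi.single s 1 = j.1 + Pi.single s 1 + Pi.single r (1 : ℤ) :=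
    add_right_comm _ _ _
  have e2 : j.1 + Pi.single r 1 - Pi.single s 1 = j.1 - Pi.single s 1 + Pi.single r (1 : ℤ) := by
    abel
  have e3 : j.1 - Pi.single r 1 + Pi.single s 1 = j.1 + Pi.single s 1 - Pi.single r (1 : ℤ) := by
    abel
  have e4 : j.1 - Pi.single r 1 - Pi.single s 1 = j.1 - Pi.single s 1 - Pi.single r (1 : ℤ) := by
    abel
  rw [e1, e2, e3, e4]
  ring

/-- Index set of the half-integer points in the direction `r`. -/
noncomputable def stag (r : Fin d) : Finset (Fin d → ℤ) :=
  Fintype.piFinset fun l => Finset.Icc (if l = r then (0 : ℤ) else 1) ((M.m l : ℤ) - 1)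

theorem mem_stag_of_mem (r : Fin d) {j : Fin d → ℤ} (h : j ∈ M.J) : j ∈ M.stag r := by
  rw [mem_J] at h
  refine Fintype.mem_piFinset.2 fun l => ?_
  have := Finset.mem_Icc.1 (h l)
  rw [Finset.mem_Icc]
  split_ifs <;> omega

theorem mem_stag_of_add_mem (r : Fin d) {j : Fin d → ℤ} (h : j + Pi.single r 1 ∈ M.J) :
    j ∈ M.stag r := by
  rw [mem_J] at h
  refine Fintype.mem_piFinset.2 fun l => ?_
  have := Finset.mem_Icc.1 (h l)
  rw [Finset.mem_Icc]
  by_cases hl : l = r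
  · subst hl
    simp only [Pi.add_apply, Pi.single_eq_same] at this
    simp only [if_true]; omega
  · rw [add_single_apply_ne hl] at this
    simpa [hl] using this

theorem sum_stag (r : Fin d) {F : (Fin d → ℤ) → ℝ} (hF : ∀ j, j ∉ M.J → F j = 0) :
    ∑ j ∈ M.stag r, F j = ∑ j ∈ M.J, F j :=
  (Finset.sum_subset (fun _ h => M.mem_stag_of_mem r h) fun j _ hj => hF j hj).symm

theorem sum_stag_shift (r : Fin d) {F : (Fin d → ℤ) → ℝ} (hF : ∀ j, j ∉ M.J → F j = 0) :
    ∑ j ∈ M.stag r, F (j + Pi.single r 1) = ∑ j ∈ M.J, F j := by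
  have h := Finset.sum_map (M.stag r) (addRightEmbedding (Pi.single r 1)) F
  simp only [addRightEmbedding_apply] at h
  rw [← h]
  refine (Finset.sum_subset (fun j h => ?_) fun j _ hj => hF j hj).symm
  rw [Finset.mem_map]
  exact ⟨j - Pi.single r 1, M.mem_stag_of_add_mem r (by simpa using h), by simp⟩

/-- Summation by parts in one direction. -/
theorem sum_stag_mul (r : Fin d) {v w : (Fin d → ℤ) → ℝ} (hv : ∀ j, j ∉ M.J → v j = 0) {c : ℝ}
    (hc : c ^ 2 = 1) :
    ∑ j ∈ M.stag r, (v (j + Pi.single r 1) + c * v j) * (w (j + Pi.single r 1) + c * w j)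
      = ∑ j ∈ M.J, v j * (2 * w j + c * (w (j + Pi.single r 1) + w (j - Pi.single r 1))) := by
  have h1 := M.sum_stag_shift r (F := fun j => v j * w j) fun j hj => by simp [hv j hj]
  have h2 := M.sum_stag r (F := fun j => v j * w j) fun j hj => by simp [hv j hj]
  have h3 := M.sum_stag_shift r (F := fun j => v j * w (j - Pi.single r 1))
    fun j hj => by simp [hv j hj]
  have h4 := M.sum_stag r (F := fun j => v j * w (j + Pi.single r 1)) fun j hj => by simp [hv j hj]
  have e1 : ∀ j, (v (j + Pi.single r 1) + c * v j) * (w (j + Pi.single r 1) + c * w j)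
      = v (j + Pi.single r 1) * w (j + Pi.single r 1) + v j * w j
        + c * (v (j + Pi.single r 1) * w (j + Pi.single r 1 - Pi.single r 1))
        + c * (v j * w (j + Pi.single r 1)) := by
    intro j
    rw [add_sub_cancel_right]
    linear_combination (v j * w j) * hc
  have e2 : ∀ j, v j * (2 * w j + c * (w (j + Pi.single r 1) + w (j - Pi.single r 1)))
      = v j * w j + v j * w j + c * (v j * w (j - Pi.single r 1))
        + c * (v j * w (j + Pi.single r 1)) := fun j => by ring
  simp_rw [e1, e2, Finset.sum_add_distrib, ← Finset.mul_sum]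
  rw [h1, h2, h3, h4]

theorem sum_mul_negδ2 (r : Fin d) (v w : M.J → ℝ) :
    ∑ j, v j * M.negδ2 r w j
      = 1 / M.Δx r ^ 2 * ∑ j ∈ M.stag r, (M.ext v (j + Pi.single r 1) - M.ext v j)
          * (M.ext w (j + Pi.single r 1) - M.ext w j) := by
  have h := M.sum_stag_mul r (v := M.ext v) (w := M.ext w) (c := -1)
    (fun j hj => M.ext_of_notMem _ hj) (by norm_num)
  simp only [neg_one_mul, ← sub_eq_add_neg] at h
  rw [h, Finset.mul_sum, ← Finset.sum_coe_sort M.J]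
  refine Finset.sum_congr rfl fun j _ => ?_
  rw [ext_of_mem]
  change v j * -M.δ2 r (M.ext w) j = _
  rw [δ2, ext_of_mem]
  ring

/-- The counterpart with plus signs: the difference `4/Δx² - (-δ_r²)` is also a sum of squares,
which bounds the spectrum of `-δ_r²` from above. -/
theorem sum_mul_four_sub_negδ2 (r : Fin d) (v w : M.J → ℝ) :
    ∑ j, v j * (4 / M.Δx r ^ 2 * w j - M.negδ2 r w j)
      = 1 / M.Δx r ^ 2 * ∑ j ∈ M.stag r, (M.ext v (j + Pi.single r 1) + M.ext v j)
          * (M.ext w (j + Pi.single r 1) + M.ext w j) := by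
  have h := M.sum_stag_mul r (v := M.ext v) (w := M.ext w) (c := 1)
    (fun j hj => M.ext_of_notMem _ hj) (by norm_num)
  simp only [one_mul] at h
  rw [h, Finset.mul_sum, ← Finset.sum_coe_sort M.J]
  refine Finset.sum_congr rfl fun j _ => ?_
  rw [ext_of_mem]
  change v j * (_ - -M.δ2 r (M.ext w) j) = _
  rw [δ2, ext_of_mem]
  ring

end Discretization
end FL21

/-! ### The difference operators as matrices, and locality. -/

namespace FL21

open Set Filter Topology MeasureTheory
open scoped MatrixOrder

theorem matrix_nonneg_of_form {ι : Type*} [Fintype ι] [DecidableEq ι] {A : Matrix ι ι ℝ}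
    (hsymm : ∀ v w, v ⬝ᵥ A.mulVec w = w ⬝ᵥ A.mulVec v) (hpos : ∀ v, 0 ≤ v ⬝ᵥ A.mulVec v) :
    0 ≤ A := by
  refine Matrix.nonneg_iff_posSemidef.2 (Matrix.PosSemidef.of_dotProduct_mulVec_nonneg ?_ ?_)
  · refine Matrix.ext fun i j => ?_
    have := hsymm (Pi.single j 1) (Pi.single i 1)
    simpa using this
  · simpa using hpos

namespace Discretization

variable {d : ℕ} {P : Problem d} (M : Discretization P)

/-- The matrix of `-δ_r²`. -/
noncomputable def TM (r : Fin d) : Matrix M.J M.J ℝ := LinearMap.toMatrix' (M.negδ2 r)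

theorem TM_mulVec (r : Fin d) (w : M.J → ℝ) : (M.TM r).mulVec w = M.negδ2 r w :=
  LinearMap.toMatrix'_mulVec _ _

theorem TM_comm (r s : Fin d) : Commute (M.TM r) (M.TM s) := by
  rw [Commute, SemiconjBy, TM, TM, ← LinearMap.toMatrix'_mul, ← LinearMap.toMatrix'_mul]
  congr 1
  exact LinearMap.ext fun w => M.negδ2_comm r s w

theorem dotProduct_TM (r : Fin d) (v w : M.J → ℝ) :
    v ⬝ᵥ (M.TM r).mulVec w = 1 / M.Δx r ^ 2 * ∑ j ∈ M.stag r,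
      (M.ext v (j + Pi.single r 1) - M.ext v j) * (M.ext w (j + Pi.single r 1) - M.ext w j) := by
  rw [TM_mulVec, ← sum_mul_negδ2]; rfl

theorem TM_nonneg (r : Fin d) : 0 ≤ M.TM r := by
  refine matrix_nonneg_of_form (fun v w => ?_) fun v => ?_
  · rw [dotProduct_TM, dotProduct_TM]
    simp_rw [mul_comm]
  · rw [dotProduct_TM]
    exact mul_nonneg (by positivity) (Finset.sum_nonneg fun j _ => mul_self_nonneg _)

/-- The matrix of the averaging operator. -/
noncomputable def AM (r : Fin d) : Matrix M.J M.J ℝ := 1 - (M.Δx r ^ 2 / 12) • M.TM r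

theorem AM_mulVec (r : Fin d) (w : M.J → ℝ) :
    (M.AM r).mulVec w = w - (M.Δx r ^ 2 / 12) • M.negδ2 r w := by
  rw [AM, Matrix.sub_mulVec, Matrix.one_mulVec, Matrix.smul_mulVec, TM_mulVec]

theorem AM_comm_TM (r s : Fin d) : Commute (M.AM r) (M.TM s) :=
  (Commute.one_left _).sub_left ((M.TM_comm r s).smul_left _)

theorem AM_comm (r s : Fin d) : Commute (M.AM r) (M.AM s) :=
  (Commute.one_right _).sub_right ((M.AM_comm_TM r s).smul_right _)

/-- As `-δ_r² ≤ 4/Δx²`, the average `1 - (Δx²/12)(-δ_r²)` is at least `1 - 1/3`. -/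
theorem AM_lower (r : Fin d) : (2 / 3 : ℝ) • (1 : Matrix M.J M.J ℝ) ≤ M.AM r := by
  have hΔ := M.Δx_pos r
  have h : 0 ≤ (4 / M.Δx r ^ 2) • (1 : Matrix M.J M.J ℝ) - M.TM r := by
    have e : ∀ v w : M.J → ℝ, v ⬝ᵥ ((4 / M.Δx r ^ 2) • (1 : Matrix M.J M.J ℝ) - M.TM r).mulVec w
        = 1 / M.Δx r ^ 2 * ∑ j ∈ M.stag r, (M.ext v (j + Pi.single r 1) + M.ext v j)
          * (M.ext w (j + Pi.single r 1) + M.ext w j) := by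
      intro v w
      rw [Matrix.sub_mulVec, Matrix.smul_mulVec, Matrix.one_mulVec, TM_mulVec,
        ← sum_mul_four_sub_negδ2]
      rfl
    refine matrix_nonneg_of_form (fun v w => ?_) fun v => ?_
    · rw [e, e]
      simp_rw [mul_comm]
    · rw [e]
      exact mul_nonneg (by positivity) (Finset.sum_nonneg fun j _ => mul_self_nonneg _)
  have h2 := matrix_smul_nonneg (c := M.Δx r ^ 2 / 12) (by positivity) h
  rw [← sub_nonneg]
  convert! h2 using 1
  rw [AM, smul_sub, smul_smul]
  have : M.Δx r ^ 2 / 12 * (4 / M.Δx r ^ 2) = 1 / 3 := by field_simp; norm_num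
  rw [this, sub_right_comm]
  congr 1
  module

/-- The matrix of `A_h`. -/
noncomputable def AA : Matrix M.J M.J ℝ := ((List.finRange d).map M.AM).prod

/-- The matrix of `∏_{l ≠ k} A_l`. -/
noncomputable def AE (k : Fin d) : Matrix M.J M.J ℝ :=
  (((List.finRange d).filter (fun l => l ≠ k)).map M.AM).prod

/-- The matrix of `-Δ_h`. -/
noncomputable def TT : Matrix M.J M.J ℝ := ∑ k, M.TM k

/-- The matrix of `-Λ_h`. -/
noncomputable def LL : Matrix M.J M.J ℝ := ∑ k, M.AE k * M.TM k

theorem AM_prod_comm_TM (L : List (Fin d)) (k : Fin d) : Commute (L.map M.AM).prod (M.TM k) :=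
  (commute_list_map_prod (fun l => (M.AM_comm_TM l k).symm) L).symm

theorem TT_nonneg : 0 ≤ M.TT := Finset.sum_nonneg fun k _ => M.TM_nonneg k

theorem AA_comm_TT : Commute M.AA M.TT :=
  Commute.sum_right _ _ _ fun k _ => M.AM_prod_comm_TM _ k

theorem AA_lower : (2 / 3 : ℝ) ^ d • (1 : Matrix M.J M.J ℝ) ≤ M.AA := by
  have := list_map_prod_lower M.AM_comm (by norm_num) M.AM_lower (List.finRange d)
  rwa [List.length_finRange] at this

theorem filter_ne_eq_erase (k : Fin d) :
    (List.finRange d).filter (fun l => l ≠ k) = (List.finRange d).erase k := by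
  rw [List.Nodup.erase_eq_filter (List.nodup_finRange d) k]
  congr 1
  funext l
  by_cases h : l = k <;> simp [h]

theorem length_filter_ne (k : Fin d) :
    ((List.finRange d).filter (fun l => l ≠ k)).length = d - 1 := by
  rw [filter_ne_eq_erase, List.length_erase_of_mem (List.mem_finRange k), List.length_finRange]

theorem AE_lower (k : Fin d) : (2 / 3 : ℝ) ^ (d - 1) • (1 : Matrix M.J M.J ℝ) ≤ M.AE k := by
  have := list_map_prod_lower M.AM_comm (by norm_num) M.AM_lower
    ((List.finRange d).filter (fun l => l ≠ k))
  rwa [length_filter_ne] at this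

theorem AA_nonneg : 0 ≤ M.AA := (matrix_smul_one_nonneg (by positivity)).trans M.AA_lower

theorem AA_mul_TT_nonneg : 0 ≤ M.AA * M.TT :=
  matrix_mul_nonneg M.AA_nonneg M.TT_nonneg M.AA_comm_TT

theorem smul_TT_le : (2 / 3 : ℝ) ^ d • M.TT ≤ M.AA * M.TT := by
  have := matrix_mul_nonneg (sub_nonneg.2 M.AA_lower) M.TT_nonneg
    (M.AA_comm_TT.sub_left ((Commute.one_left _).smul_left _))
  rw [← sub_nonneg]
  rwa [sub_mul, smul_mul_assoc, one_mul] at this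

/-- The coercivity of `-Λ_h` tested against `-Δ_h`. It is proved direction by direction: the product
of the commuting nonnegative matrices `TT`, `AE k - (2/3)^(d-1)` and `TM k` is nonnegative. -/
theorem smul_TT_mul_TT_le : (2 / 3 : ℝ) ^ (d - 1) • (M.TT * M.TT) ≤ M.TT * M.LL := by
  have hTk : ∀ k, Commute M.TT (M.TM k) := fun k =>
    Commute.sum_left _ _ _ fun l _ => M.TM_comm l k
  have h : ∀ k, 0 ≤ M.TT * ((M.AE k - (2 / 3 : ℝ) ^ (d - 1) • 1) * M.TM k) := by
    intro k
    have hc1 : ∀ l, Commute (M.AE k - (2 / 3 : ℝ) ^ (d - 1) • 1) (M.TM l) := fun l =>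
      (M.AM_prod_comm_TM _ l).sub_left ((Commute.one_left _).smul_left _)
    have h1 := matrix_mul_nonneg (sub_nonneg.2 (M.AE_lower k)) (M.TM_nonneg k) (hc1 k)
    refine matrix_mul_nonneg M.TT_nonneg h1 ?_
    exact (Commute.sum_left _ _ _ fun l _ => (hc1 l).symm).mul_right (hTk k)
  have h2 := Finset.sum_nonneg fun k (_ : k ∈ Finset.univ) => h k
  rw [← sub_nonneg]
  convert! h2 using 1
  rw [← Finset.mul_sum]
  simp_rw [sub_mul, smul_mul_assoc, one_mul]
  rw [Finset.sum_sub_distrib, ← Finset.smul_sum, mul_sub, mul_smul_comm]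
  rfl

theorem AA_transpose : M.AA.transpose = M.AA := matrix_transpose_of_nonneg M.AA_nonneg

theorem TT_transpose : M.TT.transpose = M.TT := matrix_transpose_of_nonneg M.TT_nonneg

/-! ### The difference operators in matrix form -/

theorem avg_ext (r : Fin d) (w : M.J → ℝ) : M.avg r (M.ext w) = M.ext ((M.AM r).mulVec w) := by
  funext j
  by_cases hj : j ∈ M.slab r
  · rw [avg_eq_of_mem _ hj, AM_mulVec, sub_eq_add_neg, ext_add, ← neg_smul, ext_smul]
    simp only [Pi.add_apply, Pi.smul_apply, smul_eq_mul]
    rw [ext_negδ2 _ _ _ hj]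
    ring
  · have hJ : j ∉ M.J := fun h => hj (M.mem_J.1 h r)
    rw [avg, if_neg (show ¬ j r ∈ _ from hj), ext_of_notMem _ _ hJ, ext_of_notMem _ _ hJ]

theorem foldr_avg_ext (L : List (Fin d)) (w : M.J → ℝ) :
    L.foldr (fun k v => M.avg k v) (M.ext w) = M.ext ((L.map M.AM).prod.mulVec w) := by
  induction L with
  | nil => simp
  | cons r L ih =>
    rw [List.foldr_cons, ih, avg_ext, List.map_cons, List.prod_cons, Matrix.mulVec_mulVec]

theorem Ah_ext (w : M.J → ℝ) : M.Ah (M.ext w) = M.ext (M.AA.mulVec w) := M.foldr_avg_ext _ w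

/-- A product of averages is a contraction in the maximum norm on index sets that contain the
neighbours the product refers to. -/
theorem abs_foldr_avg_sub_le {S : Set (Fin d → ℤ)} {v w : (Fin d → ℤ) → ℝ} {C : ℝ}
    (h : ∀ j ∈ S, |v j - w j| ≤ C) (L : List (Fin d))
    (hS : ∀ r ∈ L, ∀ j ∈ S, j ∈ M.slab r → j + Pi.single r 1 ∈ S ∧ j - Pi.single r 1 ∈ S) :
    ∀ j ∈ S, |L.foldr (fun l v => M.avg l v) v j - L.foldr (fun l v => M.avg l v) w j| ≤ C := by
  induction L with
  | nil => exact h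
  | cons r L ih =>
    intro j hj
    have ih' := ih fun l hl => hS l (List.mem_cons_of_mem _ hl)
    simp only [List.foldr_cons, avg]
    split_ifs with hr
    · have hn := hS r List.mem_cons_self j hj hr
      have h0 := abs_le.1 (ih' _ hj)
      have h1 := abs_le.1 (ih' _ hn.1)
      have h2 := abs_le.1 (ih' _ hn.2)
      rw [abs_le]
      constructor <;> linarith [h0.1, h0.2, h1.1, h1.2, h2.1, h2.2]
    · exact ih' j hj

theorem slab_neighbours {k r : Fin d} (hr : r ≠ k) {j : Fin d → ℤ} (hj : j ∈ M.slab k) :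
    j + Pi.single r 1 ∈ M.slab k ∧ j - Pi.single r 1 ∈ M.slab k := by
  constructor
  · change (j + Pi.single r 1 : Fin d → ℤ) k ∈ Finset.Icc 1 ((M.m k : ℤ) - 1)
    rw [add_single_apply_ne hr.symm]; exact hj
  · change (j - Pi.single r 1 : Fin d → ℤ) k ∈ Finset.Icc 1 ((M.m k : ℤ) - 1)
    rw [sub_single_apply_ne hr.symm]; exact hj

/-- Averages in directions other than `k` never change the `k`-th index, so only values on the slab
are seen. -/
theorem AhExcept_congr_slab {k : Fin d} {v w : (Fin d → ℤ) → ℝ}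
    (h : ∀ j ∈ M.slab k, v j = w j) : ∀ j ∈ M.slab k, M.AhExcept k v j = M.AhExcept k w j := by
  intro j hj
  refine sub_eq_zero.1 (abs_nonpos_iff.1 (M.abs_foldr_avg_sub_le
    (fun i hi => by rw [h i hi, sub_self, abs_zero]) _ (fun r hr i hi _ => ?_) j hj))
  exact M.slab_neighbours (by simpa using hr) hi

/-- The second difference of the zero extension need not vanish at points on a face normal to `k`,
so it is not itself a zero extension. It agrees with one on the slab, which is all that the
remaining averages see. -/
theorem AhExcept_δ2_ext (k : Fin d) (w : M.J → ℝ) (j : M.J) :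
    M.AhExcept k (M.δ2 k (M.ext w)) j = -(M.AE k * M.TM k).mulVec w j := by
  have hj : j.1 ∈ M.slab k := M.mem_J.1 j.2 k
  rw [M.AhExcept_congr_slab (w := M.ext (-M.negδ2 k w)) _ j.1 hj, AhExcept, foldr_avg_ext, ext_of_mem, Matrix.mulVec_neg, ← TM_mulVec, Matrix.mulVec_mulVec]
  · rfl
  · intro i hi
    rw [← neg_one_smul ℝ, ext_smul, Pi.smul_apply, ext_negδ2 _ _ _ hi]
    simp

theorem Λh_ext (w : M.J → ℝ) (j : M.J) : M.Λh (M.ext w) j = -M.LL.mulVec w j := by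
  rw [Λh, LL, Matrix.sum_mulVec, Finset.sum_apply, ← Finset.sum_neg_distrib]
  exact Finset.sum_congr rfl fun k _ => M.AhExcept_δ2_ext k w j

theorem Δh_ext (w : M.J → ℝ) (j : M.J) : M.Δh (M.ext w) j = -M.TT.mulVec w j := by
  rw [Δh, TT, Matrix.sum_mulVec, Finset.sum_apply, ← Finset.sum_neg_distrib]
  refine Finset.sum_congr rfl fun k _ => ?_
  rw [TM_mulVec]
  exact (neg_neg _).symm

theorem norm1A_ext (w : M.J → ℝ) :
    M.norm1A (M.ext w) = √((∏ r, M.Δx r) * (w ⬝ᵥ (M.AA * M.TT).mulVec w)) := by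
  rw [norm1A, ip, Ah_ext, ← Matrix.mulVec_mulVec, Matrix.dotProduct_mulVec, ← Matrix.mulVec_transpose, AA_transpose,
    ← Finset.sum_coe_sort M.J]
  congr 2
  refine Finset.sum_congr rfl fun j _ => ?_
  rw [ext_of_mem, Δh_ext, neg_neg]

theorem norm1_ext (w : M.J → ℝ) :
    M.norm1 (M.ext w) = √((∏ r, M.Δx r) * (w ⬝ᵥ M.TT.mulVec w)) := by
  rw [norm1, TT, Matrix.sum_mulVec, dotProduct_sum, Finset.mul_sum]
  congr 1
  refine Finset.sum_congr rfl fun k _ => ?_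
  rw [dotProduct_TM, sq1, Finset.mul_sum (M.stag k)]
  congr 1
  refine Finset.sum_congr rfl fun j _ => ?_
  rw [δ]
  ring

/-! ### Locality -/

theorem mem_Jbar {j : Fin d → ℤ} : j ∈ M.Jbar ↔ ∀ k, j k ∈ Finset.Icc 0 (M.m k : ℤ) := by
  simp [Jbar]

theorem J_subset_Jbar : M.J ⊆ M.Jbar := by
  intro j hj
  rw [mem_J] at hj
  rw [mem_Jbar]
  intro k
  have := Finset.mem_Icc.1 (hj k)
  exact Finset.mem_Icc.2 ⟨by omega, by omega⟩

theorem add_single_mem_Jbar {j : Fin d → ℤ} (hj : j ∈ M.Jbar) {k : Fin d} {c : ℤ}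
    (hk : j k + c ∈ Finset.Icc 0 (M.m k : ℤ)) : j + Pi.single k c ∈ M.Jbar := by
  rw [mem_Jbar] at hj ⊢
  intro l
  by_cases hl : l = k
  · subst hl; simpa using hk
  · rw [add_single_apply_ne hl]; exact hj l

theorem sub_single_eq (j : Fin d → ℤ) (k : Fin d) :
    j - Pi.single k 1 = j + Pi.single k (-1) := by
  rw [sub_eq_add_neg, Pi.single_neg]

theorem neighbours_mem_Jbar {j : Fin d → ℤ} (hj : j ∈ M.Jbar) {k : Fin d} (hk : j ∈ M.slab k) :
    j + Pi.single k 1 ∈ M.Jbar ∧ j - Pi.single k 1 ∈ M.Jbar := by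
  have := Finset.mem_Icc.1 (show j k ∈ Finset.Icc 1 ((M.m k : ℤ) - 1) from hk)
  rw [sub_single_eq]
  exact ⟨M.add_single_mem_Jbar hj (Finset.mem_Icc.2 ⟨by omega, by omega⟩),
    M.add_single_mem_Jbar hj (Finset.mem_Icc.2 ⟨by omega, by omega⟩)⟩

/-- Locality is the contraction estimate with constant 0. -/
theorem Ah_congr {v w : (Fin d → ℤ) → ℝ} (h : ∀ j ∈ M.Jbar, v j = w j) :
    ∀ j ∈ M.Jbar, M.Ah v j = M.Ah w j := by
  intro j hj
  exact sub_eq_zero.1 (abs_nonpos_iff.1 (M.abs_foldr_avg_sub_le (S := M.Jbar)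
    (fun i hi => by rw [h i hi, sub_self, abs_zero]) _
    (fun r _ i hi hir => M.neighbours_mem_Jbar hi hir) j hj))

theorem δ2_congr {v w : (Fin d → ℤ) → ℝ} (h : ∀ j ∈ M.Jbar, v j = w j) {r : Fin d}
    {j : Fin d → ℤ} (hj : j ∈ M.Jbar) (hr : j ∈ M.slab r) : M.δ2 r v j = M.δ2 r w j := by
  have := M.neighbours_mem_Jbar hj hr
  rw [δ2, δ2, h _ hj, h _ this.1, h _ this.2]

theorem Jbar_slab_neighbours {k r : Fin d} (hr : r ≠ k) {j : Fin d → ℤ}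
    (hj : j ∈ (M.Jbar : Set (Fin d → ℤ)) ∩ M.slab k) (hjr : j ∈ M.slab r) :
    j + Pi.single r 1 ∈ (M.Jbar : Set (Fin d → ℤ)) ∩ M.slab k ∧
      j - Pi.single r 1 ∈ (M.Jbar : Set (Fin d → ℤ)) ∩ M.slab k := by
  have h1 := M.neighbours_mem_Jbar hj.1 hjr
  have h2 := M.slab_neighbours hr hj.2
  exact ⟨⟨h1.1, h2.1⟩, ⟨h1.2, h2.2⟩⟩

theorem abs_AhExcept_sub_le {k : Fin d} {v w : (Fin d → ℤ) → ℝ} {C : ℝ}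
    (h : ∀ j ∈ (M.Jbar : Set (Fin d → ℤ)) ∩ M.slab k, |v j - w j| ≤ C) :
    ∀ j ∈ (M.Jbar : Set (Fin d → ℤ)) ∩ M.slab k, |M.AhExcept k v j - M.AhExcept k w j| ≤ C :=
  M.abs_foldr_avg_sub_le h _ fun _ hr _ hi hir =>
    M.Jbar_slab_neighbours (by simpa using hr) hi hir

theorem Λh_congr {v w : (Fin d → ℤ) → ℝ} (h : ∀ j ∈ M.Jbar, v j = w j) :
    ∀ j ∈ M.J, M.Λh v j = M.Λh w j := by
  intro j hj
  refine Finset.sum_congr rfl fun k _ => sub_eq_zero.1 (abs_nonpos_iff.1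
    (M.abs_AhExcept_sub_le (fun i hi => ?_) j ⟨M.J_subset_Jbar hj, M.mem_J.1 hj k⟩))
  rw [M.δ2_congr h hi.1 hi.2, sub_self, abs_zero]

theorem norm1A_congr {v w : (Fin d → ℤ) → ℝ} (h : ∀ j ∈ M.Jbar, v j = w j) :
    M.norm1A v = M.norm1A w := by
  rw [norm1A, norm1A, ip, ip]
  congr 2
  refine Finset.sum_congr rfl fun j hj => ?_
  have hj' := M.J_subset_Jbar hj
  rw [M.Ah_congr h j hj', Δh, Δh]
  congr 2
  exact Finset.sum_congr rfl fun k _ => M.δ2_congr h hj' (M.mem_J.1 hj k)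

theorem norm1_congr {v w : (Fin d → ℤ) → ℝ} (h : ∀ j ∈ M.Jbar, v j = w j) :
    M.norm1 v = M.norm1 w := by
  rw [norm1, norm1]
  congr 1
  refine Finset.sum_congr rfl fun k _ => ?_
  rw [sq1, sq1]
  congr 1
  refine Finset.sum_congr rfl fun j hj => ?_
  rw [Fintype.mem_piFinset] at hj
  have hj' : j ∈ M.Jbar := by
    rw [mem_Jbar]
    intro l
    have := Finset.mem_Icc.1 (hj l)
    split_ifs at this <;> exact Finset.mem_Icc.2 ⟨by omega, by omega⟩
  have hk := Finset.mem_Icc.1 (hj k)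
  rw [if_pos rfl] at hk
  rw [δ, δ, h _ hj', h _ (M.add_single_mem_Jbar hj' (Finset.mem_Icc.2 ⟨by omega, by omega⟩))]

end Discretization
end FL21

/-! ### The discrete energy estimate. -/

namespace FL21

open Set Filter Topology MeasureTheory
open scoped MatrixOrder
namespace Discretization

variable {d : ℕ} {P : Problem d} (M : Discretization P)

theorem prod_Δx_pos : 0 < ∏ r, M.Δx r := Finset.prod_pos fun r _ => M.Δx_pos r

theorem prod_Δx_mul_card_le :
    (∏ r, M.Δx r) * Fintype.card M.J ≤ ∏ r, (P.b r - P.a r) := by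
  rw [Fintype.card_coe, J, Fintype.card_piFinset, Nat.cast_prod, ← Finset.prod_mul_distrib]
  refine Finset.prod_le_prod (fun r _ => mul_nonneg (M.Δx_pos r).le (Nat.cast_nonneg _))
    fun r _ => ?_
  have hm : (0 : ℝ) < M.m r := by exact_mod_cast M.m_pos r
  have h1 : ((Finset.Icc 1 ((M.m r : ℤ) - 1)).card : ℝ) ≤ M.m r := by
    rw [Int.card_Icc]; exact_mod_cast (by omega : ((M.m r : ℤ) - 1 + 1 - 1).toNat ≤ M.m r)
  calc _ ≤ M.Δx r * M.m r := mul_le_mul_of_nonneg_left h1 (M.Δx_pos r).le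
    _ = _ := by rw [Δx]; field_simp

/-- Young's inequality pointwise, `2 S y ≤ 2 c y² + S²/(2c)`: the coercive term absorbs the test
function, and only the maximum of `S` remains. -/
theorem two_mul_dotProduct_sub_le {ι : Type*} [Fintype ι] {S y : ι → ℝ} {R c L : ℝ} (hc : 0 < c)
    (hS : ∀ j, |S j| ≤ R) (hL : c * (y ⬝ᵥ y) ≤ L) :
    2 * (S ⬝ᵥ y - L) ≤ Fintype.card ι * R ^ 2 / (2 * c) := by
  have h1 : ∀ j ∈ (Finset.univ : Finset ι), 2 * (S j * y j) - 2 * (c * (y j * y j))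
      ≤ R ^ 2 / (2 * c) := by
    intro j _
    rw [le_div_iff₀ (by positivity)]
    have h : S j ^ 2 ≤ R ^ 2 := sq_le_sq' (abs_le.1 (hS j)).1 (abs_le.1 (hS j)).2
    nlinarith [sq_nonneg (S j - 2 * c * y j)]
  have h2 := Finset.sum_le_sum h1
  simp only [Finset.sum_sub_distrib, ← Finset.mul_sum, Finset.sum_const, Finset.card_univ,
    nsmul_eq_mul] at h2
  rw [mul_div_assoc]
  have h3 : 2 * (S ⬝ᵥ y) - 2 * (c * (y ⬝ᵥ y)) ≤ Fintype.card ι * (R ^ 2 / (2 * c)) := h2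
  linarith

theorem le_LL_mulVec_dotProduct (w : M.J → ℝ) :
    (2 / 3) ^ (d - 1) * (M.TT.mulVec w ⬝ᵥ M.TT.mulVec w)
      ≤ M.LL.mulVec w ⬝ᵥ M.TT.mulVec w := by
  have h := matrix_dotProduct_nonneg (sub_nonneg.2 M.smul_TT_mul_TT_le) w
  rw [Matrix.sub_mulVec, dotProduct_sub, Matrix.smul_mulVec, dotProduct_smul,
    ← Matrix.mulVec_mulVec, ← Matrix.mulVec_mulVec, Matrix.dotProduct_mulVec w,
    Matrix.dotProduct_mulVec w, ← Matrix.mulVec_transpose, TT_transpose, smul_eq_mul] at h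
  rw [dotProduct_comm (M.LL.mulVec w)]
  linarith

/-- By `energy_inequality` the left side is at most `2 B(D, w)`, where `D` is the fast formula and
`w` the weighted time average. Moving `AA` onto `D` and writing `AA D = S - LL w`, with `S` the
residual, gives `S ⬝ y - LL w ⬝ y` with `y = TT w`. -/
theorem energy_step {Nlo Nhi : ℤ} {e : ℕ → M.J → ℝ} {R : ℝ} {k : ℕ} (hk : k < M.n)
    (hR : ∀ j : M.J, |M.Ah (fun i => M.FH Nlo Nhi (fun l => M.ext (e l) i) k) j
      - M.Λh (fun i => M.σ k * M.ext (e (k + 1)) i + (1 - M.σ k) * M.ext (e k) i) j| ≤ R) :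
    ∑ l ∈ Finset.range (k + 1), M.weight Nlo Nhi k l *
      (e (l + 1) ⬝ᵥ (M.AA * M.TT).mulVec (e (l + 1)) - e l ⬝ᵥ (M.AA * M.TT).mulVec (e l))
      ≤ Fintype.card M.J * R ^ 2 / (2 * (2 / 3) ^ (d - 1)) := by
  set Q := M.AA * M.TT with hQ
  have hQ0 : 0 ≤ Q := M.AA_mul_TT_nonneg
  set B : (M.J → ℝ) →ₗ[ℝ] (M.J → ℝ) →ₗ[ℝ] ℝ := Matrix.toLinearMap₂' ℝ Q with hB
  have hBa : ∀ x y, B x y = x ⬝ᵥ Q.mulVec y := fun x y => Matrix.toLinearMap₂'_apply' _ _ _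
  have hBsymm : ∀ x y, B x y = B y x := by
    intro x y
    rw [hBa, hBa, Matrix.dotProduct_mulVec, ← Matrix.mulVec_transpose,
      matrix_transpose_of_nonneg hQ0, dotProduct_comm]
  have hBpos : ∀ x, 0 ≤ B x x := fun x => by
    rw [hBa]; exact matrix_dotProduct_nonneg hQ0 x
  simp only [← hBa]
  refine (energy_inequality B hBsymm hBpos k (M.σ_gt hk).le (M.σ_lt hk).le
    (M.weight_nonneg_zero hk) (M.weight_mono hk) (fun l hl => M.weight_last hk hl) e).trans ?_
  set D := ∑ l ∈ Finset.range (k + 1), M.weight Nlo Nhi k l • (e (l + 1) - e l) with hD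
  set w := M.σ k • e (k + 1) + (1 - M.σ k) • e k with hw
  have h1 : (fun i => M.FH Nlo Nhi (fun l => M.ext (e l) i) k) = M.ext D := by
    funext i
    rw [FH_eq_sum]
    by_cases hi : i ∈ M.J
    · simp [ext, hi, hD, Finset.sum_apply]
    · simp [ext, hi]
  have h2 : (fun i => M.σ k * M.ext (e (k + 1)) i + (1 - M.σ k) * M.ext (e k) i)
      = M.ext w := by
    rw [hw, ext_add, ext_smul, ext_smul]; rfl
  have hRk := hR
  rw [h1, h2] at hRk
  set S := M.AA.mulVec D + M.LL.mulVec w with hS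
  have hSR : ∀ j, |S j| ≤ R := by
    intro j
    have := hRk j
    rwa [Ah_ext, ext_of_mem, Λh_ext, sub_neg_eq_add] at this
  set y := M.TT.mulVec w with hy
  have h3 : B D w = S ⬝ᵥ y - M.LL.mulVec w ⬝ᵥ y := by
    rw [hBa, hQ, ← Matrix.mulVec_mulVec, Matrix.dotProduct_mulVec, ← Matrix.mulVec_transpose,
      AA_transpose, hS, add_dotProduct, add_sub_cancel_right]
  rw [h3]
  exact two_mul_dotProduct_sub_le (by positivity) hSR (M.le_LL_mulVec_dotProduct w)

/-- Discrete energy estimate: a grid function with zero boundary and initial values whose residual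
is bounded by `R` is bounded in the energy norm. -/
theorem energy_estimate {Nlo Nhi : ℤ} (hN : M.ESAAccurate Nlo Nhi) {e : ℕ → M.J → ℝ}
    (he0 : e 0 = 0) {R : ℝ}
    (hR : ∀ k < M.n, ∀ j : M.J, |M.Ah (fun i => M.FH Nlo Nhi (fun l => M.ext (e l) i) k) j
      - M.Λh (fun i => M.σ k * M.ext (e (k + 1)) i + (1 - M.σ k) * M.ext (e k) i) j| ≤ R) :
    ∀ k ≤ M.n, (∏ r, M.Δx r) * (e k ⬝ᵥ (M.AA * M.TT).mulVec (e k))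
      ≤ (3 / 2) ^ (d - 1) * (1 / (1 - M.ε)) * P.c₁ * (∏ r, (P.b r - P.a r)) * R ^ 2 := by
  set c : ℝ := (2 / 3) ^ (d - 1) with hc
  have hc0 : 0 < c := by positivity
  set F : ℝ := Fintype.card M.J * R ^ 2 / (2 * c) with hF
  have hF0 : 0 ≤ F := by positivity
  have hε : 0 < 1 - M.ε := by linarith [M.ε_lt]
  have hγ : 0 < (1 - M.ε) / P.c₁ := div_pos hε M.c₁_pos
  have hmax := discrete_max_principle hγ hF0 (fun k hk => M.weight_zero_lower hN hk)
    (V := fun k => e k ⬝ᵥ (M.AA * M.TT).mulVec (e k))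
    (fun k hk => M.weight_mono hk) fun k hk => M.energy_step hk (hR k hk)
  intro k hk
  have h := hmax k hk
  simp only [he0, zero_dotProduct, zero_add] at h
  have hcinv : 1 / c = (3 / 2) ^ (d - 1) := by
    rw [hc, ← one_div_pow]; norm_num
  have hc1 := M.c₁_pos
  have hA : 0 ≤ (3 / 2 : ℝ) ^ (d - 1) * (1 / (1 - M.ε)) * P.c₁ := by positivity
  calc _ ≤ (∏ r, M.Δx r) * (F / ((1 - M.ε) / P.c₁)) :=
        mul_le_mul_of_nonneg_left h M.prod_Δx_pos.le
    _ = (1 / c) * (1 / (1 - M.ε)) * P.c₁ * ((∏ r, M.Δx r) * Fintype.card M.J) * R ^ 2 / 2 := by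
        rw [hF]; field_simp
    _ ≤ (1 / c) * (1 / (1 - M.ε)) * P.c₁ * (∏ r, (P.b r - P.a r)) * R ^ 2 / 2 := by
        rw [hcinv]
        gcongr
        exact M.prod_Δx_mul_card_le
    -- A factor 1/2 is given away to reach the stated constant.
    _ ≤ _ := by
        rw [hcinv]
        have : 0 ≤ ∏ r, (P.b r - P.a r) :=
          Finset.prod_nonneg fun r _ => (sub_pos.2 (P.a_lt_b r)).le
        have : 0 ≤ (3 / 2) ^ (d - 1) * (1 / (1 - M.ε)) * P.c₁ * (∏ r, (P.b r - P.a r)) * R ^ 2 := by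
          positivity
        linarith

theorem norm1A_le {Nlo Nhi : ℤ} (hN : M.ESAAccurate Nlo Nhi) {e : ℕ → M.J → ℝ}
    (he0 : e 0 = 0) {R : ℝ} (hR0 : 0 ≤ R)
    (hR : ∀ k < M.n, ∀ j : M.J, |M.Ah (fun i => M.FH Nlo Nhi (fun l => M.ext (e l) i) k) j
      - M.Λh (fun i => M.σ k * M.ext (e (k + 1)) i + (1 - M.σ k) * M.ext (e k) i) j| ≤ R)
    {k : ℕ} (hk : k ≤ M.n) : M.norm1A (M.ext (e k))
      ≤ √((3 / 2) ^ (d - 1) * (1 / (1 - M.ε)) * P.c₁ * ∏ r, (P.b r - P.a r)) * R := by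
  rw [norm1A_ext]
  refine (Real.sqrt_le_sqrt (M.energy_estimate hN he0 hR k hk)).trans (le_of_eq ?_)
  rw [Real.sqrt_mul' _ (sq_nonneg R), Real.sqrt_sq hR0]

/-- Since `AA ≥ (2/3)^d`, passing to the plain norm costs `(3/2)^d` in the square; together with
`(3/2)^(d-1)` this is the exponent `2d - 1`, where `d ≥ 1` keeps the subtraction honest. -/
theorem norm1_le (hd : 1 ≤ d) {Nlo Nhi : ℤ} (hN : M.ESAAccurate Nlo Nhi) {e : ℕ → M.J → ℝ}
    (he0 : e 0 = 0) {R : ℝ} (hR0 : 0 ≤ R)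
    (hR : ∀ k < M.n, ∀ j : M.J, |M.Ah (fun i => M.FH Nlo Nhi (fun l => M.ext (e l) i) k) j
      - M.Λh (fun i => M.σ k * M.ext (e (k + 1)) i + (1 - M.σ k) * M.ext (e k) i) j| ≤ R)
    {k : ℕ} (hk : k ≤ M.n) : M.norm1 (M.ext (e k))
      ≤ √((3 / 2) ^ (2 * d - 1) * (1 / (1 - M.ε)) * P.c₁ * ∏ r, (P.b r - P.a r)) * R := by
  rw [norm1_ext]
  have h1 := M.energy_estimate hN he0 hR k hk
  have h2 := matrix_dotProduct_nonneg (sub_nonneg.2 M.smul_TT_le) (e k)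
  rw [Matrix.sub_mulVec, dotProduct_sub, Matrix.smul_mulVec, dotProduct_smul, smul_eq_mul,
    sub_nonneg] at h2
  have h3 : e k ⬝ᵥ M.TT.mulVec (e k)
      ≤ (3 / 2) ^ d * (e k ⬝ᵥ (M.AA * M.TT).mulVec (e k)) := by
    have : (3 / 2 : ℝ) ^ d * (2 / 3) ^ d = 1 := by rw [← mul_pow]; norm_num
    calc e k ⬝ᵥ M.TT.mulVec (e k)
        = (3 / 2 : ℝ) ^ d * ((2 / 3) ^ d * (e k ⬝ᵥ M.TT.mulVec (e k))) := by
          rw [← mul_assoc, this, one_mul]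
      _ ≤ _ := by gcongr
  have h4 : (∏ r, M.Δx r) * (e k ⬝ᵥ M.TT.mulVec (e k))
      ≤ (3 / 2) ^ (2 * d - 1) * (1 / (1 - M.ε)) * P.c₁ * (∏ r, (P.b r - P.a r)) * R ^ 2 := by
    calc _ ≤ (∏ r, M.Δx r) * ((3 / 2) ^ d * (e k ⬝ᵥ (M.AA * M.TT).mulVec (e k))) :=
          mul_le_mul_of_nonneg_left h3 M.prod_Δx_pos.le
      _ = (3 / 2) ^ d * ((∏ r, M.Δx r) * (e k ⬝ᵥ (M.AA * M.TT).mulVec (e k))) := by ring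
      _ ≤ (3 / 2) ^ d * _ := mul_le_mul_of_nonneg_left h1 (by positivity)
      _ = _ := by
        rw [show 2 * d - 1 = d + (d - 1) by omega, pow_add]; ring
  refine (Real.sqrt_le_sqrt h4).trans (le_of_eq ?_)
  rw [Real.sqrt_mul' _ (sq_nonneg R), Real.sqrt_sq hR0]

end Discretization
end FL21

/-! ### Taylor estimates for difference and interpolation formulas. -/

namespace FL21

open Set Filter Topology MeasureTheory

/-- Taylor's formula with a crude remainder estimate, for one-sided derivatives on an interval. -/
theorem taylor_remainder_le {s : Set ℝ} (hs : s.OrdConnected) {K : ℝ} (n : ℕ) :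
    ∀ {f : ℕ → ℝ → ℝ}, (∀ i < n, ∀ y ∈ s, HasDerivWithinAt (f i) (f (i + 1) y) s y) →
    (∀ y ∈ s, |f n y| ≤ K) → ∀ x ∈ s, ∀ y ∈ s,
    |f 0 y - ∑ i ∈ Finset.range n, f i x * (y - x) ^ i / i.factorial| ≤ K * |y - x| ^ n := by
  induction n with
  | zero => intro f _ hK x _ y hy; simpa using hK y hy
  | succ n ih =>
    intro f hf hK x hx y hy
    have hK0 : 0 ≤ K := (abs_nonneg _).trans (hK x hx)
    have hsub : uIcc x y ⊆ s := hs.uIcc_subset hx hy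
    have ih' := ih (f := fun i => f (i + 1)) (fun i hi => hf (i + 1) (by omega)) hK x hx
    set R : ℝ → ℝ := fun z =>
      f 0 z - ∑ i ∈ Finset.range (n + 1), f i x * (z - x) ^ i / i.factorial with hR
    -- The derivative of the remainder is the remainder, one order lower, of the shifted family `f
    -- (i + 1)`; the mean value inequality then adds one power of the distance.
    have hRd : ∀ z ∈ uIcc x y, HasDerivWithinAt R
        (f 1 z - ∑ i ∈ Finset.range n, f (i + 1) x * (z - x) ^ i / i.factorial) (uIcc x y) z := by
      intro z hz
      refine ((hf 0 (by omega) z (hsub hz)).mono hsub).sub ?_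
      have h1 : ∀ i ∈ Finset.range (n + 1), HasDerivWithinAt
          (fun z => f i x * (z - x) ^ i / i.factorial)
          (f i x * (i * (z - x) ^ (i - 1)) / i.factorial) (uIcc x y) z := by
        intro i _
        have := ((((hasDerivAt_id z).sub_const x).pow i).const_mul (f i x)).div_const
          (i.factorial : ℝ)
        simpa using this.hasDerivWithinAt
      refine (HasDerivWithinAt.fun_sum h1).congr_deriv ?_
      rw [Finset.sum_range_succ']
      simp only [Nat.cast_zero, zero_mul, mul_zero, zero_div, add_zero]
      refine Finset.sum_congr rfl fun i _ => ?_
      rw [Nat.factorial_succ, Nat.add_sub_cancel]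
      have : (i.factorial : ℝ) ≠ 0 := by exact_mod_cast i.factorial_ne_zero
      have : ((i : ℝ) + 1) ≠ 0 := by positivity
      push_cast
      field_simp
    have hb : ∀ z ∈ uIcc x y,
        ‖f 1 z - ∑ i ∈ Finset.range n, f (i + 1) x * (z - x) ^ i / i.factorial‖
          ≤ K * |y - x| ^ n := by
      intro z hz
      refine (ih' z (hsub hz)).trans (mul_le_mul_of_nonneg_left ?_ hK0)
      exact pow_le_pow_left₀ (abs_nonneg _) (abs_sub_left_of_mem_uIcc hz) n
    have h := (convex_uIcc x y).norm_image_sub_le_of_norm_hasDerivWithin_le hRd hb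
      left_mem_uIcc right_mem_uIcc
    have hRx : R x = 0 := by
      rw [hR]
      simp only [sub_self, Finset.sum_range_succ']
      simp
    rw [hRx, sub_zero, Real.norm_eq_abs, Real.norm_eq_abs] at h
    calc _ ≤ K * |y - x| ^ n * |y - x| := h
      _ = _ := by ring

/-- The compact difference formula of order four. -/
theorem compact_difference {s : Set ℝ} (hs : s.OrdConnected) {K : ℝ} {f : ℕ → ℝ → ℝ}
    (hf : ∀ i < 6, ∀ y ∈ s, HasDerivWithinAt (f i) (f (i + 1) y) s y)
    (hK : ∀ y ∈ s, |f 6 y| ≤ K) {x h : ℝ} (hh : 0 < h) (hx : x ∈ s) (hp : x + h ∈ s)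
    (hm : x - h ∈ s) :
    |1 / 12 * (f 2 (x - h) + 10 * f 2 x + f 2 (x + h))
      - 1 / h ^ 2 * (f 0 (x + h) - 2 * f 0 x + f 0 (x - h))| ≤ 3 * K * h ^ 4 := by
  have hK0 : 0 ≤ K := (abs_nonneg _).trans (hK x hx)
  have h1 := taylor_remainder_le hs 6 hf hK x hx _ hp
  have h2 := taylor_remainder_le hs 6 hf hK x hx _ hm
  have h3 := taylor_remainder_le hs 4 (f := fun i => f (i + 2)) (fun i hi => hf (i + 2) (by omega))
    hK x hx _ hp
  have h4 := taylor_remainder_le hs 4 (f := fun i => f (i + 2)) (fun i hi => hf (i + 2) (by omega))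
    hK x hx _ hm
  simp only [Finset.sum_range_succ, Finset.sum_range_zero, Nat.factorial, add_sub_cancel_left,
    sub_sub_cancel_left, abs_neg, abs_of_pos hh, zero_add] at h1 h2 h3 h4
  norm_num at h1 h2 h3 h4
  rw [abs_le] at h1 h2 h3 h4
  -- All Taylor terms up to order five cancel. Two sixth-order remainders and two fourth-order ones
  -- with weight 1/12 leave `2 + 1/6 ≤ 3`.
  have key : |h ^ 2 * (1 / 12 * (f 2 (x - h) + 10 * f 2 x + f 2 (x + h)))
      - (f 0 (x + h) - 2 * f 0 x + f 0 (x - h))| ≤ 3 * K * h ^ 6 := by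
    have hh2 : 0 < h ^ 2 := by positivity
    have a1 := mul_le_mul_of_nonneg_left h3.1 hh2.le
    have a2 := mul_le_mul_of_nonneg_left h3.2 hh2.le
    have a3 := mul_le_mul_of_nonneg_left h4.1 hh2.le
    have a4 := mul_le_mul_of_nonneg_left h4.2 hh2.le
    have e6 : 0 ≤ K * h ^ 6 := by positivity
    rw [abs_le]
    constructor
    · nlinarith [h1.1, h1.2, h2.1, h2.2]
    · nlinarith [h1.1, h1.2, h2.1, h2.2]
  have e : 1 / 12 * (f 2 (x - h) + 10 * f 2 x + f 2 (x + h))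
      - 1 / h ^ 2 * (f 0 (x + h) - 2 * f 0 x + f 0 (x - h))
      = (h ^ 2 * (1 / 12 * (f 2 (x - h) + 10 * f 2 x + f 2 (x + h)))
        - (f 0 (x + h) - 2 * f 0 x + f 0 (x - h))) / h ^ 2 := by
    field_simp
  rw [e, abs_div, abs_of_pos (by positivity : 0 < h ^ 2), div_le_iff₀ (by positivity)]
  calc _ ≤ _ := key
    _ = _ := by ring

theorem second_difference_le {s : Set ℝ} (hs : s.OrdConnected) {K : ℝ} {f : ℕ → ℝ → ℝ}
    (hf : ∀ i < 2, ∀ y ∈ s, HasDerivWithinAt (f i) (f (i + 1) y) s y)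
    (hK : ∀ y ∈ s, |f 2 y| ≤ K) {x h : ℝ} (hh : 0 < h) (hx : x ∈ s) (hp : x + h ∈ s)
    (hm : x - h ∈ s) :
    |1 / h ^ 2 * (f 0 (x + h) - 2 * f 0 x + f 0 (x - h))| ≤ 2 * K := by
  have h1 := taylor_remainder_le hs 2 hf hK x hx _ hp
  have h2 := taylor_remainder_le hs 2 hf hK x hx _ hm
  simp only [Finset.sum_range_succ, Finset.sum_range_zero, Nat.factorial, add_sub_cancel_left,
    sub_sub_cancel_left, abs_neg, abs_of_pos hh, zero_add] at h1 h2
  norm_num at h1 h2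
  rw [abs_le] at h1 h2
  rw [abs_mul, abs_of_pos (by positivity : 0 < 1 / h ^ 2), one_div, inv_mul_le_iff₀ (by positivity),
    abs_le]
  constructor <;> linarith [h1.1, h1.2, h2.1, h2.2]

/-- Interpolation at an intermediate point is of second order. -/
theorem linear_interpolation_le {s : Set ℝ} (hs : s.OrdConnected) {K : ℝ} {f : ℕ → ℝ → ℝ}
    (hf : ∀ i < 2, ∀ y ∈ s, HasDerivWithinAt (f i) (f (i + 1) y) s y)
    (hK : ∀ y ∈ s, |f 2 y| ≤ K) {x σ h : ℝ} (hh : 0 < h) (hσ : σ ∈ Icc (0 : ℝ) 1)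
    (hx : x ∈ s) (hxh : x + h ∈ s) :
    |f 0 (x + σ * h) - σ * f 0 (x + h) - (1 - σ) * f 0 x| ≤ K * h ^ 2 := by
  have hm : x + σ * h ∈ s := hs.out hx hxh ⟨by nlinarith [hσ.1], by nlinarith [hσ.2]⟩
  have hK0 : 0 ≤ K := (abs_nonneg _).trans (hK x hx)
  have h1 := taylor_remainder_le hs 2 hf hK _ hm _ hxh
  have h2 := taylor_remainder_le hs 2 hf hK _ hm _ hx
  simp only [Finset.sum_range_succ, Finset.sum_range_zero, Nat.factorial, zero_add, pow_zero,
    mul_one, pow_one, sq_abs, Nat.cast_one, div_one] at h1 h2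
  have e1 : x + h - (x + σ * h) = (1 - σ) * h := by ring
  have e2 : x - (x + σ * h) = -(σ * h) := by ring
  rw [e1] at h1
  rw [e2] at h2
  have hσ0 := hσ.1
  have hσ1 : 0 ≤ 1 - σ := by linarith [hσ.2]
  have h3 : K * ((1 - σ) * h) ^ 2 ≤ K * h ^ 2 :=
    mul_le_mul_of_nonneg_left (by rw [mul_pow]; nlinarith [sq_nonneg h]) hK0
  have h4 : K * (-(σ * h)) ^ 2 ≤ K * h ^ 2 :=
    mul_le_mul_of_nonneg_left (by rw [neg_sq, mul_pow]; nlinarith [sq_nonneg h, hσ.2]) hK0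
  have h5 := mul_le_mul_of_nonneg_left (h1.trans h3) hσ0
  have h6 := mul_le_mul_of_nonneg_left (h2.trans h4) hσ1
  rw [← abs_of_nonneg hσ0, ← abs_mul, abs_of_nonneg hσ0] at h5
  rw [← abs_of_nonneg hσ1, ← abs_mul, abs_of_nonneg hσ1] at h6
  have a5 := abs_le.1 h5
  have a6 := abs_le.1 h6
  rw [abs_le]
  constructor <;> nlinarith [a5.1, a5.2, a6.1, a6.2]

/-- The derivative of the quadratic interpolant. -/
theorem quadratic_interpolation_deriv_le {s : Set ℝ} (hs : s.OrdConnected) {K : ℝ} {f : ℕ → ℝ → ℝ}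
    (hf : ∀ i < 3, ∀ y ∈ s, HasDerivWithinAt (f i) (f (i + 1) y) s y)
    (hK : ∀ y ∈ s, |f 3 y| ≤ K) {x σ h : ℝ} (hh : 0 < h) (hσ : σ ∈ Icc (0 : ℝ) 1)
    (hx : x ∈ s) (hx2 : x + 2 * h ∈ s) :
    |(3 / 2 - σ) * (f 0 (x + h) - f 0 x) + (σ - 1 / 2) * (f 0 (x + 2 * h) - f 0 (x + h))
      - h * f 1 (x + σ * h)| ≤ 8 * K * h ^ 3 := by
  have hσ0 := hσ.1
  have hσ1 : 0 ≤ 1 - σ := by linarith [hσ.2]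
  have hxh : x + h ∈ s := hs.out hx hx2 ⟨by linarith, by linarith⟩
  have hm : x + σ * h ∈ s := hs.out hx hxh ⟨by nlinarith, by nlinarith⟩
  have hK0 : 0 ≤ K := (abs_nonneg _).trans (hK x hx)
  have h1 := taylor_remainder_le hs 3 hf hK _ hm _ hx
  have h2 := taylor_remainder_le hs 3 hf hK _ hm _ hxh
  have h3 := taylor_remainder_le hs 3 hf hK _ hm _ hx2
  have e1 : x - (x + σ * h) = -(σ * h) := by ring
  have e2 : x + h - (x + σ * h) = (1 - σ) * h := by ring
  have e3 : x + 2 * h - (x + σ * h) = (2 - σ) * h := by ring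
  rw [e1] at h1
  rw [e2] at h2
  rw [e3] at h3
  rw [abs_neg, abs_of_nonneg (mul_nonneg hσ0 hh.le)] at h1
  rw [abs_of_nonneg (mul_nonneg hσ1 hh.le)] at h2
  rw [abs_of_nonneg (mul_nonneg (by linarith : 0 ≤ 2 - σ) hh.le)] at h3
  have b1 : K * (σ * h) ^ 3 ≤ K * h ^ 3 :=
    mul_le_mul_of_nonneg_left (pow_le_pow_left₀ (by positivity) (by nlinarith [hσ.2]) 3) hK0
  have b2 : K * ((1 - σ) * h) ^ 3 ≤ K * h ^ 3 :=
    mul_le_mul_of_nonneg_left (pow_le_pow_left₀ (by positivity) (by nlinarith) 3) hK0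
  have b3 : K * ((2 - σ) * h) ^ 3 ≤ 8 * (K * h ^ 3) := by
    calc _ ≤ K * (2 * h) ^ 3 := mul_le_mul_of_nonneg_left
          (pow_le_pow_left₀ (mul_nonneg (by linarith) hh.le) (by nlinarith) 3) hK0
      _ = _ := by ring
  simp only [Finset.sum_range_succ, Finset.sum_range_zero, Nat.factorial, zero_add, pow_zero,
    mul_one, pow_one, Nat.cast_one, div_one] at h1 h2 h3
  have a1 := h1.trans b1
  have a2 := h2.trans b2
  have a3 := h3.trans b3
  -- With all values expanded at `x + σ h`, the terms in `f 0` and `f 2` cancel and `f 1`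
  -- contributes exactly `h`. The remainders sum to `(3/2)(1 + 1) + (1/2)(8 + 1) ≤ 8` times `K h³`.
  have e : (3 / 2 - σ) * (f 0 (x + h) - f 0 x) + (σ - 1 / 2) * (f 0 (x + 2 * h) - f 0 (x + h))
      - h * f 1 (x + σ * h) = (3 / 2 - σ) * (
        (f 0 (x + h) - (f 0 (x + σ * h) + f 1 (x + σ * h) * ((1 - σ) * h)
          + f 2 (x + σ * h) * ((1 - σ) * h) ^ 2 / ↑(Nat.succ 1 * Nat.succ 0)))
        - (f 0 x - (f 0 (x + σ * h) + f 1 (x + σ * h) * -(σ * h)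
          + f 2 (x + σ * h) * (-(σ * h)) ^ 2 / ↑(Nat.succ 1 * Nat.succ 0))))
      + (σ - 1 / 2) * (
        (f 0 (x + 2 * h) - (f 0 (x + σ * h) + f 1 (x + σ * h) * ((2 - σ) * h)
          + f 2 (x + σ * h) * ((2 - σ) * h) ^ 2 / ↑(Nat.succ 1 * Nat.succ 0)))
        - (f 0 (x + h) - (f 0 (x + σ * h) + f 1 (x + σ * h) * ((1 - σ) * h)
          + f 2 (x + σ * h) * ((1 - σ) * h) ^ 2 / ↑(Nat.succ 1 * Nat.succ 0)))) := by
    push_cast; ring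
  have c1 := (abs_sub _ _).trans (add_le_add a2 a1)
  have c2 := (abs_sub _ _).trans (add_le_add a3 a2)
  have d1 : |3 / 2 - σ| ≤ 3 / 2 := abs_le.2 ⟨by linarith, by linarith⟩
  have d2 : |σ - 1 / 2| ≤ 1 / 2 := abs_le.2 ⟨by linarith, by linarith⟩
  have hB : 0 ≤ K * h ^ 3 := by positivity
  rw [e]
  refine (abs_add_le _ _).trans ?_
  rw [abs_mul, abs_mul]
  have f1 := mul_le_mul d1 c1 (abs_nonneg _) (by norm_num)
  have f2 := mul_le_mul d2 c2 (abs_nonneg _) (by norm_num)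
  linarith

end FL21

/-! ### Consistency of the fast formula in time. -/

namespace FL21

open Set Filter Topology MeasureTheory
namespace Discretization

variable {d : ℕ} {P : Problem d} (M : Discretization P)

/-- The kernel of the Caputo derivative at the shifted time. -/
noncomputable def kap (k : ℕ) (y : ℝ) : ℝ :=
  (M.tσ k - y) ^ (-M.ασ k) / Real.Gamma (1 - M.ασ k)

theorem kap_nonneg {k : ℕ} (hk : k < M.n) {y : ℝ} (hy : y ≤ M.tσ k) : 0 ≤ M.kap k y :=
  div_nonneg (Real.rpow_nonneg (by linarith) _) (M.Gamma_one_sub_pos hk).le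

theorem intervalIntegrable_kap {k : ℕ} (hk : k < M.n) (a b : ℝ) :
    IntervalIntegrable (M.kap k) volume a b := by
  have h : IntervalIntegrable (fun z : ℝ => z ^ (-M.ασ k)) volume (M.tσ k - a) (M.tσ k - b) :=
    intervalIntegral.intervalIntegrable_rpow' (by linarith [M.ασ_lt_one hk])
  have h2 := (h.comp_sub_left (M.tσ k)).div_const (Real.Gamma (1 - M.ασ k))
  change IntervalIntegrable (fun y => (M.tσ k - y) ^ (-M.ασ k) / Real.Gamma (1 - M.ασ k)) _ _ _
  simpa using h2

theorem continuousOn_kap (k : ℕ) : ContinuousOn (M.kap k) (Iio (M.tσ k)) := by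
  refine ContinuousOn.div_const (ContinuousOn.rpow_const (by fun_prop) fun y hy => Or.inl ?_) _
  have : y < M.tσ k := hy
  linarith

theorem integral_kap {k : ℕ} (hk : k < M.n) (a : ℝ) :
    ∫ y in a..M.tσ k, M.kap k y = (M.tσ k - a) ^ (1 - M.ασ k) / Real.Gamma (2 - M.ασ k) := by
  have hα := M.ασ_lt_one hk
  have h := intervalIntegral.integral_comp_sub_left (fun z : ℝ => z ^ (-M.ασ k)) (a := a)
    (b := M.tσ k) (M.tσ k)
  rw [sub_self, integral_rpow (Or.inl (by linarith)), Real.zero_rpow (by linarith)] at h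
  simp only [kap]
  rw [intervalIntegral.integral_div, h, show (2 : ℝ) - M.ασ k = (1 - M.ασ k) + 1 by ring,
    Real.Gamma_add_one (by linarith), show -M.ασ k + 1 = 1 - M.ασ k by ring, sub_zero, div_div]

/-- The shift is chosen so that the linear error term over the last interval vanishes. -/
theorem integral_kap_mul_sub_mid {k : ℕ} (hk : k < M.n) :
    ∫ y in M.t k..M.tσ k, M.kap k y * (y - (M.t k + M.Δt / 2)) = 0 := by
  have hα := M.ασ_lt_one hk
  have hα0 := M.ασ_pos hk
  have hσ := M.σ_pos hk
  have hΔ := M.Δt_pos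
  have hδ : 0 < M.σ k * M.Δt := mul_pos hσ hΔ
  have eσ := M.σ_eq hk
  have h := intervalIntegral.integral_comp_sub_left (fun z : ℝ => z ^ (-M.ασ k)
    * ((M.σ k - 1 / 2) * M.Δt - z)) (a := M.t k) (b := M.tσ k) (M.tσ k)
  have e1 : M.tσ k - M.t k = M.σ k * M.Δt := by rw [tσ]; ring
  rw [sub_self, e1] at h
  have e2 : ∀ y, M.kap k y * (y - (M.t k + M.Δt / 2)) = ((M.tσ k - y) ^ (-M.ασ k)
      * ((M.σ k - 1 / 2) * M.Δt - (M.tσ k - y))) / Real.Gamma (1 - M.ασ k) := by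
    intro y
    have : y - (M.t k + M.Δt / 2) = (M.σ k - 1 / 2) * M.Δt - (M.tσ k - y) := by rw [tσ]; ring
    rw [this, kap]; ring
  simp_rw [e2]
  rw [intervalIntegral.integral_div, h]
  have e3 : ∫ z in (0 : ℝ)..M.σ k * M.Δt, z ^ (-M.ασ k) * ((M.σ k - 1 / 2) * M.Δt - z)
      = ∫ z in (0 : ℝ)..M.σ k * M.Δt, ((M.σ k - 1 / 2) * M.Δt * z ^ (-M.ασ k)
        - z ^ (1 - M.ασ k)) := by
    refine intervalIntegral.integral_congr fun z hz => ?_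
    rw [uIcc_of_le hδ.le] at hz
    have : z ^ (1 - M.ασ k) = z * z ^ (-M.ασ k) := by
      rw [sub_eq_add_neg, Real.rpow_add' hz.1 (by linarith), Real.rpow_one]
    simp only [this]; ring
  rw [e3, intervalIntegral.integral_sub
    ((intervalIntegral.intervalIntegrable_rpow' (by linarith)).const_mul _)
    (intervalIntegral.intervalIntegrable_rpow' (by linarith)),
    intervalIntegral.integral_const_mul, integral_rpow (Or.inl (by linarith)),
    integral_rpow (Or.inl (by linarith)), Real.zero_rpow (by linarith),
    Real.zero_rpow (by linarith), sub_zero, sub_zero,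
    show 1 - M.ασ k + 1 = (-M.ασ k + 1) + 1 by ring, Real.rpow_add hδ (-M.ασ k + 1) 1,
    Real.rpow_one]
  have e5 : -M.ασ k + 1 ≠ 0 := by linarith
  have e6 : -M.ασ k + 1 + 1 ≠ 0 := by linarith
  rw [div_eq_zero_iff]
  left
  rw [eσ]
  field_simp
  ring

theorem t_add_mul_mem {k l : ℕ} (hl : l < k) {s : ℝ} (hs : s ∈ Icc (0 : ℝ) 1) :
    M.t l + s * M.Δt ∈ Icc 0 (M.t k) := by
  have h1 := M.t_mono (Nat.succ_le_of_lt hl)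
  rw [Nat.succ_eq_add_one, t_succ] at h1
  have := M.Δt_pos
  exact ⟨by nlinarith [M.t_nonneg l, hs.1], by nlinarith [hs.2]⟩

/-- The error is stated relative to the integral of the exact kernel, so that summing over all
history intervals loses nothing as the number of steps grows. -/
theorem history_error {Nlo Nhi : ℤ} (hN : M.ESAAccurate Nlo Nhi) {k l : ℕ} (hk : k < M.n)
    (hl : l < k) {v : ℕ → ℝ → ℝ} {K : ℝ}
    (hv : ∀ i < 3, ∀ y ∈ Icc 0 P.T, HasDerivWithinAt (v i) (v (i + 1) y) (Icc 0 P.T) y)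
    (hK : ∀ i ≤ 3, ∀ y ∈ Icc 0 P.T, |v i y| ≤ K) :
    |(∫ s in (0 : ℝ)..1, M.ker Nlo Nhi k (M.t l + s * M.Δt)
        * ((3 / 2 - s) * (v 0 (M.t (l + 1)) - v 0 (M.t l))
          + (s - 1 / 2) * (v 0 (M.t (l + 2)) - v 0 (M.t (l + 1)))))
      - ∫ y in M.t l..M.t (l + 1), M.kap k y * v 1 y|
      ≤ (2 * K * M.ε + 8 * K * M.Δt ^ 2) * ∫ y in M.t l..M.t (l + 1), M.kap k y := by
  have hΔ := M.Δt_pos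
  have hε := M.ε_pos
  have hK0 : 0 ≤ K := (abs_nonneg _).trans (hK 0 (by omega) 0 ⟨le_rfl, T_pos.le⟩)
  have hsub : ∀ g : ℝ → ℝ, ∫ y in M.t l..M.t (l + 1), g y
      = ∫ s in (0 : ℝ)..1, M.Δt * g (M.t l + s * M.Δt) := by
    intro g
    have := intervalIntegral.mul_integral_comp_add_mul (a := 0) (b := 1) (f := g) M.Δt (M.t l)
    rw [mul_zero, add_zero, mul_one, ← t_succ, ← intervalIntegral.integral_const_mul] at this
    rw [← this]
    simp_rw [mul_comm M.Δt]
  have hmaps : MapsTo (fun s => M.t l + s * M.Δt) (uIcc (0 : ℝ) 1) (Icc 0 (M.t k)) := by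
    intro s hs
    rw [uIcc_of_le zero_le_one] at hs
    exact M.t_add_mul_mem hl hs
  have hcs : ContinuousOn (fun s => M.t l + s * M.Δt) (uIcc (0 : ℝ) 1) := by fun_prop
  have htk : Icc 0 (M.t k) ⊆ Icc 0 P.T := Icc_subset_Icc_right (M.t_le_T hk.le)
  have hkap : ContinuousOn (fun s => M.kap k (M.t l + s * M.Δt)) (uIcc (0 : ℝ) 1) :=
    ((M.continuousOn_kap k).mono fun y hy => hy.2.trans_lt (M.t_lt_tσ hk)).comp hcs hmaps
  have hv1 : ContinuousOn (fun s => v 1 (M.t l + s * M.Δt)) (uIcc (0 : ℝ) 1) := by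
    have h : ContinuousOn (v 1) (Icc 0 P.T) := fun y hy =>
      (hv 1 (by omega) y hy).continuousWithinAt
    exact (h.mono htk).comp hcs hmaps
  have hker := M.continuous_ker_comp Nlo Nhi k l
  have hint : IntervalIntegrable
      (fun s => M.Δt * (M.kap k (M.t l + s * M.Δt) * v 1 (M.t l + s * M.Δt))) volume 0 1 :=
    (hkap.mul hv1).intervalIntegrable.const_mul _
  rw [hsub, hsub, ← intervalIntegral.integral_sub
    (Continuous.intervalIntegrable (by fun_prop) _ _) hint, ← intervalIntegral.integral_const_mul,
    ← Real.norm_eq_abs]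
  refine intervalIntegral.norm_integral_le_of_norm_le zero_le_one
    (Eventually.of_forall fun s hs => ?_) ((hkap.intervalIntegrable.const_mul _).const_mul _)
  have hs' : s ∈ Icc (0 : ℝ) 1 := ⟨hs.1.le, hs.2⟩
  have hy := M.t_add_mul_mem hl hs'
  have hlT : M.t l ∈ Icc 0 P.T := M.t_mem (by omega)
  have hl1T : M.t (l + 1) ∈ Icc 0 P.T := M.t_mem (by omega)
  have hl2T : M.t (l + 2) ∈ Icc 0 P.T := M.t_mem (by omega)
  have el1 : M.t (l + 1) = M.t l + M.Δt := M.t_succ l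
  have el2 : M.t (l + 2) = M.t l + 2 * M.Δt := by rw [t_succ, t_succ]; ring
  have hq := quadratic_interpolation_deriv_le ordConnected_Icc hv (hK 3 le_rfl) hΔ hs' hlT
    (el2 ▸ hl2T)
  rw [← el1, ← el2] at hq
  have hD : ∀ x ∈ Icc 0 P.T, ∀ y ∈ Icc 0 P.T, y - x = M.Δt → |v 0 y - v 0 x| ≤ K * M.Δt := by
    intro x hx y hy e
    have := taylor_remainder_le ordConnected_Icc 1 (f := v) (fun i hi => hv i (by omega))
      (hK 1 (by omega)) x hx y hy
    simpa [e, abs_of_pos hΔ] using this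
  have hD1 := hD _ hlT _ hl1T (by rw [el1]; ring)
  have hD2 := hD _ hl1T _ hl2T (by rw [el1, el2]; ring)
  have hker' := M.abs_ker_sub_le hN (by omega) hk hy
  have hκ := M.kap_nonneg hk (hy.2.trans (M.t_lt_tσ hk).le)
  change |_ - M.kap k (M.t l + s * M.Δt)| ≤ M.kap k (M.t l + s * M.Δt) * M.ε at hker'
  set y := M.t l + s * M.Δt
  have d1 : |3 / 2 - s| ≤ 3 / 2 := abs_le.2 ⟨by linarith [hs'.2], by linarith [hs'.1]⟩
  have d2 : |s - 1 / 2| ≤ 1 / 2 := abs_le.2 ⟨by linarith [hs'.1], by linarith [hs'.2]⟩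
  set q := (3 / 2 - s) * (v 0 (M.t (l + 1)) - v 0 (M.t l))
          + (s - 1 / 2) * (v 0 (M.t (l + 2)) - v 0 (M.t (l + 1))) with hqdef
  have hqb : |q| ≤ 2 * K * M.Δt := by
    refine (abs_add_le _ _).trans ?_
    rw [abs_mul, abs_mul]
    have f1 := mul_le_mul d1 hD1 (abs_nonneg _) (by norm_num)
    have f2 := mul_le_mul d2 hD2 (abs_nonneg _) (by norm_num)
    linarith
  -- The first term is the kernel error, of relative size `ε` against `|q| ≤ 2 K Δt`; the second is
  -- the interpolation error of the derivative.
  have e : M.ker Nlo Nhi k y * q - M.Δt * (M.kap k y * v 1 y)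
      = (M.ker Nlo Nhi k y - M.kap k y) * q + M.kap k y * (q - M.Δt * v 1 y) := by ring
  rw [e, Real.norm_eq_abs]
  refine (abs_add_le _ _).trans ?_
  rw [abs_mul, abs_mul, abs_of_nonneg hκ]
  have g1 := mul_le_mul hker' hqb (abs_nonneg _) (mul_nonneg hκ hε.le)
  have g2 := mul_le_mul_of_nonneg_left hq hκ
  calc _ ≤ M.kap k y * M.ε * (2 * K * M.Δt) + M.kap k y * (8 * K * M.Δt ^ 3) := add_le_add g1 g2
    _ = _ := by ring

/-- On the last piece a linear interpolant is used, whose derivative is only first-order accurate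
pointwise. Second order is recovered because the first-order term integrates to zero against the
kernel, by the choice of `σ`. -/
theorem last_error {k : ℕ} (hk : k < M.n) {v : ℕ → ℝ → ℝ} {K : ℝ}
    (hv : ∀ i < 3, ∀ y ∈ Icc 0 P.T, HasDerivWithinAt (v i) (v (i + 1) y) (Icc 0 P.T) y)
    (hK : ∀ i ≤ 3, ∀ y ∈ Icc 0 P.T, |v i y| ≤ K) :
    |M.lastWeight k * (v 0 (M.t (k + 1)) - v 0 (M.t k))
      - ∫ y in M.t k..M.tσ k, M.kap k y * v 1 y|
      ≤ 2 * K * M.Δt ^ 2 * ∫ y in M.t k..M.tσ k, M.kap k y := by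
  have hΔ := M.Δt_pos
  have hK0 : 0 ≤ K := (abs_nonneg _).trans (hK 0 (by omega) 0 ⟨le_rfl, T_pos.le⟩)
  set mid := M.t k + M.Δt / 2 with hmid
  have hkT : M.t k ∈ Icc 0 P.T := M.t_mem hk.le
  have hk1T : M.t (k + 1) ∈ Icc 0 P.T := M.t_mem hk
  have ek1 : M.t (k + 1) = M.t k + M.Δt := M.t_succ k
  have hmT : mid ∈ Icc 0 P.T := ⟨by linarith [hkT.1], by linarith [hk1T.2]⟩
  have hlw : M.lastWeight k = (∫ y in M.t k..M.tσ k, M.kap k y) / M.Δt := by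
    rw [M.integral_kap hk, lastWeight, s, tσ, add_sub_cancel_left,
      Real.mul_rpow (M.σ_pos hk).le hΔ.le, sub_eq_add_neg 1 (M.ασ k), Real.rpow_add hΔ,
      Real.rpow_one]
    field_simp
  have h1 := taylor_remainder_le ordConnected_Icc 3 hv (hK 3 le_rfl) mid hmT _ hk1T
  have h2 := taylor_remainder_le ordConnected_Icc 3 hv (hK 3 le_rfl) mid hmT _ hkT
  have e1 : M.t (k + 1) - mid = M.Δt / 2 := by rw [ek1, hmid]; ring
  have e2 : M.t k - mid = -(M.Δt / 2) := by rw [hmid]; ring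
  rw [e1, abs_of_pos (half_pos hΔ)] at h1
  rw [e2, abs_neg, abs_of_pos (half_pos hΔ)] at h2
  simp only [Finset.sum_range_succ, Finset.sum_range_zero, Nat.factorial, zero_add, pow_zero,
    mul_one, pow_one, Nat.cast_one, div_one] at h1 h2
  have hdiff : |(v 0 (M.t (k + 1)) - v 0 (M.t k)) / M.Δt - v 1 mid| ≤ K * M.Δt ^ 2 := by
    have a := abs_le.1 h1
    have b := abs_le.1 h2
    have hB : 0 ≤ K * M.Δt ^ 3 := by positivity
    have e : (v 0 (M.t (k + 1)) - v 0 (M.t k)) / M.Δt - v 1 mid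
        = (v 0 (M.t (k + 1)) - v 0 (M.t k) - v 1 mid * M.Δt) / M.Δt := by field_simp
    rw [e, abs_div, abs_of_pos hΔ, div_le_iff₀ hΔ, abs_le]
    constructor <;> nlinarith [a.1, a.2, b.1, b.2]
  have hv1c : ContinuousOn (v 1) (Icc (M.t k) (M.tσ k)) := fun y hy =>
    ((hv 1 (by omega) y ⟨hkT.1.trans hy.1, hy.2.trans (M.tσ_lt_T hk).le⟩).continuousWithinAt).mono
      (Icc_subset_Icc hkT.1 (M.tσ_lt_T hk).le)
  have hint : ∀ g : ℝ → ℝ, ContinuousOn g (Icc (M.t k) (M.tσ k)) →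
      IntervalIntegrable (fun y => M.kap k y * g y) volume (M.t k) (M.tσ k) := by
    intro g hg
    refine (M.intervalIntegrable_kap hk _ _).mul_continuousOn ?_
    rwa [uIcc_of_le (M.t_lt_tσ hk).le]
  set Δv := (v 0 (M.t (k + 1)) - v 0 (M.t k)) / M.Δt with hΔv
  -- The inserted term `v 2 mid * (y - mid)` contributes nothing by `integral_kap_mul_sub_mid`, and
  -- it makes the integrand a Taylor remainder of `v 1` at the midpoint.
  have e3 : M.lastWeight k * (v 0 (M.t (k + 1)) - v 0 (M.t k))
      - ∫ y in M.t k..M.tσ k, M.kap k y * v 1 y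
      = ∫ y in M.t k..M.tσ k, M.kap k y * (Δv + v 2 mid * (y - mid) - v 1 y) := by
    have e4 : ∀ y, M.kap k y * (Δv + v 2 mid * (y - mid) - v 1 y)
        = M.kap k y * Δv + v 2 mid * (M.kap k y * (y - mid)) - M.kap k y * v 1 y :=
      fun y => by ring
    simp_rw [e4]
    rw [intervalIntegral.integral_sub (((M.intervalIntegrable_kap hk _ _).mul_const _).add
      ((hint _ (by fun_prop)).const_mul _)) (hint _ hv1c),
      intervalIntegral.integral_add ((M.intervalIntegrable_kap hk _ _).mul_const _)
      ((hint _ (by fun_prop)).const_mul _), intervalIntegral.integral_const_mul,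
      M.integral_kap_mul_sub_mid hk, intervalIntegral.integral_mul_const, hlw, hΔv]
    ring
  rw [e3, ← intervalIntegral.integral_const_mul, ← Real.norm_eq_abs]
  refine intervalIntegral.norm_integral_le_of_norm_le (M.t_lt_tσ hk).le
    (Eventually.of_forall fun y hy => ?_) ((M.intervalIntegrable_kap hk _ _).const_mul _)
  have hyT : y ∈ Icc 0 P.T := ⟨hkT.1.trans hy.1.le, hy.2.trans (M.tσ_lt_T hk).le⟩
  have h3 := taylor_remainder_le ordConnected_Icc 2 (f := fun i => v (i + 1))
    (fun i hi => hv (i + 1) (by omega)) (hK 3 le_rfl) mid hmT y hyT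
  simp only [Finset.sum_range_succ, Finset.sum_range_zero, Nat.factorial, zero_add, pow_zero,
    mul_one, pow_one, Nat.cast_one, div_one] at h3
  have h4 : |y - mid| ≤ M.Δt := by
    have := M.tσ_lt hk
    rw [ek1] at this
    rw [abs_le]
    constructor <;> linarith [hy.1, hy.2]
  have h5 : K * |y - mid| ^ 2 ≤ K * M.Δt ^ 2 :=
    mul_le_mul_of_nonneg_left (pow_le_pow_left₀ (abs_nonneg _) h4 2) hK0
  have hκ := M.kap_nonneg hk hy.2
  rw [Real.norm_eq_abs, abs_mul, abs_of_nonneg hκ, mul_comm]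
  refine mul_le_mul_of_nonneg_right ?_ hκ
  have a := abs_le.1 hdiff
  have b := abs_le.1 (h3.trans h5)
  rw [abs_le]
  constructor <;> linarith [a.1, a.2, b.1, b.2]

/-- The error of the fast formula for the Caputo derivative. -/
theorem FH_error {Nlo Nhi : ℤ} (hN : M.ESAAccurate Nlo Nhi) {k : ℕ} (hk : k < M.n)
    {v : ℕ → ℝ → ℝ} {K : ℝ}
    (hv : ∀ i < 3, ∀ y ∈ Icc 0 P.T, HasDerivWithinAt (v i) (v (i + 1) y) (Icc 0 P.T) y)
    (hK : ∀ i ≤ 3, ∀ y ∈ Icc 0 P.T, |v i y| ≤ K) :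
    |M.FH Nlo Nhi (fun l => v 0 (M.t l)) k - ∫ y in (0 : ℝ)..M.tσ k, M.kap k y * v 1 y|
      ≤ 10 * K * (M.Δt ^ 2 + M.ε) * ∫ y in (0 : ℝ)..M.tσ k, M.kap k y := by
  have hε := M.ε_pos
  have hK0 : 0 ≤ K := (abs_nonneg _).trans (hK 0 (by omega) 0 ⟨le_rfl, T_pos.le⟩)
  have hv1 : ContinuousOn (v 1) (Icc 0 P.T) := fun y hy =>
    (hv 1 (by omega) y hy).continuousWithinAt
  have t0 : M.t 0 = 0 := by simp [t]
  have hi2 : ∀ a b, a ∈ Icc 0 P.T → b ∈ Icc 0 P.T →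
      IntervalIntegrable (fun y => M.kap k y * v 1 y) volume a b := fun a b ha hb =>
    (M.intervalIntegrable_kap hk _ _).mul_continuousOn (hv1.mono (uIcc_subset_Icc ha hb))
  have hsplit : ∀ g : ℝ → ℝ, (∀ a b, a ∈ Icc 0 P.T → b ∈ Icc 0 P.T →
      IntervalIntegrable g volume a b) → ∫ y in (0 : ℝ)..M.tσ k, g y
      = (∑ l ∈ Finset.range k, ∫ y in M.t l..M.t (l + 1), g y) + ∫ y in M.t k..M.tσ k, g y := by
    intro g hg
    rw [intervalIntegral.sum_integral_adjacent_intervals fun l hl =>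
      hg _ _ (M.t_mem (by omega)) (M.t_mem (by omega)), t0]
    exact (intervalIntegral.integral_add_adjacent_intervals
      (hg _ _ ⟨le_rfl, T_pos.le⟩ (M.t_mem hk.le)) (hg _ _ (M.t_mem hk.le) (M.tσ_mem hk))).symm
  rw [hsplit _ hi2, hsplit _ fun a b _ _ => M.intervalIntegrable_kap hk a b, FH_eq_integral,
    add_sub_add_comm, ← Finset.sum_sub_distrib]
  refine (abs_add_le _ _).trans ?_
  rw [mul_add]
  refine add_le_add ?_ ((M.last_error hk hv hK).trans ?_)
  · refine (Finset.abs_sum_le_sum_abs _ _).trans ?_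
    rw [Finset.mul_sum]
    refine Finset.sum_le_sum fun l hl => ?_
    have hl' : l < k := Finset.mem_range.1 hl
    refine (M.history_error hN hk hl' hv hK).trans (mul_le_mul_of_nonneg_right ?_ ?_)
    · nlinarith [mul_nonneg hK0 hε.le, mul_nonneg hK0 (sq_nonneg M.Δt)]
    · refine intervalIntegral.integral_nonneg (M.t_mono (Nat.le_succ l)) fun y hy =>
        M.kap_nonneg hk (hy.2.trans ((M.t_mono hl').trans (M.t_lt_tσ hk).le))
  · refine mul_le_mul_of_nonneg_right ?_ (intervalIntegral.integral_nonneg (M.t_lt_tσ hk).le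
      fun y hy => M.kap_nonneg hk hy.2)
    nlinarith [mul_nonneg hK0 hε.le, mul_nonneg hK0 (sq_nonneg M.Δt)]

/-- The integral is `t^(1-α)/Γ(2-α)`: the numerator is at most `T` because `T ≥ 1`, and `Γ` has a
positive minimum on `[1, 2]`. This uniform bound makes the truncation constant independent of the
mesh. -/
theorem exists_integral_kap_le (P : Problem d) : ∃ W : ℝ, 0 ≤ W ∧ ∀ (M : Discretization P) (k : ℕ),
    k < M.n → ∫ y in (0 : ℝ)..M.tσ k, M.kap k y ≤ W := by
  have hcont : ContinuousOn Real.Gamma (Icc 1 2) := fun x hx =>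
    (Real.differentiableAt_Gamma fun m => by
      have : (0 : ℝ) ≤ m := m.cast_nonneg
      linarith [hx.1]).continuousAt.continuousWithinAt
  obtain ⟨x₀, hx₀, hmin⟩ := isCompact_Icc.exists_isMinOn ⟨1, by norm_num⟩ hcont
  have hγ : 0 < Real.Gamma x₀ := Real.Gamma_pos_of_pos (by linarith [hx₀.1])
  refine ⟨P.T / Real.Gamma x₀, div_nonneg T_pos.le hγ.le, fun M k hk => ?_⟩
  have hα := M.ασ_pos hk
  have hα1 := M.ασ_lt_one hk
  rw [M.integral_kap hk, sub_zero]
  have h1 : M.tσ k ^ (1 - M.ασ k) ≤ P.T := by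
    calc _ ≤ P.T ^ (1 - M.ασ k) :=
          Real.rpow_le_rpow (M.tσ_pos hk).le (M.tσ_lt_T hk).le (by linarith)
      _ ≤ P.T ^ (1 : ℝ) := Real.rpow_le_rpow_of_exponent_le P.one_le_T (by linarith)
      _ = P.T := Real.rpow_one _
  have h2 : Real.Gamma x₀ ≤ Real.Gamma (2 - M.ασ k) := hmin ⟨by linarith, by linarith⟩
  exact div_le_div₀ T_pos.le h1 hγ h2

end Discretization
end FL21

/-! ### The equation on the closed box, and algebra of the averages. -/

namespace FL21

open Set Filter Topology MeasureTheory

variable {d : ℕ} {P : Problem d}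

/-- `D β p` are the derivatives `∂ₓ^β ∂ₜ^p u` up to the order `(6, 3)`. -/
structure IsDerivFamily (P : Problem d) (u : (Fin d → ℝ) → ℝ → ℝ)
    (D : (Fin d → ℕ) → ℕ → (Fin d → ℝ) → ℝ → ℝ) : Prop where
  zero : ∀ x ∈ Icc P.a P.b, ∀ t ∈ Icc 0 P.T, D 0 0 x t = u x t
  cont : ∀ β p, ∑ k, β k ≤ 6 → p ≤ 3 →
    ContinuousOn (fun z : (Fin d → ℝ) × ℝ => D β p z.1 z.2) (Icc P.a P.b ×ˢ Icc 0 P.T)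
  space : ∀ β p, ∑ k, β k < 6 → p ≤ 3 → ∀ k, ∀ x ∈ Icc P.a P.b, ∀ t ∈ Icc 0 P.T,
    HasDerivWithinAt (fun s => D β p (Function.update x k s) t)
      (D (β + Pi.single k 1) p x t) (Icc (P.a k) (P.b k)) (x k)
  time : ∀ β p, ∑ k, β k ≤ 6 → p < 3 → ∀ x ∈ Icc P.a P.b, ∀ t ∈ Icc 0 P.T,
    HasDerivWithinAt (fun s => D β p x s) (D β (p + 1) x t) (Icc 0 P.T) t

namespace IsDerivFamily

variable {u : (Fin d → ℝ) → ℝ → ℝ} {D : (Fin d → ℕ) → ℕ → (Fin d → ℝ) → ℝ → ℝ}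

theorem update_mem {x : Fin d → ℝ} (hx : x ∈ Icc P.a P.b) {k : Fin d} {y : ℝ}
    (hy : y ∈ Icc (P.a k) (P.b k)) : Function.update x k y ∈ Icc P.a P.b :=
  ⟨le_update_iff.2 ⟨hy.1, fun j _ => hx.1 j⟩, update_le_iff.2 ⟨hy.2, fun j _ => hx.2 j⟩⟩

theorem hasDeriv_line (h : IsDerivFamily P u D) {k : Fin d} {i p : ℕ} (hi : i < 6) (hp : p ≤ 3)
    {x : Fin d → ℝ} (hx : x ∈ Icc P.a P.b) {t : ℝ} (ht : t ∈ Icc 0 P.T) {y : ℝ}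
    (hy : y ∈ Icc (P.a k) (P.b k)) :
    HasDerivWithinAt (fun s => D (Pi.single k i) p (Function.update x k s) t)
      (D (Pi.single k (i + 1)) p (Function.update x k y) t) (Icc (P.a k) (P.b k)) y := by
  have := h.space (Pi.single k i) p (by simpa using hi) hp k _ (update_mem hx hy) t ht
  simpa [← Pi.single_add] using this

theorem hasDeriv_time (h : IsDerivFamily P u D) {k : Fin d} {i p : ℕ} (hi : i ≤ 6) (hp : p < 3)
    {x : Fin d → ℝ} (hx : x ∈ Icc P.a P.b) {t : ℝ} (ht : t ∈ Icc 0 P.T) :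
    HasDerivWithinAt (fun s => D (Pi.single k i) p x s) (D (Pi.single k i) (p + 1) x t)
      (Icc 0 P.T) t :=
  h.time (Pi.single k i) p (by simpa using hi) hp x hx t ht

/-- Only derivatives in one space direction at a time, mixed with time, enter the truncation error.
-/
theorem exists_bound (h : IsDerivFamily P u D) : ∃ K : ℝ, 0 ≤ K ∧ ∀ (k : Fin d), ∀ i ≤ 6, ∀ p ≤ 3,
    ∀ x ∈ Icc P.a P.b, ∀ t ∈ Icc 0 P.T, |D (Pi.single k i) p x t| ≤ K := by
  have hcomp : IsCompact (Icc P.a P.b ×ˢ Icc 0 P.T) := isCompact_Icc.prod isCompact_Icc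
  have h1 : ∀ (k : Fin d) (i p : ℕ), ∃ C : ℝ, i ≤ 6 → p ≤ 3 →
      ∀ x ∈ Icc P.a P.b, ∀ t ∈ Icc 0 P.T, |D (Pi.single k i) p x t| ≤ C := by
    intro k i p
    by_cases hip : i ≤ 6 ∧ p ≤ 3
    · obtain ⟨C, hC⟩ := hcomp.exists_bound_of_continuousOn
        (h.cont (Pi.single k i) p (by simpa using hip.1) hip.2)
      exact ⟨C, fun _ _ x hx t ht => hC (x, t) ⟨hx, ht⟩⟩
    · exact ⟨0, fun hi hp => absurd ⟨hi, hp⟩ hip⟩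
  choose C hC using h1
  refine ⟨∑ k, ∑ i ∈ Finset.range 7, ∑ p ∈ Finset.range 4, |C k i p|, by positivity,
    fun k i hi p hp x hx t ht => ?_⟩
  refine (hC k i p hi hp x hx t ht).trans ((le_abs_self _).trans ?_)
  have a1 := Finset.single_le_sum (f := fun p => |C k i p|) (fun p _ => abs_nonneg _)
    (Finset.mem_range.2 (by omega : p < 4))
  have a2 := Finset.single_le_sum (f := fun i => ∑ p ∈ Finset.range 4, |C k i p|)
    (fun p _ => by positivity) (Finset.mem_range.2 (by omega : i < 7))
  have a3 := Finset.single_le_sum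
    (f := fun k => ∑ i ∈ Finset.range 7, ∑ p ∈ Finset.range 4, |C k i p|)
    (fun p _ => by positivity) (Finset.mem_univ k)
  exact a1.trans (a2.trans a3)

theorem deriv_time_eq (h : IsDerivFamily P u D) {x : Fin d → ℝ} (hx : x ∈ Icc P.a P.b) {t : ℝ}
    (ht : t ∈ Ioo 0 P.T) : deriv (u x) t = D 0 1 x t := by
  have h1 := (h.time 0 0 (by simp) (by norm_num) x hx t ⟨ht.1.le, ht.2.le⟩).hasDerivAt
    (Icc_mem_nhds ht.1 ht.2)
  refine (h1.congr_of_eventuallyEq ?_).deriv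
  filter_upwards [Icc_mem_nhds ht.1 ht.2] with s hs
  exact (h.zero x hx s hs).symm

theorem closure_Ω (P : Problem d) : closure P.Ω = Icc P.a P.b := by
  rw [Problem.Ω, closure_pi_set]
  have : ∀ k, closure (Ioo (P.a k) (P.b k)) = Icc (P.a k) (P.b k) :=
    fun k => closure_Ioo (P.a_lt_b k).ne
  simp_rw [this]
  exact pi_univ_Icc _ _

theorem laplacian_eq (h : IsDerivFamily P u D) {x : Fin d → ℝ} (hx : x ∈ P.Ω) {t : ℝ}
    (ht : t ∈ Icc 0 P.T) :
    Problem.laplacian u x t = ∑ k, D (Pi.single k 2) 0 x t := by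
  have hxc : x ∈ Icc P.a P.b := closure_Ω P ▸ subset_closure hx
  refine Finset.sum_congr rfl fun k _ => ?_
  have hxk : x k ∈ Ioo (P.a k) (P.b k) := hx k (mem_univ k)
  have h1 : ∀ i < 2, ∀ s ∈ Ioo (P.a k) (P.b k),
      HasDerivAt (fun s => D (Pi.single k i) 0 (Function.update x k s) t)
      (D (Pi.single k (i + 1)) 0 (Function.update x k s) t) s := fun i hi s hs =>
    (h.hasDeriv_line (by omega) (by omega) hxc ht ⟨hs.1.le, hs.2.le⟩).hasDerivAt
      (Icc_mem_nhds hs.1 hs.2)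
  have hn : Ioo (P.a k) (P.b k) ∈ 𝓝 (x k) := Ioo_mem_nhds hxk.1 hxk.2
  have e0 : ∀ s ∈ Ioo (P.a k) (P.b k),
      deriv (fun s => u (Function.update x k s) t) s
        = D (Pi.single k 1) 0 (Function.update x k s) t := by
    intro s hs
    refine ((h1 0 (by norm_num) s hs).congr_of_eventuallyEq ?_).deriv
    filter_upwards [Ioo_mem_nhds hs.1 hs.2] with y hy
    rw [Pi.single_zero, h.zero _ (update_mem hxc ⟨hy.1.le, hy.2.le⟩) t ht]
  rw [iteratedDeriv_succ, iteratedDeriv_one]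
  have := ((h1 1 (by norm_num) (x k) hxk).congr_of_eventuallyEq
    (f₁ := deriv fun s => u (Function.update x k s) t)
    (by filter_upwards [hn] with y hy using e0 y hy)).deriv
  rwa [Function.update_eq_self] at this

/-- The differential equation, with the derivatives replaced by their continuous extensions,
holds on the closed box. -/
theorem equation_closed (h : IsDerivFamily P u D) (hsol : P.IsSolution u) (M : Discretization P)
    {k : ℕ} (hk : k < M.n) {x : Fin d → ℝ} (hx : x ∈ Icc P.a P.b) :
    ∫ y in (0 : ℝ)..M.tσ k, M.kap k y * D 0 1 x y
      = ∑ r, D (Pi.single r 2) 0 x (M.tσ k) + P.f x (M.tσ k) := by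
  have hτ := M.tσ_pos hk
  have hτT := M.tσ_lt_T hk
  have hτm := M.tσ_mem hk
  have hcomp : IsCompact (Icc P.a P.b ×ˢ Icc 0 P.T) := isCompact_Icc.prod isCompact_Icc
  have hD1 := h.cont 0 1 (by simp) (by norm_num)
  obtain ⟨C, hC⟩ := hcomp.exists_bound_of_continuousOn hD1
  have hfix : ∀ g : (Fin d → ℝ) → ℝ → ℝ,
      ContinuousOn (fun z : (Fin d → ℝ) × ℝ => g z.1 z.2) (Icc P.a P.b ×ˢ Icc 0 P.T) →
      ∀ t ∈ Icc 0 P.T, ContinuousOn (fun x => g x t) (Icc P.a P.b) := fun g hg t ht =>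
    hg.comp (f := fun x => (x, t)) (by fun_prop) fun x hx => ⟨hx, ht⟩
  -- The averages reach boundary grid points, where the equation is not assumed. Dominated
  -- convergence, with the integrable kernel times a bound for `∂ₜu`, lets both sides be compared on
  -- the closure.
  have hL : ContinuousOn (fun x => ∫ y in (0 : ℝ)..M.tσ k, M.kap k y * D 0 1 x y)
      (Icc P.a P.b) := by
    intro x hx
    refine intervalIntegral.continuousWithinAt_of_dominated_interval
      (bound := fun y => |M.kap k y| * C) ?_ ?_ ?_ ?_
    · filter_upwards [self_mem_nhdsWithin] with x' hx'
      have hc : ContinuousOn (D 0 1 x') (uIcc 0 (M.tσ k)) := by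
        rw [uIcc_of_le hτ.le]
        exact hD1.comp (f := fun y => (x', y)) (by fun_prop) fun y hy =>
          ⟨hx', hy.1, hy.2.trans hτT.le⟩
      exact ((M.intervalIntegrable_kap hk _ _).mul_continuousOn hc).def'.aestronglyMeasurable
    · filter_upwards [self_mem_nhdsWithin] with x' hx'
      refine Eventually.of_forall fun y hy => ?_
      rw [uIoc_of_le hτ.le] at hy
      rw [norm_mul, Real.norm_eq_abs]
      exact mul_le_mul_of_nonneg_left (hC (x', y) ⟨hx', hy.1.le, hy.2.trans hτT.le⟩)
        (abs_nonneg _)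
    · exact (M.intervalIntegrable_kap hk _ _).abs.mul_const _
    · refine Eventually.of_forall fun y hy => ?_
      rw [uIoc_of_le hτ.le] at hy
      exact continuousWithinAt_const.mul
        (hfix _ hD1 y ⟨hy.1.le, hy.2.trans hτT.le⟩ x hx)
  have hR : ContinuousOn (fun x => ∑ r, D (Pi.single r 2) 0 x (M.tσ k) + P.f x (M.tσ k))
      (Icc P.a P.b) := by
    refine ContinuousOn.add (continuousOn_finsetSum _ fun r _ => ?_) (hfix _ P.f_cont _ hτm)
    exact hfix _ (h.cont (Pi.single r 2) 0 (by simp) (by norm_num)) _ hτm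
  have heq : EqOn (fun x => ∫ y in (0 : ℝ)..M.tσ k, M.kap k y * D 0 1 x y)
      (fun x => ∑ r, D (Pi.single r 2) 0 x (M.tσ k) + P.f x (M.tσ k)) P.Ω := by
    intro x hx
    have hxc : x ∈ Icc P.a P.b := closure_Ω P ▸ subset_closure hx
    have h1 := hsol.equation x hx (M.tσ k) ⟨hτ, hτT.le⟩
    rw [h.laplacian_eq hx hτm, caputo, ← intervalIntegral.integral_const_mul] at h1
    beta_reduce
    rw [← h1, intervalIntegral.integral_of_le hτ.le, intervalIntegral.integral_of_le hτ.le,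
      integral_Ioc_eq_integral_Ioo, integral_Ioc_eq_integral_Ioo]
    refine setIntegral_congr_fun measurableSet_Ioo fun y hy => ?_
    rw [h.deriv_time_eq hxc ⟨hy.1, hy.2.trans hτT⟩, Discretization.kap,
      Real.rpow_neg (by linarith [hy.2]), Discretization.ασ]
    ring
  exact heq.of_subset_closure hL hR (closure_Ω P ▸ subset_closure) (closure_Ω P ▸ subset_rfl) hx

end IsDerivFamily

namespace Discretization

variable (M : Discretization P)

/-! ### Averages as linear operators -/

theorem avg_add (r : Fin d) (v w : (Fin d → ℤ) → ℝ) :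
    M.avg r (fun j => v j + w j) = fun j => M.avg r v j + M.avg r w j := by
  funext j; simp only [avg]; split_ifs <;> ring

theorem avg_mul (r : Fin d) (c : ℝ) (v : (Fin d → ℤ) → ℝ) :
    M.avg r (fun j => c * v j) = fun j => c * M.avg r v j := by
  funext j; simp only [avg]; split_ifs <;> ring

theorem foldr_avg_add (L : List (Fin d)) (v w : (Fin d → ℤ) → ℝ) :
    L.foldr (fun l v => M.avg l v) (fun j => v j + w j)
      = fun j => L.foldr (fun l v => M.avg l v) v j + L.foldr (fun l v => M.avg l v) w j := by
  induction L with
  | nil => rfl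
  | cons r L ih => simp only [List.foldr_cons]; rw [ih, avg_add]

theorem foldr_avg_mul (L : List (Fin d)) (c : ℝ) (v : (Fin d → ℤ) → ℝ) :
    L.foldr (fun l v => M.avg l v) (fun j => c * v j)
      = fun j => c * L.foldr (fun l v => M.avg l v) v j := by
  induction L with
  | nil => rfl
  | cons r L ih => simp only [List.foldr_cons]; rw [ih, avg_mul]

theorem Ah_add (v w : (Fin d → ℤ) → ℝ) (j : Fin d → ℤ) :
    M.Ah (fun j => v j + w j) j = M.Ah v j + M.Ah w j := congrFun (M.foldr_avg_add _ v w) j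

theorem Ah_sub (v w : (Fin d → ℤ) → ℝ) (j : Fin d → ℤ) :
    M.Ah (fun j => v j - w j) j = M.Ah v j - M.Ah w j := by
  have h1 := M.Ah_add (fun j => v j - w j) w j
  simp only [sub_add_cancel] at h1
  rw [h1]; ring

theorem AhExcept_sub (k : Fin d) (v w : (Fin d → ℤ) → ℝ) (j : Fin d → ℤ) :
    M.AhExcept k (fun j => v j - w j) j = M.AhExcept k v j - M.AhExcept k w j := by
  have h1 := congrFun (M.foldr_avg_add ((List.finRange d).filter (fun l => l ≠ k))
    (fun j => v j - w j) w) j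
  simp only [sub_add_cancel] at h1
  simp only [AhExcept]
  rw [h1]; ring

theorem foldr_avg_zero (L : List (Fin d)) :
    L.foldr (fun l v => M.avg l v) (fun _ => 0) = fun _ => (0 : ℝ) := by
  have := M.foldr_avg_mul L 0 (fun _ => 0)
  simpa using this

theorem Ah_sum {ι : Type*} (s : Finset ι) (v : ι → (Fin d → ℤ) → ℝ) (j : Fin d → ℤ) :
    M.Ah (fun j => ∑ i ∈ s, v i j) j = ∑ i ∈ s, M.Ah (v i) j := by
  classical
  induction s using Finset.induction_on with
  | empty => simp [Ah, foldr_avg_zero]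
  | insert a s ha ih =>
    simp only [Finset.sum_insert ha]
    rw [Ah_add, ih]

theorem avg_comm (r s : Fin d) (w : (Fin d → ℤ) → ℝ) :
    M.avg r (M.avg s w) = M.avg s (M.avg r w) := by
  by_cases hrs : r = s
  · rw [hrs]
  funext j
  have e1 : j + Pi.single r 1 + Pi.single s 1 = j + Pi.single s 1 + Pi.single r (1 : ℤ) :=
    add_right_comm _ _ _
  have e2 : j + Pi.single r 1 - Pi.single s 1 = j - Pi.single s 1 + Pi.single r (1 : ℤ) := by
    abel
  have e3 : j - Pi.single r 1 + Pi.single s 1 = j + Pi.single s 1 - Pi.single r (1 : ℤ) := by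
    abel
  have e4 : j - Pi.single r 1 - Pi.single s 1 = j - Pi.single s 1 - Pi.single r (1 : ℤ) := by
    abel
  simp only [avg, add_single_apply_ne hrs, add_single_apply_ne (Ne.symm hrs),
    sub_single_apply_ne hrs, sub_single_apply_ne (Ne.symm hrs), e1, e2, e3, e4]
  split_ifs <;> ring

/-- The averages commute, so any direction may be applied first. Thus `A_h` acting on `∂_r² u`
becomes the remaining averages of `A_r ∂_r² u`, ready for comparison with `δ_r²`. -/
theorem Ah_eq_AhExcept (r : Fin d) (w : (Fin d → ℤ) → ℝ) : M.Ah w = M.AhExcept r (M.avg r w) := by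
  have hp : ((List.finRange d).filter (fun l => l ≠ r) ++ [r]).Perm (List.finRange d) := by
    rw [filter_ne_eq_erase]
    exact (List.perm_append_singleton _ _).trans (List.perm_cons_erase (List.mem_finRange r)).symm
  have h := hp.foldr_eq' (f := fun l v => M.avg l v) (fun x _ y _ z => M.avg_comm y x z) w
  rw [Ah, ← h, List.foldr_append]
  rfl

end Discretization
end FL21

/-! ### Truncation error and the error equation. -/

namespace FL21

open Set Filter Topology MeasureTheory
namespace Discretization

variable {d : ℕ} {P : Problem d} (M : Discretization P)

theorem FH_congr {Nlo Nhi : ℤ} {v w : ℕ → ℝ} {k : ℕ} (h : ∀ l ≤ k + 1, v l = w l) :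
    M.FH Nlo Nhi v k = M.FH Nlo Nhi w k := by
  rw [FH_eq_sum, FH_eq_sum]
  refine Finset.sum_congr rfl fun l hl => ?_
  have := Finset.mem_range.1 hl
  rw [h l (by omega), h (l + 1) (by omega)]

theorem FH_sub {Nlo Nhi : ℤ} (v w : ℕ → ℝ) (k : ℕ) :
    M.FH Nlo Nhi (fun l => v l - w l) k = M.FH Nlo Nhi v k - M.FH Nlo Nhi w k := by
  rw [FH_eq_sum, FH_eq_sum, FH_eq_sum, ← Finset.sum_sub_distrib]
  exact Finset.sum_congr rfl fun l _ => by ring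

theorem m_mul_Δx (k : Fin d) : M.m k * M.Δx k = P.b k - P.a k := by
  have : (M.m k : ℝ) ≠ 0 := by exact_mod_cast (M.m_pos k).ne'
  rw [Δx]; field_simp

theorem pt_mem {j : Fin d → ℤ} (hj : j ∈ M.Jbar) : M.pt j ∈ Icc P.a P.b := by
  rw [mem_Jbar] at hj
  refine ⟨fun k => ?_, fun k => ?_⟩
  · have h : (0 : ℝ) ≤ j k := by exact_mod_cast (Finset.mem_Icc.1 (hj k)).1
    have := mul_nonneg h (M.Δx_pos k).le
    simp only [pt]; linarith
  · have h : (j k : ℝ) ≤ M.m k := by exact_mod_cast (Finset.mem_Icc.1 (hj k)).2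
    have := mul_le_mul_of_nonneg_right h (M.Δx_pos k).le
    rw [m_mul_Δx] at this
    simp only [pt]; linarith

theorem pt_add_single (j : Fin d → ℤ) (k : Fin d) (c : ℤ) :
    M.pt (j + Pi.single k c) = Function.update (M.pt j) k (M.pt j k + c * M.Δx k) := by
  funext l
  by_cases hl : l = k
  · subst hl; simp [pt]; ring
  · simp [pt, hl]

theorem pt_mem_frontier {j : Fin d → ℤ} (hj : j ∈ M.bdJ) : M.pt j ∈ frontier P.Ω := by
  rw [bdJ, Finset.mem_sdiff] at hj
  have hopen : IsOpen P.Ω := isOpen_set_pi finite_univ fun _ _ => isOpen_Ioo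
  rw [hopen.frontier_eq, IsDerivFamily.closure_Ω]
  refine ⟨M.pt_mem hj.1, fun hmem => hj.2 ?_⟩
  have hb := M.mem_Jbar.1 hj.1
  rw [mem_J]
  intro k
  have h1 := Finset.mem_Icc.1 (hb k)
  have h2 := hmem k (mem_univ k)
  simp only [pt, mem_Ioo] at h2
  rw [Finset.mem_Icc]
  constructor
  · by_contra h
    have : j k = 0 := by omega
    simp [this] at h2
  · by_contra h
    have : j k = M.m k := by omega
    rw [this, Int.cast_natCast, m_mul_Δx] at h2
    linarith [h2.2]

theorem Δx_le_max (k : Fin d) : M.Δx k ≤ M.Δxmax :=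
  le_ciSup (finite_range M.Δx).bddAbove k

theorem order_pos : 0 < M.order := by
  have := M.ε_pos
  have : 0 < M.Δt ^ 2 := pow_pos M.Δt_pos 2
  have : 0 ≤ M.Δxmax ^ 4 := by positivity
  unfold order; linarith

theorem spatial_error {u : (Fin d → ℝ) → ℝ → ℝ} {D : (Fin d → ℕ) → ℕ → (Fin d → ℝ) → ℝ → ℝ}
    (h : IsDerivFamily P u D) {K : ℝ} (hK : ∀ (k : Fin d), ∀ i ≤ 6, ∀ p ≤ 3,
      ∀ x ∈ Icc P.a P.b, ∀ t ∈ Icc 0 P.T, |D (Pi.single k i) p x t| ≤ K)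
    {k : ℕ} (hk : k < M.n) (r : Fin d) {j : Fin d → ℤ}
    (hj : j ∈ (M.Jbar : Set (Fin d → ℤ)) ∩ M.slab r) :
    |M.avg r (fun i => D (Pi.single r 2) 0 (M.pt i) (M.tσ k)) j
      - M.δ2 r (fun i => M.σ k * M.restrict u (k + 1) i + (1 - M.σ k) * M.restrict u k i) j|
      ≤ 3 * K * M.Δx r ^ 4 + 2 * (K * M.Δt ^ 2) := by
  have hn := M.neighbours_mem_Jbar hj.1 hj.2
  have hx := M.pt_mem hj.1
  have hτ := M.tσ_mem hk
  have hkT := M.t_mem hk.le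
  have hk1T := M.t_mem (Nat.succ_le_of_lt hk)
  set x := M.pt j with hxdef
  have ep : M.pt (j + Pi.single r 1) = Function.update x r (x r + M.Δx r) := by
    rw [pt_add_single]; simp [hxdef]
  have em : M.pt (j - Pi.single r 1) = Function.update x r (x r - M.Δx r) := by
    rw [sub_single_eq, pt_add_single]; simp [hxdef, sub_eq_add_neg]
  have e0 : x = Function.update x r (x r) := (Function.update_eq_self r x).symm
  have hp : x r + M.Δx r ∈ Icc (P.a r) (P.b r) := by
    have := M.pt_mem hn.1
    rw [ep] at this
    exact ⟨by simpa using this.1 r, by simpa using this.2 r⟩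
  have hm : x r - M.Δx r ∈ Icc (P.a r) (P.b r) := by
    have := M.pt_mem hn.2
    rw [em] at this
    exact ⟨by simpa using this.1 r, by simpa using this.2 r⟩
  have hxr : x r ∈ Icc (P.a r) (P.b r) := ⟨hx.1 r, hx.2 r⟩
  have hline : ∀ t ∈ Icc 0 P.T, ∀ i < 6, ∀ y ∈ Icc (P.a r) (P.b r),
      HasDerivWithinAt (fun s => D (Pi.single r i) 0 (Function.update x r s) t)
      (D (Pi.single r (i + 1)) 0 (Function.update x r y) t) (Icc (P.a r) (P.b r)) y :=
    fun t ht i hi y hy => h.hasDeriv_line hi (by norm_num) hx ht hy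
  have h1 := compact_difference ordConnected_Icc
    (f := fun i s => D (Pi.single r i) 0 (Function.update x r s) (M.tσ k)) (hline _ hτ)
    (fun y hy => hK r 6 le_rfl 0 (by norm_num) _ (IsDerivFamily.update_mem hx hy) _ hτ)
    (M.Δx_pos r) hxr hp hm
  -- The second difference is applied to the time interpolation error of `u`. Its second space
  -- derivative is the time interpolation error of `∂_r² u`, of size `K Δt²`, so no division by
  -- `Δx²` survives.
  have h2 := second_difference_le ordConnected_Icc (K := K * M.Δt ^ 2)
    (f := fun i s => D (Pi.single r i) 0 (Function.update x r s) (M.tσ k)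
      - M.σ k * D (Pi.single r i) 0 (Function.update x r s) (M.t (k + 1))
      - (1 - M.σ k) * D (Pi.single r i) 0 (Function.update x r s) (M.t k))
    (fun i hi y hy => ((hline _ hτ i (by omega) y hy).sub
      ((hline _ hk1T i (by omega) y hy).const_mul _)).sub
      ((hline _ hkT i (by omega) y hy).const_mul _))
    (fun y hy => by
      have hxy := IsDerivFamily.update_mem hx hy
      have := linear_interpolation_le ordConnected_Icc
        (f := fun p s => D (Pi.single r 2) p (Function.update x r y) s)
        (fun p hp s hs => h.hasDeriv_time (by norm_num) (by omega) hxy hs)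
        (fun s hs => hK r 2 (by norm_num) 2 (by norm_num) _ hxy _ hs) M.Δt_pos
        ⟨(M.σ_pos hk).le, (M.σ_lt hk).le⟩ hkT (by rw [← t_succ]; exact hk1T)
      rwa [← t_succ] at this)
    (M.Δx_pos r) hxr hp hm
  have hu : ∀ l, l ≤ M.n → ∀ i ∈ M.Jbar, M.restrict u l i = D (Pi.single r 0) 0 (M.pt i) (M.t l) := by
    intro l hl i hi
    rw [Pi.single_zero, h.zero _ (M.pt_mem hi) _ (M.t_mem hl)]; rfl
  have ea : M.avg r (fun i => D (Pi.single r 2) 0 (M.pt i) (M.tσ k)) j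
      - M.δ2 r (fun i => M.σ k * M.restrict u (k + 1) i + (1 - M.σ k) * M.restrict u k i) j
      = (1 / 12 * (D (Pi.single r 2) 0 (Function.update x r (x r - M.Δx r)) (M.tσ k)
          + 10 * D (Pi.single r 2) 0 (Function.update x r (x r)) (M.tσ k)
          + D (Pi.single r 2) 0 (Function.update x r (x r + M.Δx r)) (M.tσ k))
        - 1 / M.Δx r ^ 2 * (D (Pi.single r 0) 0 (Function.update x r (x r + M.Δx r)) (M.tσ k)
          - 2 * D (Pi.single r 0) 0 (Function.update x r (x r)) (M.tσ k)
          + D (Pi.single r 0) 0 (Function.update x r (x r - M.Δx r)) (M.tσ k)))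
      + 1 / M.Δx r ^ 2 * (
          (D (Pi.single r 0) 0 (Function.update x r (x r + M.Δx r)) (M.tσ k)
            - M.σ k * D (Pi.single r 0) 0 (Function.update x r (x r + M.Δx r)) (M.t (k + 1))
            - (1 - M.σ k) * D (Pi.single r 0) 0 (Function.update x r (x r + M.Δx r)) (M.t k))
          - 2 * (D (Pi.single r 0) 0 (Function.update x r (x r)) (M.tσ k)
            - M.σ k * D (Pi.single r 0) 0 (Function.update x r (x r)) (M.t (k + 1))
            - (1 - M.σ k) * D (Pi.single r 0) 0 (Function.update x r (x r)) (M.t k))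
          + (D (Pi.single r 0) 0 (Function.update x r (x r - M.Δx r)) (M.tσ k)
            - M.σ k * D (Pi.single r 0) 0 (Function.update x r (x r - M.Δx r)) (M.t (k + 1))
            - (1 - M.σ k) * D (Pi.single r 0) 0 (Function.update x r (x r - M.Δx r)) (M.t k))) := by
    rw [avg, if_pos (show j r ∈ _ from hj.2), δ2, hu _ hk _ hj.1, hu _ hk _ hn.1, hu _ hk _ hn.2,
      hu _ hk.le _ hj.1, hu _ hk.le _ hn.1, hu _ hk.le _ hn.2, ep, em, ← hxdef, ← e0]
    ring
  rw [ea]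
  exact (abs_add_le _ _).trans (add_le_add h1 h2)

theorem truncation_error {u : (Fin d → ℝ) → ℝ → ℝ}
    {D : (Fin d → ℕ) → ℕ → (Fin d → ℝ) → ℝ → ℝ} (hd : 1 ≤ d) (hsol : P.IsSolution u)
    (h : IsDerivFamily P u D) {K : ℝ} (hK0 : 0 ≤ K) (hK : ∀ (k : Fin d), ∀ i ≤ 6, ∀ p ≤ 3,
      ∀ x ∈ Icc P.a P.b, ∀ t ∈ Icc 0 P.T, |D (Pi.single k i) p x t| ≤ K)
    {W : ℝ} (hW : ∀ k < M.n, ∫ y in (0 : ℝ)..M.tσ k, M.kap k y ≤ W)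
    {Nlo Nhi : ℤ} (hN : M.ESAAccurate Nlo Nhi) :
    M.TruncationBound Nlo Nhi u (10 * K * W + 3 * d * K) := by
  intro k hk j hj
  have hε := M.ε_pos
  have hjb := M.J_subset_Jbar hj
  set g : Fin d → (Fin d → ℤ) → ℝ := fun r i => D (Pi.single r 2) 0 (M.pt i) (M.tσ k) with hg
  set ub : (Fin d → ℤ) → ℝ :=
    fun i => M.σ k * M.restrict u (k + 1) i + (1 - M.σ k) * M.restrict u k i with hub
  set w : (Fin d → ℤ) → ℝ := fun i => M.FH Nlo Nhi (fun l => M.restrict u l i) k with hw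
  set fp : (Fin d → ℤ) → ℝ := fun i => P.f (M.pt i) (M.tσ k) with hfp
  have htime : ∀ i ∈ (M.Jbar : Set (Fin d → ℤ)), |w i - (∑ r, g r i + fp i)|
      ≤ 10 * K * (M.Δt ^ 2 + M.ε) * W := by
    intro i hi
    have hx := M.pt_mem hi
    rw [hg, hfp]
    simp only
    rw [← h.equation_closed hsol M hk hx, hw]
    have h1 : M.FH Nlo Nhi (fun l => M.restrict u l i) k
        = M.FH Nlo Nhi (fun l => D 0 0 (M.pt i) (M.t l)) k := by
      refine M.FH_congr fun l hl => ?_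
      rw [h.zero _ hx _ (M.t_mem (by omega))]; rfl
    simp only
    rw [h1]
    have hv : ∀ p < 3, ∀ y ∈ Icc 0 P.T,
        HasDerivWithinAt (D 0 p (M.pt i)) (D 0 (p + 1) (M.pt i) y) (Icc 0 P.T) y :=
      fun p hp y hy => h.time 0 p (by simp) hp _ hx y hy
    have hvK : ∀ p ≤ 3, ∀ y ∈ Icc 0 P.T, |D 0 p (M.pt i) y| ≤ K := by
      intro p hp y hy
      have := hK ⟨0, hd⟩ 0 (by norm_num) p hp _ hx y hy
      rwa [Pi.single_zero] at this
    refine (M.FH_error hN hk (v := fun p => D 0 p (M.pt i)) hv hvK).trans ?_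
    exact mul_le_mul_of_nonneg_left (hW k hk) (by positivity)
  have hA := M.abs_foldr_avg_sub_le htime (List.finRange d)
    (fun r _ i hi hir => M.neighbours_mem_Jbar hi hir) j hjb
  change |M.Ah w j - M.Ah (fun i => ∑ r, g r i + fp i) j| ≤ _ at hA
  have hS : ∀ r, |M.AhExcept r (M.avg r (g r)) j - M.AhExcept r (M.δ2 r ub) j|
      ≤ 3 * K * M.Δxmax ^ 4 + 2 * (K * M.Δt ^ 2) := by
    intro r
    refine M.abs_AhExcept_sub_le (fun i hi => (M.spatial_error h hK hk r hi).trans ?_) j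
      ⟨hjb, M.mem_J.1 hj r⟩
    have := pow_le_pow_left₀ (M.Δx_pos r).le (M.Δx_le_max r) 4
    have : 3 * K * M.Δx r ^ 4 ≤ 3 * K * M.Δxmax ^ 4 :=
      mul_le_mul_of_nonneg_left this (by positivity)
    linarith
  -- The averaged differential equation cancels the source term; a time error under `A_h` and one
  -- spatial error per direction remain, and the averages are contractions in the maximum norm.
  have e : M.residual Nlo Nhi (M.restrict u) k j
      = (M.Ah w j - M.Ah (fun i => ∑ r, g r i + fp i) j)
        + ∑ r, (M.AhExcept r (M.avg r (g r)) j - M.AhExcept r (M.δ2 r ub) j) := by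
    rw [Finset.sum_sub_distrib, Ah_add, Ah_sum, residual]
    simp_rw [← Ah_eq_AhExcept]
    simp only [Λh]
    ring
  have hsum : |∑ r, (M.AhExcept r (M.avg r (g r)) j - M.AhExcept r (M.δ2 r ub) j)|
      ≤ d * (3 * K * M.Δxmax ^ 4 + 2 * (K * M.Δt ^ 2)) := by
    refine (Finset.abs_sum_le_sum_abs _ _).trans ((Finset.sum_le_sum fun r _ => hS r).trans ?_)
    rw [Finset.sum_const, Finset.card_univ, Fintype.card_fin, nsmul_eq_mul]
  have hW0 : 0 ≤ W := (intervalIntegral.integral_nonneg (M.tσ_pos hk).le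
      fun y hy => M.kap_nonneg hk hy.2).trans (hW k hk)
  rw [e]
  refine (abs_add_le _ _).trans ((add_le_add hA hsum).trans ?_)
  have hx4 : 0 ≤ M.Δxmax ^ 4 := by positivity
  have p1 : 0 ≤ K * W * M.Δxmax ^ 4 := by positivity
  have p2 : 0 ≤ d * K * M.Δt ^ 2 := by positivity
  have p3 : 0 ≤ d * K * M.ε := by positivity
  rw [order]
  nlinarith

/-- The error of the scheme on the interior grid points, with its boundary values. -/
theorem error_eq_ext {u : (Fin d → ℝ) → ℝ → ℝ} (hsol : P.IsSolution u) {Nlo Nhi : ℤ}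
    {U : ℕ → (Fin d → ℤ) → ℝ} (hU : M.IsSchemeSolution Nlo Nhi U) {k : ℕ} (hk : k ≤ M.n) :
    ∀ j ∈ M.Jbar, M.ext (fun i => M.restrict u k i - U k i) j = M.restrict u k j - U k j := by
  intro j hj
  by_cases h : j ∈ M.J
  · exact M.ext_of_mem _ ⟨j, h⟩
  · have hb : j ∈ M.bdJ := Finset.mem_sdiff.2 ⟨hj, h⟩
    rw [ext_of_notMem _ _ h, hU.boundary k hk j hb, restrict,
      hsol.boundary _ (M.pt_mem_frontier hb) _ (M.t_mem hk), sub_zero]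

/-- Linearity cancels the source and the discrete solution. The error may be replaced by a zero
extension because exact and discrete solutions both vanish at boundary grid points. -/
theorem error_residual {u : (Fin d → ℝ) → ℝ → ℝ} (hsol : P.IsSolution u) {Nlo Nhi : ℤ}
    {U : ℕ → (Fin d → ℤ) → ℝ} (hU : M.IsSchemeSolution Nlo Nhi U) {k : ℕ} (hk : k < M.n) (j : M.J) :
    M.Ah (fun i => M.FH Nlo Nhi
        (fun l => M.ext (fun i' => M.restrict u l i' - U l i') i) k) j
      - M.Λh (fun i => M.σ k * M.ext (fun i' => M.restrict u (k + 1) i' - U (k + 1) i') i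
          + (1 - M.σ k) * M.ext (fun i' => M.restrict u k i' - U k i') i) j
      = M.residual Nlo Nhi (M.restrict u) k j := by
  have hjb := M.J_subset_Jbar j.2
  have h1 : M.Ah (fun i => M.FH Nlo Nhi
      (fun l => M.ext (fun i' => M.restrict u l i' - U l i') i) k) j
      = M.Ah (fun i => M.FH Nlo Nhi (fun l => M.restrict u l i) k) j
        - M.Ah (fun i => M.FH Nlo Nhi (fun l => U l i) k) j := by
    rw [← Ah_sub]
    refine M.Ah_congr (fun i hi => ?_) _ hjb
    rw [← FH_sub]
    exact M.FH_congr fun l hl => M.error_eq_ext hsol hU (by omega) i hi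
  have h2 : M.Λh (fun i => M.σ k * M.ext (fun i' => M.restrict u (k + 1) i' - U (k + 1) i') i
          + (1 - M.σ k) * M.ext (fun i' => M.restrict u k i' - U k i') i) j
      = M.Λh (fun i => M.σ k * M.restrict u (k + 1) i + (1 - M.σ k) * M.restrict u k i) j
        - M.Λh (fun i => M.σ k * U (k + 1) i + (1 - M.σ k) * U k i) j := by
    have h3 : ∀ v w : (Fin d → ℤ) → ℝ, M.Λh (fun i => v i - w i) j = M.Λh v j - M.Λh w j := by
      intro v w
      rw [Λh, Λh, Λh, ← Finset.sum_sub_distrib]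
      refine Finset.sum_congr rfl fun r _ => ?_
      rw [← AhExcept_sub]
      congr 1
      funext i
      simp only [δ2]; ring
    rw [← h3]
    refine M.Λh_congr (fun i hi => ?_) _ j.2
    rw [M.error_eq_ext hsol hU hk i hi, M.error_eq_ext hsol hU hk.le i hi]
    ring
  rw [h1, h2, residual, hU.scheme k hk j j.2]
  ring

end Discretization
end FL21

/-! ### Assembly of the three claims. -/

theorem mainTheorem2 {d : ℕ} (hd : 1 ≤ d) (P : FL21.Problem d)
    (u : (Fin d → ℝ) → ℝ → ℝ) (hsol : P.IsSolution u) (hreg : P.IsC63 u) :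
    -- exponential sums of the expected accuracy exist for every discretization
    (∀ M : FL21.Discretization P, ∃ Nlo Nhi : ℤ, M.ESAAccurate Nlo Nhi) ∧
    -- the local truncation errors are bounded with a constant independent of the discretization
    (∃ c₀ : ℝ, 0 < c₀ ∧ ∀ (M : FL21.Discretization P) (Nlo Nhi : ℤ),
      M.ESAAccurate Nlo Nhi → M.TruncationBound Nlo Nhi u c₀) ∧
    -- the error bounds, with any constant that bounds the local truncation errors
    (∀ (M : FL21.Discretization P) (Nlo Nhi : ℤ), M.ESAAccurate Nlo Nhi →
      ∀ U : ℕ → (Fin d → ℤ) → ℝ, M.IsSchemeSolution Nlo Nhi U →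
      ∀ c₀ : ℝ, 0 ≤ c₀ → M.TruncationBound Nlo Nhi u c₀ →
      ∀ k ≤ M.n,
        M.norm1A (fun j => M.restrict u k j - U k j)
            ≤ √((3 / 2) ^ (d - 1) * (1 / (1 - M.ε)) * P.c₁ * ∏ r, (P.b r - P.a r))
                * c₀ * M.order ∧
        M.norm1 (fun j => M.restrict u k j - U k j)
            ≤ √((3 / 2) ^ (2 * d - 1) * (1 / (1 - M.ε)) * P.c₁ * ∏ r, (P.b r - P.a r))
                * c₀ * M.order) := by
  refine ⟨fun M => M.exists_ESAAccurate, ?_, ?_⟩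
  · obtain ⟨D, hD0, hDc, hDs, hDt⟩ := hreg
    have h : FL21.IsDerivFamily P u D := ⟨hD0, hDc, hDs, hDt⟩
    obtain ⟨K, hK0, hK⟩ := h.exists_bound
    obtain ⟨W, hW0, hW⟩ := FL21.Discretization.exists_integral_kap_le P
    -- The summand 1 only makes the constant strictly positive, since `K` may be 0.
    refine ⟨10 * K * W + 3 * d * K + 1, by positivity, fun M Nlo Nhi hN k hk j hj => ?_⟩
    have h1 := M.truncation_error hd hsol h hK0 hK (hW M) hN k hk j hj
    have h2 := M.order_pos
    nlinarith
  · intro M Nlo Nhi hN U hU c₀ hc₀ hT k hk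
    set e : ℕ → M.J → ℝ := fun l i => M.restrict u l i - U l i with he
    have he0 : e 0 = 0 := by
      funext i
      have h1 : M.pt i ∈ closure P.Ω := by
        rw [FL21.IsDerivFamily.closure_Ω]
        exact M.pt_mem (M.J_subset_Jbar i.2)
      have h2 : M.t 0 = 0 := by simp [FL21.Discretization.t]
      simp only [he, FL21.Discretization.restrict, h2, hsol.initial _ h1, hU.initial _ i.2,
        sub_self, Pi.zero_apply]
    have hR0 : 0 ≤ c₀ * M.order := mul_nonneg hc₀ M.order_pos.le
    have hR : ∀ k < M.n, ∀ j : M.J,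
        |M.Ah (fun i => M.FH Nlo Nhi (fun l => M.ext (e l) i) k) j
          - M.Λh (fun i => M.σ k * M.ext (e (k + 1)) i + (1 - M.σ k) * M.ext (e k) i) j|
          ≤ c₀ * M.order := by
      intro k hk j
      rw [M.error_residual hsol hU hk j]
      exact hT k hk j j.2
    have hext : ∀ j ∈ M.Jbar, M.restrict u k j - U k j = M.ext (e k) j :=
      fun j hj => (M.error_eq_ext hsol hU hk j hj).symm
    rw [M.norm1A_congr hext, M.norm1_congr hext]
    exact ⟨(M.norm1A_le hN he0 hR0 hR hk).trans_eq (by ring),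
      (M.norm1_le hd hN he0 hR0 hR hk).trans_eq (by ring)⟩
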